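/- **Setting.** Let $(V,\eta)=\mathbb R^{1,4}$ with $\eta=\mathrm{diag}(1,-1,-1,-1,-1)$ and Clifford relation $v\cdot v=\eta(v,v)1$, let $\Sigma=\mathbb H^2$ be the irreducible Clifford module (a right quaternionic vector space) on which the volume element acts as the identity, and let $S$ be $\Sigma$ regarded as a real vector space, $\dim_{\mathbb R}S=8$; the Lie algebra $\mathfrak{sp}(1)$ of imaginary quaternions acts on $S$ from the right and commutes with $C\ell(V)$. Let $(M,g)$ be a connected five-dimensional Lorentzian spin manifold with associated real rank-8 spinor bundle $\mathbb S=\mathrm{Spin}(M)\times_{\mathrm{Spin}(V)}S$, let $C\in\Omega^2(M)$ and $F\in\Omega^1(M;\mathfrak{sp}(1))$; the data $(M,g,C,F)$ are called a background. Define the superconnection on $\mathbb S$ by $$\mathscr D_Xs=\nabla_Xs-\beta_Xs,\qquad \beta_Xs=\tfrac14X\cdot C\cdot s-\tfrac34C\cdot X\cdot s-\tfrac18X\cdot F\cdot s-\tfrac38F\cdot X\cdot s,$$ where $\nabla$ is the spin lift of the Levi-Civita connection of $g$ and $\cdot$ is Clifford multiplication, combined for $F$ with the action of $\mathfrak{sp}(1)$.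 A Killing spinor is a smooth section $s$ of $\mathbb S$ with $\mathscr Ds=0$. The background is maximally supersymmetric if its space of Killing spinors has the maximal possible dimension $\operatorname{rank}\mathbb S=\dim S=8$. **Proposition.** If $(M,g,C,F)$ is maximally supersymmetric, then $\mathscr D$ is flat: its curvature $$R^{\mathscr D}(X,Y)=\mathscr D_{[X,Y]}-[\mathscr D_X,\mathscr D_Y]\qquad (X,Y\in\mathfrak X(M))$$ vanishes. Conversely, if $M$ is simply connected and $\mathscr D$ is flat, then $(M,g,C,F)$ is maximally supersymmetric. -/

import Mathlib

open Bundle Manifold ContDiff Quaternion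

noncomputable section

namespace Susy5

/-! ### Minkowski space, its Clifford module and the spin group -/

/-- The vector space `V = ℝ^{1,4}`. -/
abbrev V : Type := Fin 5 → ℝ

/-- The diagonal entries of `η = diag(1,-1,-1,-1,-1)` (mostly minus). -/
def eta : Fin 5 → ℝ := ![1, -1, -1, -1, -1]

/-- The quadratic form `η(v,v)` on `V`. With Mathlib's convention the Clifford relation in
`CliffordAlgebra quadForm` is `v · v = η(v,v) 1`. -/
def quadForm : QuadraticForm ℝ V := QuadraticMap.weightedSumSquares ℝ eta

/-- The real eight-dimensional spinor module `S`: the two-dimensional right quaternionic vector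
space `Σ = ℍ²`, regarded as a real vector space. -/
def S : Type := Fin 2 → ℍ[ℝ]

instance : NormedAddCommGroup S := inferInstanceAs (NormedAddCommGroup (Fin 2 → ℍ[ℝ]))

instance : NormedSpace ℝ S := inferInstanceAs (NormedSpace ℝ (Fin 2 → ℍ[ℝ]))

instance : FiniteDimensional ℝ S := inferInstanceAs (FiniteDimensional ℝ (Fin 2 → ℍ[ℝ]))

theorem finrank_S : Module.finrank ℝ S = 8 := by
  change Module.finrank ℝ (Fin 2 → ℍ[ℝ]) = 8
  rw [Module.finrank_pi_fintype]
  simp [Quaternion.finrank_eq_four]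

/-- The spatial components of a vector, assembled into a quaternion. -/
def spatial (v : V) : ℍ[ℝ] := ⟨v 1, v 2, v 3, v 4⟩

@[simp] theorem spatial_re (v : V) : (spatial v).re = v 1 := rfl
@[simp] theorem spatial_imI (v : V) : (spatial v).imI = v 2 := rfl
@[simp] theorem spatial_imJ (v : V) : (spatial v).imJ = v 3 := rfl
@[simp] theorem spatial_imK (v : V) : (spatial v).imK = v 4 := rfl

/-- Clifford multiplication by `v ∈ V` on `ℍ²`: left multiplication by the quaternionic matrix
`!![t, star q; -q, -t]`, where `t = v 0` and `q = spatial v`. -/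
def gammaFun (v : V) : (Fin 2 → ℍ[ℝ]) →ₗ[ℝ] (Fin 2 → ℍ[ℝ]) where
  toFun s := ![v 0 • s 0 + star (spatial v) * s 1, -(spatial v * s 0) - v 0 • s 1]
  map_add' s t := by
    ext i : 1
    fin_cases i <;> simp [mul_add] <;> abel
  map_smul' c s := by
    ext i : 1
    fin_cases i <;> simp [smul_comm c, smul_sub]

theorem gammaFun_add (v w : V) (s : Fin 2 → ℍ[ℝ]) :
    gammaFun (v + w) s = gammaFun v s + gammaFun w s := by
  have h : spatial (v + w) = spatial v + spatial w := by
    ext <;> simp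
  ext i : 1
  fin_cases i <;> simp [gammaFun, h, add_smul, add_mul] <;> abel

theorem gammaFun_smul (c : ℝ) (v : V) (s : Fin 2 → ℍ[ℝ]) :
    gammaFun (c • v) s = c • gammaFun v s := by
  have h : spatial (c • v) = c • spatial v := by
    ext <;> simp
  ext i : 1
  fin_cases i <;> simp [gammaFun, h, mul_smul, smul_sub]

theorem gammaFun_sq (v : V) (s : Fin 2 → ℍ[ℝ]) :
    gammaFun v (gammaFun v s) = quadForm v • s := by
  have hq : quadForm v = v 0 ^ 2 - v 1 ^ 2 - v 2 ^ 2 - v 3 ^ 2 - v 4 ^ 2 := by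
    simp [quadForm, eta, QuadraticMap.weightedSumSquares_apply, Fin.sum_univ_five]
    ring
  ext i : 1
  fin_cases i <;> simp [gammaFun, hq] <;> ext <;> simp <;> ring

/-- Clifford multiplication `v ↦ Γ(v)` as a linear map from `V` to the real endomorphisms of `S`. -/
def gamma : V →ₗ[ℝ] (S →L[ℝ] S) where
  toFun v := LinearMap.toContinuousLinearMap (show S →ₗ[ℝ] S from gammaFun v)
  map_add' v w := by
    ext s : 1
    exact gammaFun_add v w s
  map_smul' c v := by
    ext s : 1
    exact gammaFun_smul c v s

theorem gamma_apply (v : V) (s : S) : gamma v s = gammaFun v s := rfl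

theorem gamma_sq (v : V) :
    gamma v * gamma v = algebraMap ℝ (S →L[ℝ] S) (quadForm v) := by
  ext s : 1
  rw [Algebra.algebraMap_eq_smul_one]
  exact gammaFun_sq v s

/-- The representation of the Clifford algebra of `(V, η)` on `S`. -/
def cliffordRep : CliffordAlgebra quadForm →ₐ[ℝ] (S →L[ℝ] S) :=
  CliffordAlgebra.lift quadForm ⟨gamma, gamma_sq⟩

/-- The gamma matrices `Γ_μ`. -/
def Γ (μ : Fin 5) : S →L[ℝ] S := gamma (Pi.single μ 1)

/-- `Γ_{μν} = ½ [Γ_μ, Γ_ν]`. -/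
def Γ₂ (μ ν : Fin 5) : S →L[ℝ] S := (1 / 2 : ℝ) • (Γ μ * Γ ν - Γ ν * Γ μ)

/-- The volume element of the Clifford algebra acts on `S` as the identity. -/
theorem volume_acts_trivially : Γ 0 * Γ 1 * Γ 2 * Γ 3 * Γ 4 = 1 := by
  have key : ∀ s : Fin 2 → ℍ[ℝ],
      gammaFun (Pi.single 0 1) (gammaFun (Pi.single 1 1) (gammaFun (Pi.single 2 1)
        (gammaFun (Pi.single 3 1) (gammaFun (Pi.single 4 1) s)))) = s := by
    intro s
    ext i : 1
    fin_cases i <;> simp [gammaFun] <;> ext <;> simp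
  ext s : 1
  exact key s

/-- The imaginary quaternions. -/
def imaginary : Submodule ℝ ℍ[ℝ] where
  carrier := {q | q.re = 0}
  zero_mem' := by simp
  add_mem' {p q} hp hq := by
    simp only [Set.mem_ofPred_eq] at hp hq ⊢
    simp [hp, hq]
  smul_mem' c q hq := by
    simp only [Set.mem_ofPred_eq] at hq ⊢
    simp [hq]

/-- The Lie algebra `𝔰𝔭(1)` of imaginary quaternions. -/
def sp1 : Type := imaginary

instance : NormedAddCommGroup sp1 := inferInstanceAs (NormedAddCommGroup imaginary)

instance : NormedSpace ℝ sp1 := inferInstanceAs (NormedSpace ℝ imaginary)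

instance : FiniteDimensional ℝ sp1 := inferInstanceAs (FiniteDimensional ℝ imaginary)

/-- The quaternion underlying an element of `𝔰𝔭(1)`. -/
def sp1.quat (q : sp1) : ℍ[ℝ] := Subtype.val (p := fun q : ℍ[ℝ] => q ∈ imaginary) q

/-- Right multiplication by a quaternion on `ℍ²`. -/
def rightMul (q : ℍ[ℝ]) : (Fin 2 → ℍ[ℝ]) →ₗ[ℝ] (Fin 2 → ℍ[ℝ]) where
  toFun s i := s i * q
  map_add' s t := by ext i : 1; simp [add_mul]
  map_smul' c s := by ext i : 1; simp

/-- The action `s ↦ s q̄ = - s q` of `𝔰𝔭(1)` on `S = ℍ²` from the right: the derivative of the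
action `s ↦ s q̄` of the group `Sp(1)` of unit quaternions. -/
def spAction (q : sp1) : S →L[ℝ] S :=
  LinearMap.toContinuousLinearMap (show S →ₗ[ℝ] S from rightMul (star q.quat))

/-- The group `Spin(V)`, the double cover of `SO(V)`: even elements `x` of the Lipschitz group (the
group generated by the non-null vectors) of spinor norm `star x * x = ±1`. -/
def spin : Subgroup (CliffordAlgebra quadForm)ˣ where
  carrier := {x | x ∈ lipschitzGroup quadForm ∧
    (x : CliffordAlgebra quadForm) ∈ CliffordAlgebra.even quadForm ∧
    (star (x : CliffordAlgebra quadForm) * x = 1 ∨ star (x : CliffordAlgebra quadForm) * x = -1)}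
  one_mem' := ⟨one_mem _, one_mem _, by simp⟩
  mul_mem' := by
    rintro x y ⟨hx, hx', hx''⟩ ⟨hy, hy', hy''⟩
    refine ⟨mul_mem hx hy, mul_mem hx' hy', ?_⟩
    have h : star ((x * y : (CliffordAlgebra quadForm)ˣ) : CliffordAlgebra quadForm)
        * ((x * y : (CliffordAlgebra quadForm)ˣ) : CliffordAlgebra quadForm)
        = star (y : CliffordAlgebra quadForm) *
          (star (x : CliffordAlgebra quadForm) * x) * y := by
      simp [mul_assoc]
    rw [h]
    rcases hx'' with hx'' | hx'' <;> rcases hy'' with hy'' | hy'' <;> simp [hx'', hy'']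
  inv_mem' := by
    rintro x ⟨hx, hx', hx''⟩
    have hs : star (x : CliffordAlgebra quadForm) ∈ CliffordAlgebra.even quadForm := by
      rw [CliffordAlgebra.star_def, CliffordAlgebra.involute_eq_of_mem_even hx']
      exact (CliffordAlgebra.reverse_mem_evenOdd_iff quadForm).2 hx'
    rcases hx'' with h | h
    · have hi : ((x⁻¹ : (CliffordAlgebra quadForm)ˣ) : CliffordAlgebra quadForm) = star ↑x :=
        Units.inv_eq_of_mul_eq_one_left h
      refine ⟨inv_mem hx, by rw [hi]; exact hs, Or.inl ?_⟩
      rw [hi, star_star, ← hi, Units.mul_inv]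
    · have hi : ((x⁻¹ : (CliffordAlgebra quadForm)ˣ) : CliffordAlgebra quadForm) = -star ↑x :=
        Units.inv_eq_of_mul_eq_one_left (by rw [neg_mul, h, neg_neg])
      refine ⟨inv_mem hx, by rw [hi]; exact neg_mem hs, Or.inr ?_⟩
      rw [hi, star_neg, star_star, neg_mul, mul_neg, neg_neg]
      rw [← neg_neg (star (x : CliffordAlgebra quadForm)), ← hi, mul_neg, Units.mul_inv]

/-! ### Lorentzian spin manifolds of dimension five -/

variable {M : Type*} [TopologicalSpace M] [ChartedSpace (EuclideanSpace ℝ (Fin 5)) M]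

variable (M) in
/-- A smooth Lorentzian metric (of signature `(+,-,-,-,-)`) on a five-dimensional manifold. -/
structure LorentzMetric [IsManifold (𝓡 5) ∞ M] where
  inner (x : M) : TangentSpace (𝓡 5) x →L[ℝ] TangentSpace (𝓡 5) x →L[ℝ] ℝ
  symm (x : M) (v w : TangentSpace (𝓡 5) x) : inner x v w = inner x w v
  lorentzian (x : M) :
    ∃ e : V ≃ₗ[ℝ] TangentSpace (𝓡 5) x, ∀ v : V, inner x (e v) (e v) = quadForm v
  contMDiff : ContMDiff (𝓡 5)
    ((𝓡 5).prod 𝓘(ℝ, EuclideanSpace ℝ (Fin 5) →L[ℝ] EuclideanSpace ℝ (Fin 5) →L[ℝ] ℝ)) ∞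
    (fun x ↦ TotalSpace.mk'
      (EuclideanSpace ℝ (Fin 5) →L[ℝ] EuclideanSpace ℝ (Fin 5) →L[ℝ] ℝ)
      (E := fun x : M ↦ TangentSpace (𝓡 5) x →L[ℝ] TangentSpace (𝓡 5) x →L[ℝ] ℝ) x (inner x))

variable (M) in
/-- A smooth two-form. -/
structure TwoForm [IsManifold (𝓡 5) ∞ M] where
  toFun (x : M) : TangentSpace (𝓡 5) x →L[ℝ] TangentSpace (𝓡 5) x →L[ℝ] ℝ
  alternating (x : M) (v : TangentSpace (𝓡 5) x) : toFun x v v = 0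
  contMDiff : ContMDiff (𝓡 5)
    ((𝓡 5).prod 𝓘(ℝ, EuclideanSpace ℝ (Fin 5) →L[ℝ] EuclideanSpace ℝ (Fin 5) →L[ℝ] ℝ)) ∞
    (fun x ↦ TotalSpace.mk'
      (EuclideanSpace ℝ (Fin 5) →L[ℝ] EuclideanSpace ℝ (Fin 5) →L[ℝ] ℝ)
      (E := fun x : M ↦ TangentSpace (𝓡 5) x →L[ℝ] TangentSpace (𝓡 5) x →L[ℝ] ℝ) x (toFun x))

variable (M) in
/-- A smooth one-form with values in `𝔰𝔭(1)`. -/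
structure SpOneForm [IsManifold (𝓡 5) ∞ M] where
  toFun (x : M) : TangentSpace (𝓡 5) x →L[ℝ] sp1
  contMDiff : ContMDiff (𝓡 5) ((𝓡 5).prod 𝓘(ℝ, EuclideanSpace ℝ (Fin 5) →L[ℝ] sp1)) ∞
    (fun x ↦ TotalSpace.mk' (EuclideanSpace ℝ (Fin 5) →L[ℝ] sp1)
      (E := fun x : M ↦ TangentSpace (𝓡 5) x →L[ℝ] sp1) x (toFun x))

variable [IsManifold (𝓡 5) ∞ M]

/-- A spin structure on `(M, g)`, given by local data: an open cover with smooth local orthonormal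
frames `frame i : U_i → SO(M)`, together with smooth `Spin(V)`-valued lifts `lift i j` of the
transition functions of these frames, subject to the cocycle condition. The lifts act on `V` through
the covering homomorphism `Spin(V) → SO(V)`, `x ↦ (v ↦ x v x⁻¹)`. In particular all frames
are compatibly oriented. Smoothness of a lift is tested in the representation `S`, which is
faithful on the even Clifford algebra. -/
structure SpinStructure (g : LorentzMetric M) (ι : Type*) where
  baseSet : ι → Set M
  isOpen_baseSet : ∀ i, IsOpen (baseSet i)
  indexAt : M → ι
  mem_baseSet_at : ∀ x, x ∈ baseSet (indexAt x)
  frame : ι → Fin 5 → ∀ x : M, TangentSpace (𝓡 5) x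
  contMDiffOn_frame : ∀ i μ, ContMDiffOn (𝓡 5) (𝓡 5).tangent ∞
    (fun x ↦ (⟨x, frame i μ x⟩ : TangentBundle (𝓡 5) M)) (baseSet i)
  orthonormal : ∀ i, ∀ x ∈ baseSet i, ∀ μ ν,
    g.inner x (frame i μ x) (frame i ν x) = if μ = ν then eta μ else 0
  lift : ι → ι → M → (CliffordAlgebra quadForm)ˣ
  lift_mem : ∀ i j, ∀ x ∈ baseSet i ∩ baseSet j, lift i j x ∈ spin
  contMDiffOn_lift : ∀ i j, ContMDiffOn (𝓡 5) 𝓘(ℝ, S →L[ℝ] S) ∞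
    (fun x ↦ cliffordRep (lift i j x : CliffordAlgebra quadForm)) (baseSet i ∩ baseSet j)
  /-- If `w = g_ij v g_ij⁻¹` then `∑ μ, v^μ e^j_μ = ∑ μ, w^μ e^i_μ`. -/
  frame_change : ∀ i j, ∀ x ∈ baseSet i ∩ baseSet j, ∀ v w : V,
    CliffordAlgebra.ι quadForm w =
      (lift i j x : CliffordAlgebra quadForm) * CliffordAlgebra.ι quadForm v
        * ((lift i j x)⁻¹ : (CliffordAlgebra quadForm)ˣ) →
    ∑ μ, v μ • frame j μ x = ∑ μ, w μ • frame i μ x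
  lift_self : ∀ i, ∀ x ∈ baseSet i, lift i i x = 1
  cocycle : ∀ i j k, ∀ x ∈ baseSet i ∩ baseSet j ∩ baseSet k,
    lift i j x * lift j k x = lift i k x

variable (M) in
/-- A bosonic background `(M, g, C, F)` with its spin structure. -/
structure Background (ι : Type*) where
  g : LorentzMetric M
  spinStr : SpinStructure g ι
  C : TwoForm M
  F : SpOneForm M

/-- The Levi-Civita connection `∇` of `g`, by the Koszul formula: the value at `x` of
`g(∇_X Y, Z)` for vector fields `X, Y, Z` that are smooth near `x`. -/
def LorentzMetric.leviCivita (g : LorentzMetric M) (X Y Z : ∀ x : M, TangentSpace (𝓡 5) x)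
    (x : M) : ℝ :=
  (1 / 2 : ℝ) *
    (mvfderiv (𝓡 5) (fun y ↦ g.inner y (Y y) (Z y)) x (X x)
      + mvfderiv (𝓡 5) (fun y ↦ g.inner y (Z y) (X y)) x (Y x)
      - mvfderiv (𝓡 5) (fun y ↦ g.inner y (X y) (Y y)) x (Z x)
      + g.inner x (VectorField.mlieBracket (𝓡 5) X Y x) (Z x)
      - g.inner x (VectorField.mlieBracket (𝓡 5) Y Z x) (X x)
      + g.inner x (VectorField.mlieBracket (𝓡 5) Z X x) (Y x))

namespace SpinStructure

variable {g : LorentzMetric M} {ι : Type*} (P : SpinStructure g ι)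

/-- The real rank-eight spinor bundle associated to the spin structure and the representation `S`:
the components of a spinor in the frames `i` and `j` are related by `s_i = lift i j · s_j`. -/
def bundleCore : VectorBundleCore ℝ M S ι where
  baseSet := P.baseSet
  isOpen_baseSet := P.isOpen_baseSet
  indexAt := P.indexAt
  mem_baseSet_at := P.mem_baseSet_at
  coordChange i j x := cliffordRep (P.lift j i x : CliffordAlgebra quadForm)
  coordChange_self i x hx v := by simp [P.lift_self i x hx]
  continuousOn_coordChange i j := by
    rw [Set.inter_comm]
    exact (P.contMDiffOn_lift j i).continuousOn
  coordChange_comp i j k x hx v := by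
    rw [← P.cocycle k j i x ⟨⟨hx.2, hx.1.2⟩, hx.1.1⟩]
    simp

instance : P.bundleCore.IsContMDiff (𝓡 5) ∞ where
  contMDiffOn_coordChange i j := by
    have h := P.contMDiffOn_lift j i
    rw [Set.inter_comm] at h
    exact h

/-- The fibre at `x` of the spinor bundle. -/
abbrev Fiber : M → Type := P.bundleCore.Fiber

instance (x : M) : IsTopologicalAddGroup (P.Fiber x) :=
  inferInstanceAs (IsTopologicalAddGroup S)

instance (x : M) : ContinuousSMul ℝ (P.Fiber x) :=
  inferInstanceAs (ContinuousSMul ℝ S)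

/-- The smooth sections of the spinor bundle, that is, the Majorana spinor fields. -/
abbrev SpinorField : Type _ := Cₛ^∞⟮𝓡 5; S, P.Fiber⟯

/-- The component `v^μ` of a tangent vector `v = ∑ μ, v^μ e_μ` in the orthonormal frame `i`. -/
def comp (i : ι) (x : M) (μ : Fin 5) : TangentSpace (𝓡 5) x →L[ℝ] ℝ :=
  eta μ • g.inner x (P.frame i μ x)

/-- The connection one-form `ω_{μν}(v) = g(e_μ, ∇_v e_ν)` of the Levi-Civita connection in the
orthonormal frame `i`. -/
def connForm (i : ι) (x : M) (μ ν : Fin 5) : TangentSpace (𝓡 5) x →L[ℝ] ℝ :=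
  ∑ ρ, g.leviCivita (P.frame i ρ) (P.frame i ν) (P.frame i μ) x • P.comp i x ρ

/-- The spin lift `¼ ω_{μν}(v) Γ^{μν}` of the connection one-form in the frame `i`. -/
def spinForm (i : ι) (x : M) (v : TangentSpace (𝓡 5) x) : S →L[ℝ] S :=
  (1 / 4 : ℝ) • ∑ μ, ∑ ν, (eta μ * eta ν * P.connForm i x μ ν v) • Γ₂ μ ν

/-- Clifford multiplication by a tangent vector, in the frame `i`. -/
def slash (i : ι) (x : M) (v : TangentSpace (𝓡 5) x) : S →L[ℝ] S :=
  ∑ μ, P.comp i x μ v • Γ μ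

theorem spinForm_add (i : ι) (x : M) (v w : TangentSpace (𝓡 5) x) :
    P.spinForm i x (v + w) = P.spinForm i x v + P.spinForm i x w := by
  simp only [spinForm, map_add, mul_add, add_smul, Finset.sum_add_distrib, smul_add]

theorem spinForm_smul (i : ι) (x : M) (c : ℝ) (v : TangentSpace (𝓡 5) x) :
    P.spinForm i x (c • v) = c • P.spinForm i x v := by
  simp only [spinForm, map_smul, smul_eq_mul, Finset.smul_sum, smul_smul]
  refine Finset.sum_congr rfl fun μ _ ↦ Finset.sum_congr rfl fun ν _ ↦ ?_
  congr 1
  ring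

theorem slash_add (i : ι) (x : M) (v w : TangentSpace (𝓡 5) x) :
    P.slash i x (v + w) = P.slash i x v + P.slash i x w := by
  simp only [slash, map_add, add_smul, Finset.sum_add_distrib]

theorem slash_smul (i : ι) (x : M) (c : ℝ) (v : TangentSpace (𝓡 5) x) :
    P.slash i x (c • v) = c • P.slash i x v := by
  simp only [slash, map_smul, smul_eq_mul, Finset.smul_sum, smul_smul]

/-- A linear map `T_xM → End(S)`, viewed as a map `𝕊_x → Hom(T_xM, 𝕊_x)` by means of the preferred
frame at `x`, in which the fibre `𝕊_x` is the vector space `S`. -/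
def toForm (x : M) (A : EuclideanSpace ℝ (Fin 5) →ₗ[ℝ] (S →L[ℝ] S)) :
    P.Fiber x →L[ℝ] TangentSpace (𝓡 5) x →L[ℝ] P.Fiber x :=
  show S →L[ℝ] EuclideanSpace ℝ (Fin 5) →L[ℝ] S from
    (LinearMap.toContinuousLinearMap A).flip

theorem toForm_apply (x : M) (A : EuclideanSpace ℝ (Fin 5) →ₗ[ℝ] (S →L[ℝ] S))
    (s : P.Fiber x) (v : TangentSpace (𝓡 5) x) : P.toForm x A s v = A v s := rfl

/-- The derivative `d s_i` at `x` of the components of a spinor field `s`, where `i` is the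
preferred frame at `x`. -/
def frameDeriv (s : ∀ x : M, P.Fiber x) (x : M) : TangentSpace (𝓡 5) x →L[ℝ] P.Fiber x :=
  show EuclideanSpace ℝ (Fin 5) →L[ℝ] S from
    mvfderiv (𝓡 5) (fun y ↦ (trivializationAt S P.Fiber x ⟨y, s y⟩).2) x

theorem isCovariantDerivativeOn_frameDeriv :
    IsCovariantDerivativeOn S (I := 𝓡 5) (V := P.Fiber) P.frameDeriv where
  add {σ τ x} hσ hτ _ := by
    rw [mdifferentiableAt_section] at hσ hτ
    have h : (fun y ↦ (trivializationAt S P.Fiber x ⟨y, (σ + τ) y⟩).2) =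
        (fun y ↦ (trivializationAt S P.Fiber x ⟨y, σ y⟩).2) +
          fun y ↦ (trivializationAt S P.Fiber x ⟨y, τ y⟩).2 := by
      funext y
      exact map_add (P.bundleCore.coordChange (P.indexAt y) (P.indexAt x) y) (σ y) (τ y)
    unfold frameDeriv
    rw [h]
    exact mvfderiv_add hσ hτ
  leibniz {σ f x} hσ hf _ := by
    rw [mdifferentiableAt_section] at hσ
    have h : (fun y ↦ (trivializationAt S P.Fiber x ⟨y, (f • σ) y⟩).2) =
        f • fun y ↦ (trivializationAt S P.Fiber x ⟨y, σ y⟩).2 := by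
      funext y
      exact map_smul (P.bundleCore.coordChange (P.indexAt y) (P.indexAt x) y) (f y) (σ y)
    have hx : (trivializationAt S P.Fiber x ⟨x, σ x⟩).2 = σ x := by
      exact P.bundleCore.coordChange_self (P.indexAt x) x (P.mem_baseSet_at x) (σ x)
    unfold frameDeriv
    rw [h]
    have h2 := mvfderiv_smul hf hσ
    rw [hx] at h2
    exact h2

/-- The spin connection `∇`, the lift of the Levi-Civita connection to the spinor bundle:
`∇_v s = d s(v) + ¼ ω_{μν}(v) Γ^{μν} s` in the frame at `x`. -/
def spinConnection : CovariantDerivative (𝓡 5) S P.Fiber where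
  toFun s x := P.frameDeriv s x + P.toForm x
    { toFun := P.spinForm (P.indexAt x) x
      map_add' := P.spinForm_add (P.indexAt x) x
      map_smul' := P.spinForm_smul (P.indexAt x) x } (s x)
  isCovariantDerivativeOnUniv := P.isCovariantDerivativeOn_frameDeriv.add_one_form _

end SpinStructure

namespace Background

variable {ι : Type*} (B : Background M ι)

/-- Clifford multiplication `½ C_{μν} Γ^{μν}` by the two-form `C`, in the frame `i`. -/
def slashC (i : ι) (x : M) : S →L[ℝ] S :=
  (1 / 2 : ℝ) • ∑ μ, ∑ ν,
    (eta μ * eta ν * B.C.toFun x (B.spinStr.frame i μ x) (B.spinStr.frame i ν x)) • Γ₂ μ ν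

/-- Clifford multiplication `F_μ Γ^μ` by the `𝔰𝔭(1)`-valued one-form `F`, in the frame `i`, where
`𝔰𝔭(1)` acts on `S` from the right. -/
def slashF (i : ι) (x : M) : S →L[ℝ] S :=
  ∑ μ, eta μ • (Γ μ * spAction (B.F.toFun x (B.spinStr.frame i μ x)))

/-- The endomorphism `β_v s = ¼ v·C·s - ¾ C·v·s - ⅛ v·F·s - ⅜ F·v·s`, in the frame `i`. -/
def betaOp (i : ι) (x : M) (v : TangentSpace (𝓡 5) x) : S →L[ℝ] S :=
  (1 / 4 : ℝ) • (B.spinStr.slash i x v * B.slashC i x)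
    - (3 / 4 : ℝ) • (B.slashC i x * B.spinStr.slash i x v)
    - (1 / 8 : ℝ) • (B.spinStr.slash i x v * B.slashF i x)
    - (3 / 8 : ℝ) • (B.slashF i x * B.spinStr.slash i x v)

theorem betaOp_add (i : ι) (x : M) (v w : TangentSpace (𝓡 5) x) :
    B.betaOp i x (v + w) = B.betaOp i x v + B.betaOp i x w := by
  simp only [betaOp, SpinStructure.slash_add, add_mul, mul_add, smul_add]
  abel

theorem betaOp_smul (i : ι) (x : M) (c : ℝ) (v : TangentSpace (𝓡 5) x) :
    B.betaOp i x (c • v) = c • B.betaOp i x v := by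
  simp only [betaOp, SpinStructure.slash_smul, smul_mul_assoc, mul_smul_comm, smul_sub,
    smul_comm c]

/-- The one-form `β` with values in the endomorphisms of the spinor bundle. -/
def beta (x : M) :
    B.spinStr.Fiber x →L[ℝ] TangentSpace (𝓡 5) x →L[ℝ] B.spinStr.Fiber x :=
  B.spinStr.toForm x
    { toFun := B.betaOp (B.spinStr.indexAt x) x
      map_add' := B.betaOp_add (B.spinStr.indexAt x) x
      map_smul' := B.betaOp_smul (B.spinStr.indexAt x) x }

/-- The superconnection `𝒟 = ∇ - β`. -/
def superconnection : CovariantDerivative (𝓡 5) S B.spinStr.Fiber :=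
  B.spinStr.spinConnection.addOneForm fun x ↦ -B.beta x

/-- The section `x ↦ (𝒟_X s)(x)`. -/
def D (X : ∀ x : M, TangentSpace (𝓡 5) x) (s : ∀ x : M, B.spinStr.Fiber x) :
    ∀ x : M, B.spinStr.Fiber x :=
  fun x ↦ B.superconnection s x (X x)

/-- The curvature `R(X, Y) s = 𝒟_{[X,Y]} s - [𝒟_X, 𝒟_Y] s` of the superconnection. -/
def curvature (X Y : ∀ x : M, TangentSpace (𝓡 5) x) (s : ∀ x : M, B.spinStr.Fiber x) :
    ∀ x : M, B.spinStr.Fiber x :=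
  B.D (VectorField.mlieBracket (𝓡 5) X Y) s - (B.D X (B.D Y s) - B.D Y (B.D X s))

/-- The superconnection is flat: its curvature vanishes, on all smooth vector fields and smooth
spinor fields. -/
def IsFlat : Prop :=
  ∀ (X Y : Cₛ^∞⟮𝓡 5; EuclideanSpace ℝ (Fin 5), (TangentSpace (𝓡 5) : M → Type)⟯)
    (s : B.spinStr.SpinorField), B.curvature X Y s = 0

/-- The real vector space of Killing spinors: smooth Majorana spinor fields `s` with `𝒟 s = 0`,
that is `∇ s = β s`. -/
def killingSpinors : Submodule ℝ B.spinStr.SpinorField where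
  carrier := {s | ∀ x, B.superconnection s x = 0}
  zero_mem' x := by
    rw [ContMDiffSection.coe_zero]
    exact congrFun B.superconnection.zero x
  add_mem' {s t} hs ht x := by
    rw [ContMDiffSection.coe_add,
      B.superconnection.isCovariantDerivativeOnUniv.add s.mdifferentiableAt t.mdifferentiableAt,
      hs x, ht x, add_zero]
  smul_mem' c s hs x := by
    rw [ContMDiffSection.coe_smul,
      B.superconnection.isCovariantDerivativeOnUniv.smul_const c s.mdifferentiableAt, hs x,
      smul_zero]

/-- A background is maximally supersymmetric if its space of Killing spinors has the maximal
possible dimension, the rank `dim S = 8` of the spinor bundle. -/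
def IsMaximallySupersymmetric : Prop :=
  Module.finrank ℝ B.killingSpinors = Module.finrank ℝ S

end Background

end Susy5

end

/-! # Flatness of the superconnection of five-dimensional backgrounds -/

noncomputable section

namespace Susy5

/-! ### The Clifford module -/

/-! A Killing spinor is a parallel section of a linear connection, so along any curve it solves a
linear ODE and is determined by its value at one point. Hence on a connected manifold, evaluation at
a point embeds the Killing spinors into the fibre `S`.

If their dimension is that of `S`, evaluation is bijective at every point, so there is a parallel
frame `K`. Writing a spinor field as `K f` turns the superconnection into the ordinary derivative of
`f`, and the curvature vanishes because `[X, Y] f = X (Y f) - Y (X f)`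
(`curvature_eq_zero_of_parallel_frame`, `mvfderiv_mlieBracket`).

Conversely, let the connection be flat. In a chart, the ODE is solved along the rays issuing from
the centre. Flatness makes the resulting section parallel in every direction, not only radially
(`norm_ray_difference_le`, `exists_parallel_of_flat`). The transitions between local parallel
families are locally constant, so these families form a covering space. Over a simply connected base
it has a section through every point (`exists_section_of_locally_constant_cocycle`), and evaluation
of Killing spinors is onto.

Both directions need the superconnection in one fixed frame near a point, whereas its definition at
`x` uses the frame preferred at `x`, which may jump with `x`. The bridge is `rep_superconnection`,
which rests on the gauge law `d h = h ω_j - ω_i h` for the spin lift `h` of a frame change. The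
classical law for the Levi-Civita form, from the Koszul formula, determines `d h` up to a multiple
of `h`: the discrepancy times `h⁻¹` commutes with all `Γ_μ` and with the right quaternions, so it is
a real scalar. The scalar vanishes because `h` preserves an invariant bilinear form up to a locally
constant sign (`lift_variation_eq`). -/

theorem gamma_mul_add_swap (v w : V) :
    gamma v * gamma w + gamma w * gamma v =
      (QuadraticMap.polar quadForm v w) • (1 : S →L[ℝ] S) := by
  have h := gamma_sq (v + w)
  simp only [map_add, add_mul, mul_add, gamma_sq] at h
  simp only [Algebra.algebraMap_eq_smul_one] at h
  simp only [QuadraticMap.polar, sub_smul]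
  rw [← h]
  abel

theorem polar_single (μ ν : Fin 5) :
    QuadraticMap.polar quadForm (Pi.single μ 1) (Pi.single ν 1) =
      if μ = ν then 2 * eta μ else 0 := by
  simp only [QuadraticMap.polar, quadForm, QuadraticMap.weightedSumSquares_apply, eta,
    Fin.sum_univ_five]
  fin_cases μ <;> fin_cases ν <;> simp <;> norm_num

theorem Γ_mul_add_swap (μ ν : Fin 5) :
    Γ μ * Γ ν + Γ ν * Γ μ = (if μ = ν then 2 * eta μ else 0) • (1 : S →L[ℝ] S) := by
  rw [Γ, Γ, gamma_mul_add_swap, polar_single]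

/-- Moving `Γ ρ` through both factors by the Clifford relation leaves only terms linear in the gamma
matrices. The commutator with `Γ₂ μ ν` is thus twice the infinitesimal rotation in the plane of `μ`
and `ν`, which is why combinations of the `Γ₂` lift `so(V)` to `S`. -/
theorem Γ₂_mul_sub_mul_Γ₂ (μ ν ρ : Fin 5) :
    Γ₂ μ ν * Γ ρ - Γ ρ * Γ₂ μ ν =
      (if ν = ρ then 2 * eta ν else 0) • Γ μ - (if μ = ρ then 2 * eta μ else 0) • Γ ν := by
  have h1 := Γ_mul_add_swap ν ρ
  have h2 := Γ_mul_add_swap μ ρ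
  have e1 : Γ ρ * Γ ν = (if ν = ρ then 2 * eta ν else 0) • (1 : S →L[ℝ] S) - Γ ν * Γ ρ := by
    rw [← h1]; abel
  have e2 : Γ ρ * Γ μ = (if μ = ρ then 2 * eta μ else 0) • (1 : S →L[ℝ] S) - Γ μ * Γ ρ := by
    rw [← h2]; abel
  generalize (if ν = ρ then 2 * eta ν else 0) = a at *
  generalize (if μ = ρ then 2 * eta μ else 0) = b at *
  have k1 : Γ ρ * (Γ μ * Γ ν) = b • Γ ν - a • Γ μ + Γ μ * Γ ν * Γ ρ := by
    rw [← mul_assoc, e2, sub_mul, mul_assoc, e1]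
    simp only [mul_sub, mul_assoc, smul_mul_assoc, mul_smul_comm, one_mul, mul_one]
    abel
  have k2 : Γ ρ * (Γ ν * Γ μ) = a • Γ μ - b • Γ ν + Γ ν * Γ μ * Γ ρ := by
    rw [← mul_assoc, e1, sub_mul, mul_assoc, e2]
    simp only [mul_sub, mul_assoc, smul_mul_assoc, mul_smul_comm, one_mul, mul_one]
    abel
  simp only [Γ₂, smul_mul_assoc, mul_smul_comm, mul_sub, sub_mul, k1, k2]
  module

theorem gamma_eq_sum (v : V) : gamma v = ∑ μ, v μ • Γ μ := by
  conv_lhs => rw [pi_eq_sum_univ' v]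
  simp only [map_sum, map_smul, Γ]

/-- Right multiplication by a quaternion, as a continuous endomorphism of `S`. -/
def rightMulL (q : ℍ[ℝ]) : S →L[ℝ] S :=
  LinearMap.toContinuousLinearMap (show S →ₗ[ℝ] S from rightMul q)

theorem gamma_commute_rightMulL (v : V) (q : ℍ[ℝ]) : Commute (gamma v) (rightMulL q) := by
  have key : ∀ s : Fin 2 → ℍ[ℝ], gammaFun v (rightMul q s) = rightMul q (gammaFun v s) := by
    intro s
    ext i : 1
    fin_cases i <;> simp [gammaFun, rightMul, add_mul, sub_mul, mul_assoc]
  ext s : 1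
  exact key s

theorem cliffordRep_commute_rightMulL (x : CliffordAlgebra quadForm) (q : ℍ[ℝ]) :
    Commute (cliffordRep x) (rightMulL q) := by
  induction x using CliffordAlgebra.induction with
  | algebraMap r => rw [AlgHom.commutes]; exact Algebra.commute_algebraMap_left _ _
  | ι v => simpa [cliffordRep] using gamma_commute_rightMulL v q
  | mul a b ha hb => rw [map_mul]; exact ha.mul_left hb
  | add a b ha hb => rw [map_add]; exact ha.add_left hb

/-- The commutant of the Clifford algebra and of the right quaternions consists of scalars. -/
theorem exists_eq_smul_of_gammaFun_comm (N : (Fin 2 → ℍ[ℝ]) →ₗ[ℝ] (Fin 2 → ℍ[ℝ]))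
    (hγ : ∀ v s, N (gammaFun v s) = gammaFun v (N s))
    (hr : ∀ q s, N (rightMul q s) = rightMul q (N s)) : ∃ c : ℝ, ∀ s, N s = c • s := by
  -- The spinor `(1, 0)` generates `ℍ²` under Clifford multiplication and the right quaternions, so
  -- `N` is determined by `n`. Since `Γ_0` fixes `(1, 0)`, it also fixes `n`, which kills the second
  -- component.
  obtain ⟨n, hn⟩ : ∃ n, n = N ![1, 0] := ⟨_, rfl⟩
  have e0 : gammaFun (Pi.single 0 1) ![1, 0] = ![1, 0] := by
    ext i : 1; fin_cases i <;> simp [gammaFun] <;> ext <;> simp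
  have hn0 : n = gammaFun (Pi.single 0 1) n := by
    have := hγ (Pi.single 0 1) ![1, 0]
    rwa [e0, ← hn] at this
  have hn1 : n 1 = 0 := by
    have h := congrFun hn0 1
    have hz : spatial (Pi.single 0 1) = 0 := by ext <;> simp
    simp only [gammaFun, LinearMap.coe_mk, AddHom.coe_mk, hz] at h
    simp at h
    have h2 : (2 : ℝ) • n 1 = 0 := by
      rw [two_smul]; nth_rewrite 1 [h]; simp
    simpa using h2
  have s1 : spatial (-Pi.single 1 1) = -1 := by ext <;> simp
  -- For `v` without time component, `v · (1, 0) = (0, -q)` is also `(0, 1)` times `-q` from the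
  -- right, and `(0, 1) = (-e_1) · (1, 0)`. Applying `N` to both forms shows that the first
  -- component of `n` commutes with every quaternion `q`, hence is real.
  have hcomm : ∀ v : V, spatial v * n 0 = n 0 * spatial v := by
    intro v
    have s2 : spatial (v - Pi.single 0 (v 0)) = spatial v := by ext <;> simp
    have e : gammaFun (v - Pi.single 0 (v 0)) ![1, 0] =
        rightMul (-(spatial v)) (gammaFun (-Pi.single 1 1) ![1, 0]) := by
      ext i : 1; fin_cases i <;> simp [gammaFun, rightMul, s1, s2]
    have h := hγ (v - Pi.single 0 (v 0)) ![1, 0]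
    rw [e, hr, hγ, ← hn] at h
    have h1 := congrFun h 1
    simp [rightMul, gammaFun, s1, s2] at h1
    exact h1.symm
  have him : n 0 = ((n 0).re : ℍ[ℝ]) := by
    have h2 := hcomm (Pi.single 2 1)
    have h3 := hcomm (Pi.single 3 1)
    have a1 := congrArg QuaternionAlgebra.imJ h2
    have a2 := congrArg QuaternionAlgebra.imK h2
    have a3 := congrArg QuaternionAlgebra.imK h3
    simp at a1 a2 a3
    ext
    · simp
    · simp; linarith
    · simp; linarith
    · simp; linarith
  have hn' : n = (n 0).re • ![1, 0] := by
    ext i : 1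
    fin_cases i
    · simp only [Fin.zero_eta, Pi.smul_apply, Matrix.cons_val_zero]
      rw [him]; ext <;> simp
    · simp [hn1]
  refine ⟨(n 0).re, fun s ↦ ?_⟩
  have hs : s = rightMul (s 0) ![1, 0] +
      gammaFun (-Pi.single 1 1) (rightMul (s 1) ![1, 0]) := by
    ext i : 1
    fin_cases i <;> simp [gammaFun, rightMul, s1]
  have hN : N s = rightMul (s 0) n + gammaFun (-Pi.single 1 1) (rightMul (s 1) n) := by
    conv_lhs => rw [hs]
    rw [map_add, hγ, hr, hr, ← hn]
  rw [hN]
  conv_rhs => rw [hs]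
  rw [hn']
  simp only [map_smul, smul_add]
  simp

theorem exists_eq_smul_one_of_commute (N : S →L[ℝ] S) (hΓ : ∀ μ, Commute N (Γ μ))
    (hq : ∀ q, Commute N (rightMulL q)) : ∃ c : ℝ, N = c • 1 := by
  have hγ : ∀ v, Commute N (gamma v) := fun v ↦ by
    rw [gamma_eq_sum]
    exact Commute.sum_right _ _ _ fun μ _ ↦ (hΓ μ).smul_right _
  obtain ⟨c, hc⟩ := exists_eq_smul_of_gammaFun_comm
    (show (Fin 2 → ℍ[ℝ]) →ₗ[ℝ] (Fin 2 → ℍ[ℝ]) from N.toLinearMap)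
    (fun v s ↦ congrArg (fun T : S →L[ℝ] S ↦ T s) (hγ v).eq)
    (fun q s ↦ congrArg (fun T : S →L[ℝ] S ↦ T s) (hq q).eq)
  exact ⟨c, ContinuousLinearMap.ext hc⟩

/-- The real bilinear form `Re (s̄₀ t₀ - s̄₁ t₁)` on `ℍ²`. -/
def spinorFormFun : (Fin 2 → ℍ[ℝ]) →ₗ[ℝ] (Fin 2 → ℍ[ℝ]) →ₗ[ℝ] ℝ :=
  LinearMap.mk₂ ℝ (fun s t ↦ (star (s 0) * t 0 - star (s 1) * t 1).re)
    (fun s s' t ↦ by simp; ring) (fun c s t ↦ by simp; ring)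
    (fun s t t' ↦ by simp; ring) (fun c s t ↦ by simp; ring)

/-- The invariant real bilinear form on `S`, for which Clifford multiplication by vectors is
self-adjoint. -/
def spinorForm : S →ₗ[ℝ] S →ₗ[ℝ] ℝ := spinorFormFun

/-- Multiplying the matrix of `v` by `diag(1, -1)` gives `!![t, star q; q, t]`, which is
quaternionic hermitian. -/
theorem spinorForm_gamma (v : V) (s t : S) :
    spinorForm (gamma v s) t = spinorForm s (gamma v t) := by
  have key : ∀ s t, spinorFormFun (gammaFun v s) t = spinorFormFun s (gammaFun v t) := by
    intro s t
    simp [gammaFun, spinorFormFun]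
    ring
  exact key s t

/-- Vectors are self-adjoint and taking adjoints reverses products, so the adjoint of `x` is its
reversal. -/
theorem spinorForm_cliffordRep (x : CliffordAlgebra quadForm) (s t : S) :
    spinorForm (cliffordRep x s) t = spinorForm s (cliffordRep (CliffordAlgebra.reverse x) t) := by
  induction x using CliffordAlgebra.induction generalizing s t with
  | algebraMap r => simp [Algebra.algebraMap_eq_smul_one]
  | ι v => simpa [cliffordRep] using spinorForm_gamma v s t
  | mul a b ha hb => simp [ha, hb]
  | add a b ha hb => simp [ha, hb]

theorem exists_spinorForm_ne_zero : ∃ s t : S, spinorForm s t ≠ 0 := by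
  have key : spinorFormFun ![1, 0] ![1, 0] ≠ 0 := by simp [spinorFormFun]
  exact ⟨_, _, key⟩

theorem spinorForm_Γ₂ (μ ν : Fin 5) (s t : S) :
    spinorForm (Γ₂ μ ν s) t = -spinorForm s (Γ₂ μ ν t) := by
  simp [Γ₂, Γ, spinorForm_gamma, mul_sub]

/-! ### The spin group acting on `S` -/

/-- On even elements reversal is `star`, so the form changes by the spinor norm `star x * x`. Both
signs occur in `spin`, hence the factor `ε`. -/
theorem spinorForm_spin {x : (CliffordAlgebra quadForm)ˣ} (hx : x ∈ spin) :
    ∃ ε : ℝ, (ε = 1 ∨ ε = -1) ∧ ∀ s t : S,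
      spinorForm (cliffordRep (x : CliffordAlgebra quadForm) s)
        (cliffordRep (x : CliffordAlgebra quadForm) t) = ε * spinorForm s t := by
  obtain ⟨-, he, h⟩ := hx
  have hs : CliffordAlgebra.reverse (x : CliffordAlgebra quadForm) =
      star (x : CliffordAlgebra quadForm) := by
    rw [CliffordAlgebra.star_def, CliffordAlgebra.involute_eq_of_mem_even he]
  have key : ∀ s t : S, spinorForm (cliffordRep (x : CliffordAlgebra quadForm) s)
        (cliffordRep (x : CliffordAlgebra quadForm) t) =
        spinorForm s (cliffordRep (star (x : CliffordAlgebra quadForm) * x) t) := by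
    intro s t
    rw [spinorForm_cliffordRep, hs, map_mul]
    rfl
  rcases h with h | h
  · exact ⟨1, Or.inl rfl, fun s t ↦ by rw [key, h]; simp⟩
  · exact ⟨-1, Or.inr rfl, fun s t ↦ by rw [key, h]; simp⟩

/-- Supplies the vector `w` that `frame_change` takes as input. -/
theorem exists_conj_of_mem_spin {x : (CliffordAlgebra quadForm)ˣ} (hx : x ∈ spin) (v : V) :
    ∃ w : V, CliffordAlgebra.ι quadForm w =
      (x : CliffordAlgebra quadForm) * CliffordAlgebra.ι quadForm v
        * ((x⁻¹ : (CliffordAlgebra quadForm)ˣ) : CliffordAlgebra quadForm) := by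
  let _ : Invertible (2 : ℝ) := invertibleOfNonzero two_ne_zero
  obtain ⟨w, hw⟩ := lipschitzGroup.conjAct_smul_ι_mem_range_ι hx.1 v
  refine ⟨w, ?_⟩
  rw [hw, ConjAct.units_smul_def, ConjAct.ofConjAct_toConjAct]

/-! ### The spin lift of an orthogonal connection matrix -/

theorem eta_mul_self (μ : Fin 5) : eta μ * eta μ = 1 := by
  fin_cases μ <;> simp [eta]

/-- The endomorphism `¼ ω_{μν} Γ^{μν}` of `S`. -/
def spinLift (a : Matrix (Fin 5) (Fin 5) ℝ) : S →L[ℝ] S :=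
  (1 / 4 : ℝ) • ∑ μ, ∑ ν, (eta μ * eta ν * a μ ν) • Γ₂ μ ν

theorem Γ₂_commute_rightMulL (μ ν : Fin 5) (q : ℍ[ℝ]) : Commute (Γ₂ μ ν) (rightMulL q) := by
  have h := fun μ ↦ gamma_commute_rightMulL (Pi.single μ 1) q
  exact (((h μ).mul_left (h ν)).sub_left ((h ν).mul_left (h μ))).smul_left _

theorem spinLift_commute_rightMulL (a : Matrix (Fin 5) (Fin 5) ℝ) (q : ℍ[ℝ]) :
    Commute (spinLift a) (rightMulL q) :=
  (Commute.sum_left _ _ _ fun μ _ ↦ Commute.sum_left _ _ _ fun ν _ ↦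
    (Γ₂_commute_rightMulL μ ν q).smul_left _).smul_left _

theorem spinorForm_spinLift (a : Matrix (Fin 5) (Fin 5) ℝ) (s t : S) :
    spinorForm (spinLift a s) t = -spinorForm s (spinLift a t) := by
  simp [spinLift, spinorForm_Γ₂, Finset.sum_neg_distrib]

/-- Each of the two terms in the commutator of `Γ₂` with `Γ ρ` contributes twice the result, the
second one by antisymmetry of `a`. The factor `1 / 4` in `spinLift` compensates exactly. -/
theorem spinLift_mul_Γ_sub (a : Matrix (Fin 5) (Fin 5) ℝ) (ha : ∀ μ ν, a μ ν = -a ν μ)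
    (ρ : Fin 5) :
    spinLift a * Γ ρ - Γ ρ * spinLift a = ∑ μ, (eta μ * a μ ρ) • Γ μ := by
  have h1 : spinLift a * Γ ρ - Γ ρ * spinLift a = (1 / 4 : ℝ) • ∑ μ, ∑ ν,
      (eta μ * eta ν * a μ ν) • (Γ₂ μ ν * Γ ρ - Γ ρ * Γ₂ μ ν) := by
    simp only [spinLift, smul_mul_assoc, mul_smul_comm, Finset.sum_mul, Finset.mul_sum, smul_sub,
      Finset.sum_sub_distrib]
  rw [h1]
  simp only [Γ₂_mul_sub_mul_Γ₂, smul_sub, Finset.sum_sub_distrib, ite_smul, zero_smul,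
    smul_ite, smul_zero, smul_smul]
  have h2 : ∑ μ, ∑ ν, (if ν = ρ then (eta μ * eta ν * a μ ν * (2 * eta ν)) • Γ μ else 0) =
      (2 : ℝ) • ∑ μ, (eta μ * a μ ρ) • Γ μ := by
    simp only [Finset.sum_ite_eq', Finset.mem_univ, if_true, Finset.smul_sum, smul_smul]
    refine Finset.sum_congr rfl fun μ _ ↦ ?_
    congr 1
    linear_combination (2 * eta μ * a μ ρ) * eta_mul_self ρ
  have h3 : ∑ μ, ∑ ν, (if μ = ρ then (eta μ * eta ν * a μ ν * (2 * eta μ)) • Γ ν else 0) =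
      -((2 : ℝ) • ∑ μ, (eta μ * a μ ρ) • Γ μ) := by
    rw [Finset.sum_comm]
    simp only [Finset.sum_ite_eq', Finset.mem_univ, if_true, Finset.smul_sum, smul_smul,
      ← Finset.sum_neg_distrib, ← neg_smul]
    refine Finset.sum_congr rfl fun μ _ ↦ ?_
    congr 1
    rw [ha ρ μ]
    linear_combination (-2 * eta μ * a μ ρ) * eta_mul_self ρ
  rw [h2, h3]
  module

theorem spinLift_mul_gamma_sub (a : Matrix (Fin 5) (Fin 5) ℝ) (ha : ∀ μ ν, a μ ν = -a ν μ)
    (u : V) :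
    spinLift a * gamma u - gamma u * spinLift a =
      gamma ((Matrix.diagonal eta * a).mulVec u) := by
  rw [gamma_eq_sum u, Finset.mul_sum, Finset.sum_mul, ← Finset.sum_sub_distrib]
  simp only [mul_smul_comm, smul_mul_assoc, ← smul_sub, spinLift_mul_Γ_sub a ha, gamma_eq_sum,
    Matrix.mulVec, dotProduct, Matrix.diagonal_mul, Finset.smul_sum, Finset.sum_smul, smul_smul]
  rw [Finset.sum_comm]
  simp only [mul_comm]

/-- A lift to `S` of an orthogonal transformation, and its first variation, intertwine the spin
lifts of two connection matrices that are related by a change of frame. -/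
theorem lift_variation_eq {h h' k : S →L[ℝ] S} {L L' a₁ a₂ : Matrix (Fin 5) (Fin 5) ℝ}
    (hk : k * h = 1) (hk' : h * k = 1)
    (hL : L.transpose * Matrix.diagonal eta * L = Matrix.diagonal eta)
    (ha₁ : ∀ μ ν, a₁ μ ν = -a₁ ν μ) (ha₂ : ∀ μ ν, a₂ μ ν = -a₂ ν μ)
    (ha : a₂ = L.transpose * a₁ * L + L.transpose * Matrix.diagonal eta * L')
    (hh : ∀ u, h * gamma u = gamma (L.mulVec u) * h)
    (hh' : ∀ u, h' * gamma u = gamma (L'.mulVec u) * h + gamma (L.mulVec u) * h')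
    (hq : ∀ q, Commute h (rightMulL q)) (hq' : ∀ q, Commute h' (rightMulL q))
    {ε : ℝ} (hε : ε ≠ 0) (hB : ∀ s t, spinorForm (h s) (h t) = ε * spinorForm s t)
    (hB' : ∀ s t, spinorForm (h' s) (h t) + spinorForm (h s) (h' t) = 0) :
    h' = h * spinLift a₂ - spinLift a₁ * h := by
  have hEE : Matrix.diagonal eta * Matrix.diagonal eta = 1 := by
    rw [Matrix.diagonal_mul_diagonal, ← Matrix.diagonal_one]
    congr 1
    funext μ
    exact eta_mul_self μ
  have hL2 : L * (Matrix.diagonal eta * L.transpose * Matrix.diagonal eta) = 1 := by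
    rw [mul_eq_one_comm, mul_assoc, mul_assoc, ← mul_assoc L.transpose, hL, hEE]
  -- On vectors the claim is the change-of-frame law `ha` solved for `L'`, using that `L` is
  -- orthogonal.
  have hmat : L' - L * (Matrix.diagonal eta * a₂) + Matrix.diagonal eta * a₁ * L = 0 := by
    have hL3 : L * Matrix.diagonal eta * L.transpose = Matrix.diagonal eta := by
      have := congrArg (· * Matrix.diagonal eta) hL2
      simp only [mul_assoc, hEE, mul_one, one_mul] at this
      rw [mul_assoc, this]
    rw [ha, mul_add, mul_add, ← mul_assoc, ← mul_assoc, ← mul_assoc, ← mul_assoc, hL3,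
      ← mul_assoc, ← mul_assoc, hL3, hEE]
    simp
  -- `N` is the defect of the claimed identity. By `hmat` the inhomogeneous terms cancel and `N`
  -- intertwines `gamma u` with `gamma (L u)` just as `h` does. So `k * N`, with `k` the inverse of
  -- `h`, lies in the commutant and is a real scalar.
  obtain ⟨N, hN⟩ : ∃ N, N = h' - h * spinLift a₂ + spinLift a₁ * h := ⟨_, rfl⟩
  have hNγ : ∀ u, N * gamma u = gamma (L.mulVec u) * N := by
    intro u
    have c1 := spinLift_mul_gamma_sub a₁ ha₁ (L.mulVec u)
    have c2 := spinLift_mul_gamma_sub a₂ ha₂ u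
    have e : N * gamma u - gamma (L.mulVec u) * N =
        gamma (L'.mulVec u) * h - h * (spinLift a₂ * gamma u - gamma u * spinLift a₂)
          + (spinLift a₁ * gamma (L.mulVec u) - gamma (L.mulVec u) * spinLift a₁) * h := by
      rw [hN, add_mul, sub_mul, hh', mul_add, mul_sub]
      have e1 : spinLift a₁ * h * gamma u = spinLift a₁ * gamma (L.mulVec u) * h := by
        rw [mul_assoc, hh, mul_assoc]
      have e2 : h * (gamma u * spinLift a₂) = gamma (L.mulVec u) * (h * spinLift a₂) := by
        rw [← mul_assoc, hh, mul_assoc]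
      rw [e1, mul_sub, e2]
      simp only [sub_mul, mul_assoc]
      abel
    rw [c1, c2, hh, ← sub_mul, ← map_sub, ← add_mul, ← map_add, Matrix.mulVec_mulVec,
      Matrix.mulVec_mulVec, ← Matrix.sub_mulVec, ← Matrix.add_mulVec, hmat, Matrix.zero_mulVec,
      map_zero, zero_mul] at e
    exact sub_eq_zero.1 e
  obtain ⟨c, hc⟩ : ∃ c : ℝ, k * N = c • 1 := by
    refine exists_eq_smul_one_of_commute _ (fun μ ↦ ?_) fun q ↦ ?_
    · have h1 : k * gamma (L.mulVec (Pi.single μ 1)) = Γ μ * k := by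
        have := congrArg (fun T ↦ k * T * k) (hh (Pi.single μ 1))
        simp only [← mul_assoc, hk, one_mul] at this
        rw [mul_assoc _ h k, hk', mul_one] at this
        exact this.symm
      change k * N * gamma (Pi.single μ 1) = Γ μ * (k * N)
      rw [mul_assoc, hNγ, ← mul_assoc, h1, mul_assoc]
    · have hkq : Commute k (rightMulL q) := by
        have := congrArg (fun T ↦ k * T * k) (hq q).eq
        simp only [← mul_assoc, hk, one_mul] at this
        rw [mul_assoc _ h k, hk', mul_one] at this
        exact this.symm
      refine hkq.mul_left ?_
      rw [hN]
      exact ((hq' q).sub_left ((hq q).mul_left (spinLift_commute_rightMulL _ q))).add_left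
        ((spinLift_commute_rightMulL _ q).mul_left (hq q))
  have hNc : N = c • h := by
    have := congrArg (h * ·) hc
    simpa [← mul_assoc, hk'] using this
  have hh'eq : h' = c • h + h * spinLift a₂ - spinLift a₁ * h := by
    rw [← hNc, hN]; abel
  -- In the first variation of the form the spin lifts drop out, being skew, and `2 c ε` times the
  -- form remains.
  have hc0 : c = 0 := by
    obtain ⟨s, t, hst⟩ := exists_spinorForm_ne_zero
    have := hB' s t
    rw [hh'eq] at this
    simp only [sub_apply, add_apply,
      smul_apply, mul_apply_eq_comp, map_add, map_sub,
      LinearMap.add_apply, LinearMap.sub_apply, map_smul, LinearMap.smul_apply, smul_eq_mul,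
      hB, spinorForm_spinLift] at this
    have h2 : 2 * c * ε * spinorForm s t = 0 := by linear_combination this
    simpa [hε, hst] using h2
  rw [hh'eq, hc0, zero_smul, zero_add]

set_option maxSynthPendingDepth 3

/-! ### Parallel sections of a connection on a trivial bundle -/

section ParallelSections

open Topology Metric Set

variable {E F : Type*} [NormedAddCommGroup E] [NormedSpace ℝ E] [NormedAddCommGroup F]
  [NormedSpace ℝ F] {A : E → E →L[ℝ] F →L[ℝ] F}

/-- A parallel section that vanishes at a point of a convex set vanishes on the whole set. -/
theorem eq_zero_of_parallel {s : Set E} (hs : Convex ℝ s) (hA : ContinuousOn A s) {σ : E → F}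
    (hσ : ∀ z ∈ s, HasFDerivAt σ (-(A z).flip (σ z)) z) {z₁ : E} (hz₁ : z₁ ∈ s) (h0 : σ z₁ = 0)
    {z : E} (hz : z ∈ s) : σ z = 0 := by
  -- On the segment from `z₁` to `z` the section solves a linear ODE whose coefficients are bounded
  -- by compactness. Grönwall's inequality then propagates the zero.
  let γ : ℝ → E := fun t ↦ z₁ + t • (z - z₁)
  have hγs : ∀ t ∈ Icc (0 : ℝ) 1, γ t ∈ s := fun t ht ↦ hs.add_smul_sub_mem hz₁ hz ht
  have hγ : ∀ t, HasDerivAt γ (z - z₁) t := fun t ↦ by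
    simpa [γ] using ((hasDerivAt_id t).smul_const (z - z₁)).const_add z₁
  have hγc : Continuous γ := continuous_iff_continuousAt.2 fun t ↦ (hγ t).continuousAt
  have hf : ∀ t ∈ Icc (0 : ℝ) 1,
      HasDerivAt (σ ∘ γ) (-(A (γ t) (z - z₁) (σ (γ t)))) t := fun t ht ↦ by
    simpa using (hσ (γ t) (hγs t ht)).comp_hasDerivAt t (hγ t)
  obtain ⟨K, hK⟩ : ∃ K, ∀ t ∈ Icc (0 : ℝ) 1, ‖A (γ t) (z - z₁)‖ ≤ K :=
    isCompact_Icc.exists_bound_of_continuousOn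
      ((hA.comp hγc.continuousOn hγs).clm_apply continuousOn_const)
  have := eq_zero_of_abs_deriv_le_mul_abs_self_of_eq_zero_right (K := K) (a := 0) (b := 1)
    (fun t ht ↦ (hf t ht).continuousAt.continuousWithinAt)
    (fun t ht ↦ (hf t (Ico_subset_Icc_self ht)).hasDerivWithinAt) (by simpa [γ] using h0)
    (fun t ht ↦ by
      rw [norm_neg]
      exact (ContinuousLinearMap.le_opNorm _ _).trans
        (mul_le_mul_of_nonneg_right (hK t (Ico_subset_Icc_self ht)) (norm_nonneg _)))
    1 (by simp)
  simpa [γ] using this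

/-- One constant controls `A`, its derivative and the Lipschitz constant of the derivative. The last
bound uses the second order of differentiability, since a `C¹` map is locally Lipschitz. -/
theorem exists_radius_of_contDiffAt {G : Type*} [NormedAddCommGroup G] [NormedSpace ℝ G]
    {A : E → G} {z₀ : E} (hA : ContDiffAt ℝ 2 A z₀) :
    ∃ ρ > 0, ∃ K > 0, (∀ z ∈ ball z₀ ρ, DifferentiableAt ℝ A z ∧ ‖A z‖ ≤ K ∧ ‖fderiv ℝ A z‖ ≤ K) ∧
      ∀ z ∈ ball z₀ ρ, ∀ z' ∈ ball z₀ ρ, ‖fderiv ℝ A z - fderiv ℝ A z'‖ ≤ K * ‖z - z'‖ := by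
  have hd : ContDiffAt ℝ 1 (fderiv ℝ A) z₀ := hA.fderiv_right (by norm_num)
  obtain ⟨C, t, ht, hC⟩ := hd.exists_lipschitzOnWith
  have h1 : ∀ᶠ z in 𝓝 z₀, DifferentiableAt ℝ A z := by
    filter_upwards [hA.eventually (by simp)] with z hz using hz.differentiableAt (by simp)
  have h2 : ∀ᶠ z in 𝓝 z₀, ‖A z‖ < ‖A z₀‖ + 1 :=
    hA.continuousAt.norm.eventually_lt continuousAt_const (by simp)
  have h3 : ∀ᶠ z in 𝓝 z₀, ‖fderiv ℝ A z‖ < ‖fderiv ℝ A z₀‖ + 1 :=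
    hd.continuousAt.norm.eventually_lt continuousAt_const (by simp)
  obtain ⟨ρ, hρ, h⟩ := Metric.eventually_nhds_iff_ball.1
    (h1.and (h2.and (h3.and (Filter.eventually_mem_set.2 ht))))
  refine ⟨ρ, hρ, max (max (‖A z₀‖ + 1) (‖fderiv ℝ A z₀‖ + 1)) C, by positivity,
    fun z hz ↦ ⟨(h z hz).1, ?_, ?_⟩, fun z hz z' hz' ↦ ?_⟩
  · exact (h z hz).2.1.le.trans ((le_max_left _ _).trans (le_max_left _ _))
  · exact (h z hz).2.2.1.le.trans ((le_max_right _ _).trans (le_max_left _ _))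
  · rw [← dist_eq_norm, ← dist_eq_norm]
    exact (hC.dist_le_mul z (h z hz).2.2.2 z' (h z' hz').2.2.2).trans
      (mul_le_mul_of_nonneg_right (le_max_right _ _) dist_nonneg)

/-- Existence of solutions of a linear differential equation with small coefficients. -/
theorem exists_linear_ode_solution [CompleteSpace F] {a : ℝ → F →L[ℝ] F}
    (ha : ContinuousOn a (Icc 0 1)) (hn : ∀ t ∈ Icc (0 : ℝ) 1, ‖a t‖ ≤ 1 / 2) (c : F) :
    ∃ α : ℝ → F, α 0 = c ∧ ∀ t ∈ Icc (0 : ℝ) 1, HasDerivWithinAt α (-(a t (α t))) (Icc 0 1) t := by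
  -- On the ball of radius `‖c‖ + 1` around `c` the vector field has norm at most `(2 ‖c‖ + 1) / 2 ≤
  -- ‖c‖ + 1`, so no solution leaves the ball within time one. The bound `1 / 2` on the coefficients
  -- is what makes the whole unit interval available.
  have hpl : IsPicardLindelof (fun t p ↦ -(a t p)) (⟨0, by simp⟩ : Icc (0 : ℝ) 1) c
      (‖c‖₊ + 1) 0 (‖c‖₊ + 1) 1 := by
    refine ⟨fun t ht ↦ ?_, fun p _ ↦ ?_, fun t ht p hp ↦ ?_, ?_⟩
    · refine LipschitzOnWith.of_dist_le_mul fun p _ q _ ↦ ?_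
      rw [dist_neg_neg, dist_eq_norm, dist_eq_norm, ← map_sub]
      refine (ContinuousLinearMap.le_opNorm _ _).trans
        (mul_le_mul_of_nonneg_right ((hn t ht).trans ?_) (norm_nonneg _))
      norm_num
    · exact (ha.clm_apply continuousOn_const).neg
    · have h1 : ‖p‖ ≤ ‖c‖ + (‖c‖ + 1) := by
        have : ‖p - c‖ ≤ ‖c‖ + 1 := by simpa [dist_eq_norm] using hp
        calc ‖p‖ = ‖c + (p - c)‖ := by simp
          _ ≤ _ := (norm_add_le _ _).trans (by linarith)
      rw [norm_neg]
      have h2 := (ContinuousLinearMap.le_opNorm (a t) p).trans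
        (mul_le_mul (hn t ht) h1 (norm_nonneg _) (by norm_num))
      refine h2.trans ?_
      simp
      linarith
    · simp
  simpa using hpl.exists_eq_forall_mem_Icc_hasDerivWithinAt₀

/-- The estimate that compares the solutions along two neighbouring rays. -/
theorem norm_ray_difference_le {z₀ y v : E} {ρ K m : ℝ} (hK : 0 < K)
    (hball : ∀ z ∈ ball z₀ ρ, DifferentiableAt ℝ A z ∧ ‖A z‖ ≤ K ∧ ‖fderiv ℝ A z‖ ≤ K)
    (hlip : ∀ z ∈ ball z₀ ρ, ∀ z' ∈ ball z₀ ρ, ‖fderiv ℝ A z - fderiv ℝ A z'‖ ≤ K * ‖z - z'‖)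
    (hflat : ∀ z ∈ ball z₀ ρ, ∀ v w p,
      fderiv ℝ A z v w p - fderiv ℝ A z w v p + (A z v (A z w p) - A z w (A z v p)) = 0)
    (hy : ‖y‖ < ρ) (hyv : ‖y + v‖ < ρ) (hyK : K * ‖y + v‖ ≤ 1) (hy1 : ‖y + v‖ ≤ 1)
    {α β : ℝ → F} (h0 : β 0 = α 0)
    (hα : ∀ t ∈ Icc (0 : ℝ) 1, HasDerivWithinAt α (-(A (z₀ + t • y) y (α t))) (Icc 0 1) t)
    (hβ : ∀ t ∈ Icc (0 : ℝ) 1,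
      HasDerivWithinAt β (-(A (z₀ + t • (y + v)) (y + v) (β t))) (Icc 0 1) t)
    (hm : ∀ t ∈ Icc (0 : ℝ) 1, ‖α t‖ ≤ m) :
    ‖β 1 - α 1 + A (z₀ + y) v (α 1)‖ ≤
      gronwallBound 0 1 ((2 * K + (K + K) * K) * m * ‖v‖ ^ 2) 1 := by
  have hyρ : ∀ t ∈ Icc (0 : ℝ) 1, z₀ + t • y ∈ ball z₀ ρ := fun t ht ↦ by
    rw [mem_ball_iff_norm, add_sub_cancel_left, norm_smul, Real.norm_of_nonneg ht.1]
    exact (mul_le_of_le_one_left (norm_nonneg _) ht.2).trans_lt hy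
  have hyvρ : ∀ t ∈ Icc (0 : ℝ) 1, z₀ + t • (y + v) ∈ ball z₀ ρ := fun t ht ↦ by
    rw [mem_ball_iff_norm, add_sub_cancel_left, norm_smul, Real.norm_of_nonneg ht.1]
    exact (mul_le_of_le_one_left (norm_nonneg _) ht.2).trans_lt hyv
  -- At time `t` the two rays differ by `t • v`, and a parallel section would change by `-A (t • v)`
  -- to first order. So `u` is the second-order error. It starts at `0`, and its value at `1` is the
  -- quantity to be estimated.
  let u : ℝ → F := fun t ↦ β t - α t + t • A (z₀ + t • y) v (α t)
  let u' : ℝ → F := fun t ↦ -(A (z₀ + t • (y + v)) (y + v) (β t)) - -(A (z₀ + t • y) y (α t)) +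
    (t • (A (z₀ + t • y) v (-(A (z₀ + t • y) y (α t))) + fderiv ℝ A (z₀ + t • y) y v (α t)) +
      (1 : ℝ) • A (z₀ + t • y) v (α t))
  have hu : ∀ t ∈ Icc (0 : ℝ) 1, HasDerivWithinAt u (u' t) (Icc 0 1) t := by
    intro t ht
    have hline : HasDerivWithinAt (fun t : ℝ ↦ z₀ + t • y) y (Icc 0 1) t := by
      simpa using (((hasDerivAt_id t).smul_const y).const_add z₀).hasDerivWithinAt
    have hAd : HasDerivWithinAt (fun t : ℝ ↦ A (z₀ + t • y)) (fderiv ℝ A (z₀ + t • y) y)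
        (Icc 0 1) t :=
      ((hball _ (hyρ t ht)).1.hasFDerivAt).comp_hasDerivWithinAt t hline
    have hAv : HasDerivWithinAt (fun t : ℝ ↦ A (z₀ + t • y) v) (fderiv ℝ A (z₀ + t • y) y v)
        (Icc 0 1) t := by
      simpa using hAd.clm_apply (hasDerivWithinAt_const t (Icc (0 : ℝ) 1) v)
    have hAα := hAv.clm_apply (hα t ht)
    have := ((hβ t ht).sub (hα t ht)).add ((hasDerivWithinAt_id t (Icc 0 1)).smul hAα)
    refine this.congr_deriv ?_
    simp only [u', id]
    rw [add_comm (fderiv ℝ A (z₀ + t • y) y v (α t))]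
  have hbound : ∀ t ∈ Ico (0 : ℝ) 1,
      ‖u' t‖ ≤ 1 * ‖u t‖ + (2 * K + (K + K) * K) * m * ‖v‖ ^ 2 := by
    intro t ht'
    have ht := Ico_subset_Icc_self ht'
    obtain ⟨x, hx⟩ : ∃ x, x = z₀ + t • y := ⟨_, rfl⟩
    obtain ⟨x', hx'⟩ : ∃ x', x' = z₀ + t • (y + v) := ⟨_, rfl⟩
    have hxx' : x' - x = t • v := by rw [hx, hx', smul_add]; abel
    have hxρ : x ∈ ball z₀ ρ := hx ▸ hyρ t ht
    have hxρ' : x' ∈ ball z₀ ρ := hx' ▸ hyvρ t ht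
    have htv : ‖x' - x‖ ≤ ‖v‖ := by
      rw [hxx', norm_smul, Real.norm_of_nonneg ht.1]
      exact mul_le_of_le_one_left (norm_nonneg _) ht.2
    obtain ⟨-, hAx, hDx⟩ := hball x hxρ
    obtain ⟨-, hAx', -⟩ := hball x' hxρ'
    have hseg : segment ℝ x x' ⊆ ball z₀ ρ := (convex_ball z₀ ρ).segment_subset hxρ hxρ'
    -- First-order Taylor remainder, quadratic because the derivative is Lipschitz.
    have ht1 : ‖A x' - A x - fderiv ℝ A x (x' - x)‖ ≤ K * ‖x' - x‖ * ‖x' - x‖ := by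
      refine (convex_segment x x').norm_image_sub_le_of_norm_fderiv_le'
        (fun w hw ↦ (hball w (hseg hw)).1) (fun w hw ↦ ?_) (left_mem_segment ℝ x x')
        (right_mem_segment ℝ x x')
      refine (hlip w (hseg hw) x hxρ).trans (mul_le_mul_of_nonneg_left ?_ hK.le)
      obtain ⟨τ, hτ, rfl⟩ := (segment_eq_image' ℝ x x' ▸ hw)
      rw [add_sub_cancel_left, norm_smul, Real.norm_of_nonneg hτ.1]
      exact mul_le_of_le_one_left (norm_nonneg _) hτ.2
    have ht2 : ‖A x' - A x‖ ≤ K * ‖x' - x‖ :=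
      (convex_ball z₀ ρ).norm_image_sub_le_of_norm_fderiv_le (fun w hw ↦ (hball w hw).1)
        (fun w hw ↦ (hball w hw).2.2) hxρ hxρ'
    -- Flatness exchanges `dA(y) v` for `dA(v) y` at the cost of a commutator. All terms linear in
    -- `v` then cancel, apart from the one containing `u` itself, and the rest is quadratic in `v`.
    have key : u' t = -(A x' (y + v) (u t))
        - ((A x' - A x - fderiv ℝ A x (x' - x)) (y + v) (α t)
            + fderiv ℝ A x (x' - x) v (α t))
        + t • ((A x' - A x) (y + v) + A x v) (A x v (α t)) := by
      have hf := hflat x hxρ y v (α t)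
      have hd : fderiv ℝ A x y v (α t) = fderiv ℝ A x v y (α t)
          - (A x y (A x v (α t)) - A x v (A x y (α t))) := by
        rw [eq_sub_iff_add_eq, ← sub_eq_zero, ← hf]
        abel
      simp only [u', u]
      rw [← hx, ← hx']
      simp only [hd, hxx', sub_apply, add_apply, map_add, map_sub, map_smul,
        smul_apply, map_neg, smul_add, smul_sub, smul_neg, one_smul]
      abel
    have b1 : ‖A x' (y + v) (u t)‖ ≤ 1 * ‖u t‖ := by
      refine (ContinuousLinearMap.le_opNorm _ _).trans
        (mul_le_mul_of_nonneg_right ?_ (norm_nonneg _))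
      exact (ContinuousLinearMap.le_of_opNorm_le _ hAx' _).trans hyK
    have hmt := hm t ht
    have hm0 : 0 ≤ m := (norm_nonneg _).trans hmt
    have b2 : ‖(A x' - A x - fderiv ℝ A x (x' - x)) (y + v) (α t)‖ ≤ K * m * ‖v‖ ^ 2 := by
      have e1 : ‖(A x' - A x - fderiv ℝ A x (x' - x)) (y + v)‖ ≤ K * ‖v‖ * ‖v‖ * 1 :=
        ((ContinuousLinearMap.le_opNorm _ _).trans
          (mul_le_mul (ht1.trans (by gcongr)) hy1 (norm_nonneg _) (by positivity)))
      refine (ContinuousLinearMap.le_of_opNorm_le_of_le _ e1 hmt).trans (le_of_eq (by ring))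
    have b3 : ‖fderiv ℝ A x (x' - x) v (α t)‖ ≤ K * m * ‖v‖ ^ 2 := by
      have e1 : ‖fderiv ℝ A x (x' - x)‖ ≤ K * ‖v‖ :=
        ContinuousLinearMap.le_of_opNorm_le_of_le _ hDx htv
      refine (ContinuousLinearMap.le_of_opNorm_le_of_le _
        (ContinuousLinearMap.le_of_opNorm_le _ e1 v) hmt).trans (le_of_eq (by ring))
    have b4 : ‖t • ((A x' - A x) (y + v) + A x v) (A x v (α t))‖ ≤ (K + K) * K * m * ‖v‖ ^ 2 := by
      have e1 : ‖(A x' - A x) (y + v) + A x v‖ ≤ K * ‖v‖ * 1 + K * ‖v‖ :=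
        (norm_add_le _ _).trans (add_le_add
          (ContinuousLinearMap.le_of_opNorm_le_of_le _ (ht2.trans (by gcongr)) hy1)
          (ContinuousLinearMap.le_of_opNorm_le _ hAx v))
      have e2 : ‖A x v (α t)‖ ≤ K * ‖v‖ * m :=
        ContinuousLinearMap.le_of_opNorm_le_of_le _
          (ContinuousLinearMap.le_of_opNorm_le _ hAx v) hmt
      rw [norm_smul, Real.norm_of_nonneg ht.1]
      refine (mul_le_of_le_one_left (norm_nonneg _) ht.2).trans ?_
      exact (ContinuousLinearMap.le_of_opNorm_le_of_le _ e1 e2).trans (le_of_eq (by ring))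
    rw [key]
    refine (norm_add_le _ _).trans ?_
    have := (norm_sub_le (-(A x' (y + v) (u t))) ((A x' - A x - fderiv ℝ A x (x' - x)) (y + v) (α t)
            + fderiv ℝ A x (x' - x) v (α t)))
    rw [norm_neg] at this
    have := norm_add_le ((A x' - A x - fderiv ℝ A x (x' - x)) (y + v) (α t))
      (fderiv ℝ A x (x' - x) v (α t))
    linarith
  -- Grönwall with rate `1`, available because `K * ‖y + v‖ ≤ 1`; the initial error is zero.
  have := norm_le_gronwallBound_of_norm_deriv_right_le (δ := 0)
    (fun t ht ↦ (hu t ht).continuousWithinAt)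
    (fun t ht ↦ ((hu t (Ico_subset_Icc_self ht)).mono_of_mem_nhdsWithin
      (Icc_mem_nhdsGE_of_mem ht))) (by simp [u, h0]) hbound 1 (by simp)
  simpa [u] using this

/-- Local existence of parallel sections of a flat connection. -/
theorem exists_parallel_of_flat [CompleteSpace F] {z₀ : E} (hA : ContDiffAt ℝ 2 A z₀)
    (hflat : ∀ᶠ z in 𝓝 z₀, ∀ v w p,
      fderiv ℝ A z v w p - fderiv ℝ A z w v p + (A z v (A z w p) - A z w (A z v p)) = 0) :
    ∃ r > 0, ∀ c : F, ∃ σ : E → F, σ z₀ = c ∧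
      ∀ z ∈ ball z₀ r, HasFDerivAt σ (-(A z).flip (σ z)) z := by
  obtain ⟨ρ₁, hρ₁, K, hK, hball₁, hlip₁⟩ := exists_radius_of_contDiffAt hA
  obtain ⟨ρ₂, hρ₂, hflat₂⟩ := Metric.eventually_nhds_iff_ball.1 hflat
  -- The bound `1 / (2 * K)` makes the coefficients of the ray equation at most `1 / 2`, as the
  -- existence lemma requires. The bound `1` serves the hypothesis `‖y + v‖ ≤ 1` of the ray
  -- comparison.
  obtain ⟨ρ, hρdef⟩ : ∃ ρ, ρ = min (min ρ₁ ρ₂) (min 1 (1 / (2 * K))) := ⟨_, rfl⟩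
  have hρ : 0 < ρ := by rw [hρdef]; positivity
  have h1 : ρ ≤ ρ₁ := hρdef ▸ (min_le_left _ _).trans (min_le_left _ _)
  have h2 : ρ ≤ ρ₂ := hρdef ▸ (min_le_left _ _).trans (min_le_right _ _)
  have h3 : ρ ≤ 1 := hρdef ▸ (min_le_right _ _).trans (min_le_left _ _)
  have h4 : K * ρ ≤ 1 / 2 := by
    have : ρ ≤ 1 / (2 * K) := hρdef ▸ (min_le_right _ _).trans (min_le_right _ _)
    calc K * ρ ≤ K * (1 / (2 * K)) := by gcongr
      _ = 1 / 2 := by field_simp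
  have hball := fun z hz ↦ hball₁ z (ball_subset_ball h1 hz)
  have hlip := fun z hz z' hz' ↦ hlip₁ z (ball_subset_ball h1 hz) z' (ball_subset_ball h1 hz')
  have hfl := fun z hz ↦ hflat₂ z (ball_subset_ball h2 hz)
  have hray : ∀ y : E, ‖y‖ < ρ → ∀ t ∈ Icc (0 : ℝ) 1, z₀ + t • y ∈ ball z₀ ρ := fun y hy t ht ↦ by
    rw [mem_ball_iff_norm, add_sub_cancel_left, norm_smul, Real.norm_of_nonneg ht.1]
    exact (mul_le_of_le_one_left (norm_nonneg _) ht.2).trans_lt hy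
  refine ⟨ρ, hρ, fun c ↦ ?_⟩
  have hex : ∀ y : E, ∃ α : ℝ → F, ‖y‖ < ρ → α 0 = c ∧ ∀ t ∈ Icc (0 : ℝ) 1,
      HasDerivWithinAt α (-(A (z₀ + t • y) y (α t))) (Icc 0 1) t := by
    intro y
    by_cases hy : ‖y‖ < ρ
    · have hc : ContinuousOn (fun t : ℝ ↦ A (z₀ + t • y) y) (Icc 0 1) := fun t ht ↦ by
        have hc : ContinuousAt (fun t : ℝ ↦ A (z₀ + t • y)) t :=
          ContinuousAt.comp (f := fun t : ℝ ↦ z₀ + t • y)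
            (hball _ (hray y hy t ht)).1.continuousAt (by fun_prop)
        exact (hc.clm_apply continuousAt_const).continuousWithinAt
      obtain ⟨α, hα⟩ := exists_linear_ode_solution hc (fun t ht ↦
        (ContinuousLinearMap.le_of_opNorm_le_of_le _ (hball _ (hray y hy t ht)).2.1
          hy.le).trans h4) c
      exact ⟨α, fun _ ↦ hα⟩
    · exact ⟨0, fun h ↦ absurd h hy⟩
  choose α hα using hex
  -- The section is the endpoint of the solution along the ray to `z`. At the centre the ray is
  -- constant and so is its solution. Elsewhere the comparison of neighbouring rays bounds the
  -- linearization error by a multiple of `‖v‖ ^ 2`, which is the derivative in all directions.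
  refine ⟨fun z ↦ α (z - z₀) 1, ?_, fun z hz ↦ ?_⟩
  · have h00 : ‖(0 : E)‖ < ρ := by simpa using hρ
    obtain ⟨h, h'⟩ := hα 0 h00
    have := eq_zero_of_abs_deriv_le_mul_abs_self_of_eq_zero_right (K := 0) (a := 0) (b := 1)
      (f := fun t ↦ α 0 t - c) (f' := fun _ ↦ 0)
      (fun t ht ↦ (h' t ht).continuousWithinAt.sub continuousWithinAt_const)
      (fun t ht ↦ by
        have := ((h' t (Ico_subset_Icc_self ht)).mono_of_mem_nhdsWithin
          (Icc_mem_nhdsGE_of_mem ht)).sub_const c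
        simpa using this)
      (by simp [h]) (by simp) 1 (by simp)
    simpa [sub_eq_zero] using this
  · obtain ⟨y, rfl⟩ : ∃ y, z = z₀ + y := ⟨z - z₀, by simp⟩
    have hy : ‖y‖ < ρ := by simpa using hz
    obtain ⟨hα0, hαd⟩ := hα y hy
    obtain ⟨m, hm⟩ := isCompact_Icc.exists_bound_of_continuousOn (s := Icc (0 : ℝ) 1) (f := α y)
      fun t ht ↦ (hαd t ht).continuousWithinAt
    rw [hasFDerivAt_iff_isLittleO_nhds_zero]
    refine Asymptotics.IsBigO.trans_isLittleO (g := fun v : E ↦ ‖v‖ ^ 2) ?_ ?_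
    · refine Asymptotics.IsBigO.of_bound
        ((2 * K + (K + K) * K) * m * (Real.exp 1 - 1)) ?_
      have hev : ∀ᶠ v in 𝓝 (0 : E), ‖y + v‖ < ρ := by
        have : ContinuousAt (fun v ↦ ‖y + v‖) (0 : E) := by fun_prop
        exact this.eventually_lt continuousAt_const (by simpa using hy)
      filter_upwards [hev] with v hv
      obtain ⟨hβ0, hβd⟩ := hα (y + v) hv
      have h5 : K * ‖y + v‖ ≤ 1 := by
        have : K * ‖y + v‖ ≤ K * ρ := by gcongr
        linarith
      have := norm_ray_difference_le hK hball hlip hfl hy hv h5 (hv.le.trans h3)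
        (hβ0.trans hα0.symm) hαd hβd hm
      rw [gronwallBound_of_K_ne_0 one_ne_zero] at this
      simp only [add_assoc, add_sub_cancel_left, neg_apply, ContinuousLinearMap.flip_apply,
        sub_neg_eq_add]
      refine this.trans (le_of_eq ?_)
      simp
      ring
    · exact Asymptotics.isLittleO_norm_pow_id one_lt_two

end ParallelSections

/-! ### Lorentzian geometry in orthonormal frames -/

open VectorField

variable {M : Type*} [TopologicalSpace M] [ChartedSpace (EuclideanSpace ℝ (Fin 5)) M]
  [IsManifold (𝓡 5) ∞ M]

instance : IsManifold (𝓡 5) 1 M := IsManifold.of_le (n := ∞) (by simp)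

instance : IsManifold (𝓡 5) 2 M :=
  IsManifold.of_le (n := ∞) (WithTop.coe_le_coe.2 (le_top : (2 : ℕ∞) ≤ ⊤))

theorem LorentzMetric.contMDiffAt_inner (g : LorentzMetric M) {X Y : ∀ x : M, TangentSpace (𝓡 5) x}
    {x : M}
    (hX : ContMDiffAt (𝓡 5) (𝓡 5).tangent ∞ (fun x ↦ (⟨x, X x⟩ : TangentBundle (𝓡 5) M)) x)
    (hY : ContMDiffAt (𝓡 5) (𝓡 5).tangent ∞ (fun x ↦ (⟨x, Y x⟩ : TangentBundle (𝓡 5) M)) x) :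
    ContMDiffAt (𝓡 5) 𝓘(ℝ, ℝ) ∞ (fun y ↦ g.inner y (X y) (Y y)) x := by
  have h := ContMDiffAt.clm_bundle_apply₂ (F₁ := EuclideanSpace ℝ (Fin 5))
    (F₂ := EuclideanSpace ℝ (Fin 5)) (F₃ := ℝ) (E₃ := fun _ : M ↦ ℝ) (g.contMDiff x) hX hY
  rw [contMDiffAt_totalSpace] at h
  exact h.2

theorem TwoForm.contMDiffAt_apply (g : TwoForm M) {X Y : ∀ x : M, TangentSpace (𝓡 5) x}
    {x : M}
    (hX : ContMDiffAt (𝓡 5) (𝓡 5).tangent ∞ (fun x ↦ (⟨x, X x⟩ : TangentBundle (𝓡 5) M)) x)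
    (hY : ContMDiffAt (𝓡 5) (𝓡 5).tangent ∞ (fun x ↦ (⟨x, Y x⟩ : TangentBundle (𝓡 5) M)) x) :
    ContMDiffAt (𝓡 5) 𝓘(ℝ, ℝ) ∞ (fun y ↦ g.toFun y (X y) (Y y)) x := by
  have h := ContMDiffAt.clm_bundle_apply₂ (F₁ := EuclideanSpace ℝ (Fin 5))
    (F₂ := EuclideanSpace ℝ (Fin 5)) (F₃ := ℝ) (E₃ := fun _ : M ↦ ℝ) (g.contMDiff x) hX hY
  rw [contMDiffAt_totalSpace] at h
  exact h.2

theorem SpOneForm.contMDiffAt_apply (g : SpOneForm M) {X : ∀ x : M, TangentSpace (𝓡 5) x}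
    {x : M}
    (hX : ContMDiffAt (𝓡 5) (𝓡 5).tangent ∞ (fun x ↦ (⟨x, X x⟩ : TangentBundle (𝓡 5) M)) x) :
    ContMDiffAt (𝓡 5) 𝓘(ℝ, sp1) ∞ (fun y ↦ g.toFun y (X y)) x := by
  have h := ContMDiffAt.clm_bundle_apply (F₁ := EuclideanSpace ℝ (Fin 5))
    (F₂ := sp1) (E₂ := fun _ : M ↦ sp1) (g.contMDiff x) hX
  rw [contMDiffAt_totalSpace] at h
  exact h.2

theorem mlieBracket_sum_smul_right {κ : Type*} (s : Finset κ) {X : ∀ x : M, TangentSpace (𝓡 5) x}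
    {f : κ → M → ℝ} {Y : κ → ∀ x : M, TangentSpace (𝓡 5) x} {x : M}
    (hf : ∀ a ∈ s, MDifferentiableAt (𝓡 5) 𝓘(ℝ, ℝ) (f a) x)
    (hY : ∀ a ∈ s, MDifferentiableAt (𝓡 5) (𝓡 5).tangent
      (fun x ↦ (⟨x, Y a x⟩ : TangentBundle (𝓡 5) M)) x) :
    mlieBracket (𝓡 5) X (fun y ↦ ∑ a ∈ s, f a y • Y a y) x =
      ∑ a ∈ s, (mvfderiv (𝓡 5) (f a) x (X x) • Y a x + f a x • mlieBracket (𝓡 5) X (Y a) x) := by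
  classical
  induction s using Finset.induction_on with
  | empty =>
    simp only [Finset.sum_empty]
    exact congrFun (mlieBracket_zero_right (I := 𝓡 5) (W := X)) x
  | insert a s ha ih =>
    have h1 : (fun y ↦ ∑ a ∈ insert a s, f a y • Y a y) =
        f a • Y a + fun y ↦ ∑ a ∈ s, f a y • Y a y := by
      funext y
      simp [Finset.sum_insert ha]
    rw [h1, mlieBracket_add_right, mlieBracket_smul_right, ih, Finset.sum_insert ha]
    · exact fun b hb ↦ hf b (Finset.mem_insert_of_mem hb)
    · exact fun b hb ↦ hY b (Finset.mem_insert_of_mem hb)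
    · exact hf a (Finset.mem_insert_self _ _)
    · exact hY a (Finset.mem_insert_self _ _)
    · exact (hf a (Finset.mem_insert_self _ _)).smul_section (hY a (Finset.mem_insert_self _ _))
    · exact MDifferentiableAt.sum_section fun b hb ↦
        (hf b (Finset.mem_insert_of_mem hb)).smul_section (hY b (Finset.mem_insert_of_mem hb))

theorem mlieBracket_sum_smul_left {κ : Type*} (s : Finset κ) {X : ∀ x : M, TangentSpace (𝓡 5) x}
    {f : κ → M → ℝ} {Y : κ → ∀ x : M, TangentSpace (𝓡 5) x} {x : M}
    (hf : ∀ a ∈ s, MDifferentiableAt (𝓡 5) 𝓘(ℝ, ℝ) (f a) x)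
    (hY : ∀ a ∈ s, MDifferentiableAt (𝓡 5) (𝓡 5).tangent
      (fun x ↦ (⟨x, Y a x⟩ : TangentBundle (𝓡 5) M)) x) :
    mlieBracket (𝓡 5) (fun y ↦ ∑ a ∈ s, f a y • Y a y) X x =
      ∑ a ∈ s, (f a x • mlieBracket (𝓡 5) (Y a) X x - mvfderiv (𝓡 5) (f a) x (X x) • Y a x) := by
  rw [mlieBracket_swap_apply, mlieBracket_sum_smul_right s hf hY, ← Finset.sum_neg_distrib]
  refine Finset.sum_congr rfl fun a _ ↦ ?_
  rw [mlieBracket_swap_apply (V := Y a)]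
  module

namespace SpinStructure

variable {g : LorentzMetric M} {ι : Type*} (P : SpinStructure g ι)

theorem contMDiffAt_frame {i : ι} {x : M} (hx : x ∈ P.baseSet i) (μ : Fin 5) :
    ContMDiffAt (𝓡 5) (𝓡 5).tangent ∞
      (fun x ↦ (⟨x, P.frame i μ x⟩ : TangentBundle (𝓡 5) M)) x :=
  (P.contMDiffOn_frame i μ).contMDiffAt ((P.isOpen_baseSet i).mem_nhds hx)

theorem comp_frame {i : ι} {x : M} (hx : x ∈ P.baseSet i) (μ ν : Fin 5) :
    P.comp i x μ (P.frame i ν x) = if μ = ν then 1 else 0 := by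
  change eta μ * g.inner x (P.frame i μ x) (P.frame i ν x) = _
  rw [P.orthonormal i x hx]
  split_ifs with h
  · exact eta_mul_self μ
  · simp

theorem sum_comp_smul_frame {i : ι} {x : M} (hx : x ∈ P.baseSet i) (v : TangentSpace (𝓡 5) x) :
    ∑ μ, P.comp i x μ v • P.frame i μ x = v := by
  have hli : LinearIndependent ℝ fun μ ↦ P.frame i μ x := by
    rw [Fintype.linearIndependent_iff]
    intro c hc μ
    have := congrArg (P.comp i x μ) hc
    simpa [P.comp_frame hx] using this
  have hcard : Fintype.card (Fin 5) = Module.finrank ℝ (TangentSpace (𝓡 5) x) := by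
    change _ = Module.finrank ℝ (EuclideanSpace ℝ (Fin 5))
    simp
  have : FiniteDimensional ℝ (TangentSpace (𝓡 5) x) :=
    inferInstanceAs (FiniteDimensional ℝ (EuclideanSpace ℝ (Fin 5)))
  let b := basisOfLinearIndependentOfCardEqFinrank hli hcard
  have hb : ∀ μ, b μ = P.frame i μ x := fun μ ↦ by simp [b]
  have hv := b.sum_repr v
  simp only [hb] at hv
  have hc : ∀ μ, P.comp i x μ v = b.repr v μ := by
    intro μ
    conv_lhs => rw [← hv]
    simp [P.comp_frame hx]
  simpa only [hc] using hv

theorem inner_eq_eta_mul_comp (i : ι) (x : M) (μ : Fin 5) (v : TangentSpace (𝓡 5) x) :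
    g.inner x (P.frame i μ x) v = eta μ * P.comp i x μ v := by
  change _ = eta μ * (eta μ * g.inner x (P.frame i μ x) v)
  rw [← mul_assoc, eta_mul_self, one_mul]

/-- The coefficients `Λ^α_μ` of the frame `j` with respect to the frame `i`. -/
def transition (i j : ι) (x : M) (α μ : Fin 5) : ℝ := P.comp i x α (P.frame j μ x)

theorem frame_eq_sum_transition {i : ι} (j : ι) {x : M} (hx : x ∈ P.baseSet i) (μ : Fin 5) :
    P.frame j μ x = ∑ α, P.transition i j x α μ • P.frame i α x :=
  (P.sum_comp_smul_frame hx _).symm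

theorem comp_eq_sum_transition {i j : ι} {x : M} (hj : x ∈ P.baseSet j)
    (α : Fin 5) (v : TangentSpace (𝓡 5) x) :
    P.comp i x α v = ∑ μ, P.transition i j x α μ * P.comp j x μ v := by
  conv_lhs => rw [← P.sum_comp_smul_frame hj v]
  simp [transition, mul_comm]

theorem contMDiffAt_comp {i : ι} {x : M} (hi : x ∈ P.baseSet i) {X : ∀ x : M, TangentSpace (𝓡 5) x}
    (hX : ContMDiffAt (𝓡 5) (𝓡 5).tangent ∞ (fun x ↦ (⟨x, X x⟩ : TangentBundle (𝓡 5) M)) x)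
    (μ : Fin 5) :
    ContMDiffAt (𝓡 5) 𝓘(ℝ, ℝ) ∞ (fun y ↦ P.comp i y μ (X y)) x :=
  contMDiffAt_const.mul (g.contMDiffAt_inner (P.contMDiffAt_frame hi μ) hX)

theorem contMDiffAt_transition {i j : ι} {x : M} (hi : x ∈ P.baseSet i) (hj : x ∈ P.baseSet j)
    (α μ : Fin 5) :
    ContMDiffAt (𝓡 5) 𝓘(ℝ, ℝ) ∞ (fun y ↦ P.transition i j y α μ) x :=
  P.contMDiffAt_comp hi (P.contMDiffAt_frame hj μ) α

theorem transition_orthogonal {i j : ι} {x : M} (hi : x ∈ P.baseSet i) (hj : x ∈ P.baseSet j) :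
    (Matrix.of (P.transition i j x)).transpose * Matrix.diagonal eta *
      Matrix.of (P.transition i j x) =
      Matrix.diagonal eta := by
  ext μ ν
  have h : g.inner x (P.frame j μ x) (P.frame j ν x) =
      ∑ α, P.transition i j x α μ * (eta α * P.transition i j x α ν) := by
    rw [P.frame_eq_sum_transition j hi μ]
    simp [inner_eq_eta_mul_comp, transition]
  rw [P.orthonormal j x hj] at h
  rw [Matrix.mul_assoc, Matrix.mul_apply, Matrix.diagonal_apply, h]
  simp [Matrix.diagonal_mul]

end SpinStructure

/-! ### Change of frame for the Levi-Civita connection form -/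

open VectorField Topology

variable {M : Type*} [TopologicalSpace M] [ChartedSpace (EuclideanSpace ℝ (Fin 5)) M]
  [IsManifold (𝓡 5) ∞ M]

omit [IsManifold (𝓡 5) ∞ M] in
theorem mvfderiv_congr {F : Type*} [NormedAddCommGroup F] [NormedSpace ℝ F] {f f' : M → F} {x : M}
    (h : f =ᶠ[𝓝 x] f') : mvfderiv (𝓡 5) f x = mvfderiv (𝓡 5) f' x := by
  simp only [mvfderiv, h.mfderiv_eq]
  rw [h.eq_of_nhds]

omit [IsManifold (𝓡 5) ∞ M] in
theorem mdifferentiableAt_finset_sum {F κ : Type*} [NormedAddCommGroup F] [NormedSpace ℝ F]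
    (s : Finset κ) {f : κ → M → F} {x : M}
    (hf : ∀ a ∈ s, MDifferentiableAt (𝓡 5) 𝓘(ℝ, F) (f a) x) :
    MDifferentiableAt (𝓡 5) 𝓘(ℝ, F) (fun y ↦ ∑ a ∈ s, f a y) x := by
  classical
  induction s using Finset.induction_on with
  | empty => simpa using mdifferentiableAt_const
  | insert a s ha ih =>
    simp only [Finset.sum_insert ha]
    exact (hf a (Finset.mem_insert_self _ _)).add
      (ih fun b hb ↦ hf b (Finset.mem_insert_of_mem hb))

omit [IsManifold (𝓡 5) ∞ M] in
theorem mvfderiv_finset_sum {F κ : Type*} [NormedAddCommGroup F] [NormedSpace ℝ F] (s : Finset κ)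
    {f : κ → M → F} {x : M} (hf : ∀ a ∈ s, MDifferentiableAt (𝓡 5) 𝓘(ℝ, F) (f a) x) :
    mvfderiv (𝓡 5) (fun y ↦ ∑ a ∈ s, f a y) x = ∑ a ∈ s, mvfderiv (𝓡 5) (f a) x := by
  classical
  induction s using Finset.induction_on with
  | empty => simpa using mvfderiv_const 0
  | insert a s ha ih =>
    have h : ∀ b ∈ s, MDifferentiableAt (𝓡 5) 𝓘(ℝ, F) (f b) x :=
      fun b hb ↦ hf b (Finset.mem_insert_of_mem hb)
    simp only [Finset.sum_insert ha]
    rw [mvfderiv_fun_add (hf a (Finset.mem_insert_self _ _)) (mdifferentiableAt_finset_sum s h),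
      ih h]

namespace SpinStructure

variable {g : LorentzMetric M} {ι : Type*} (P : SpinStructure g ι)

/-- The structure functions `g([e_ρ, e_ν], e_μ)` of an orthonormal frame. -/
def structFun (i : ι) (x : M) (ρ ν μ : Fin 5) : ℝ :=
  g.inner x (mlieBracket (𝓡 5) (P.frame i ρ) (P.frame i ν) x) (P.frame i μ x)

theorem structFun_swap (i : ι) (x : M) (ρ ν μ : Fin 5) :
    P.structFun i x ρ ν μ = -P.structFun i x ν ρ μ := by
  rw [structFun, mlieBracket_swap_apply]
  simp [structFun]

/-- The inner products of an orthonormal frame are locally constant, so only the brackets survive in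
the Koszul formula. -/
theorem leviCivita_frame {i : ι} {x : M} (hx : x ∈ P.baseSet i) (ρ ν μ : Fin 5) :
    g.leviCivita (P.frame i ρ) (P.frame i ν) (P.frame i μ) x =
      (1 / 2 : ℝ) * (P.structFun i x ρ ν μ - P.structFun i x ν μ ρ + P.structFun i x μ ρ ν) := by
  have h : ∀ α β, mvfderiv (𝓡 5) (fun y ↦ g.inner y (P.frame i α y) (P.frame i β y)) x = 0 := by
    intro α β
    have e : (fun y ↦ g.inner y (P.frame i α y) (P.frame i β y)) =ᶠ[𝓝 x]
        fun _ ↦ if α = β then eta α else 0 := by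
      filter_upwards [(P.isOpen_baseSet i).mem_nhds hx] with y hy
      exact P.orthonormal i y hy α β
    rw [mvfderiv_congr e, mvfderiv_const]
  simp only [LorentzMetric.leviCivita, h, structFun]
  simp

/-- The term `∑ β, η_β Λ^β_μ d Λ^β_ν` in the change of the connection form. -/
def inhomogeneous (i j : ι) (x : M) (μ ν : Fin 5) : TangentSpace (𝓡 5) x →L[ℝ] ℝ :=
  ∑ β, (eta β * P.transition i j x β μ) • mvfderiv (𝓡 5) (fun y ↦ P.transition i j y β ν) x

/-- Derivative of the orthogonality relation `Λᵀ η Λ = η`. -/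
theorem inhomogeneous_swap {i j : ι} {x : M} (hi : x ∈ P.baseSet i) (hj : x ∈ P.baseSet j)
    (μ ν : Fin 5) (v : TangentSpace (𝓡 5) x) :
    P.inhomogeneous i j x μ ν v = -P.inhomogeneous i j x ν μ v := by
  have hd : ∀ α μ, MDifferentiableAt (𝓡 5) 𝓘(ℝ, ℝ) (fun y ↦ P.transition i j y α μ) x :=
    fun α μ ↦ (P.contMDiffAt_transition hi hj α μ).mdifferentiableAt (by simp)
  have e : (fun y ↦ ∑ α, eta α * (P.transition i j y α μ * P.transition i j y α ν)) =ᶠ[𝓝 x]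
      fun _ ↦ Matrix.diagonal eta μ ν := by
    filter_upwards [(P.isOpen_baseSet i).mem_nhds hi, (P.isOpen_baseSet j).mem_nhds hj]
      with y hy hy'
    rw [← P.transition_orthogonal hy hy', Matrix.mul_assoc, Matrix.mul_apply]
    simp only [Matrix.transpose_apply, Matrix.diagonal_mul, Matrix.of_apply]
    refine Finset.sum_congr rfl fun α _ ↦ by ring
  have h := mvfderiv_congr e
  rw [mvfderiv_const] at h
  have h2 : ∀ α, mvfderiv (𝓡 5)
      (fun y ↦ eta α * (P.transition i j y α μ * P.transition i j y α ν)) x v =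
      eta α * P.transition i j x α μ * mvfderiv (𝓡 5) (fun y ↦ P.transition i j y α ν) x v +
      eta α * P.transition i j x α ν * mvfderiv (𝓡 5) (fun y ↦ P.transition i j y α μ) x v := by
    intro α
    have hm : MDifferentiableAt (𝓡 5) 𝓘(ℝ, ℝ)
        (fun y ↦ P.transition i j y α μ * P.transition i j y α ν) x := (hd α μ).mul (hd α ν)
    rw [mvfderiv_fun_mul mdifferentiableAt_const hm, mvfderiv_fun_mul (hd α μ) (hd α ν),
      mvfderiv_const]
    simp
    ring
  have h3 : mvfderiv (𝓡 5)
      (fun y ↦ ∑ α, eta α * (P.transition i j y α μ * P.transition i j y α ν)) x v =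
      ∑ α, mvfderiv (𝓡 5)
      (fun y ↦ eta α * (P.transition i j y α μ * P.transition i j y α ν)) x v := by
    rw [mvfderiv_finset_sum (f := fun α y ↦ eta α * (P.transition i j y α μ *
      P.transition i j y α ν)) _
      fun α _ ↦ mdifferentiableAt_const.mul ((hd α μ).mul (hd α ν)), sum_apply]
  rw [h] at h3
  simp only [h2, Finset.sum_add_distrib] at h3
  simp only [inhomogeneous, sum_apply, smul_apply, smul_eq_mul]
  have h4 : (0 : TangentSpace (𝓡 5) x →L[ℝ] ℝ) v = 0 := rfl
  rw [h4] at h3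
  linarith

/-- Structure functions are not tensorial. Expanding the frame `j` in the frame `i` near `x`, the
Leibniz rule in each slot of the bracket produces one derivative of `Λ`, with opposite signs in the
two slots. -/
theorem structFun_eq_sum {i j : ι} {x : M} (hi : x ∈ P.baseSet i) (hj : x ∈ P.baseSet j)
    (ρ ν μ : Fin 5) :
    P.structFun j x ρ ν μ =
      ∑ α, ∑ β, ∑ γ, P.transition i j x α ρ * P.transition i j x β ν * P.transition i j x γ μ *
        P.structFun i x α β γ
      + P.inhomogeneous i j x μ ν (P.frame j ρ x) - P.inhomogeneous i j x μ ρ (P.frame j ν x) := by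
  have hd : ∀ α μ, MDifferentiableAt (𝓡 5) 𝓘(ℝ, ℝ) (fun y ↦ P.transition i j y α μ) x :=
    fun α μ ↦ (P.contMDiffAt_transition hi hj α μ).mdifferentiableAt (by simp)
  have hY : ∀ α, MDifferentiableAt (𝓡 5) (𝓡 5).tangent
      (fun x ↦ (⟨x, P.frame i α x⟩ : TangentBundle (𝓡 5) M)) x :=
    fun α ↦ (P.contMDiffAt_frame hi α).mdifferentiableAt (by simp)
  have he : ∀ μ, P.frame j μ =ᶠ[𝓝 x] fun y ↦ ∑ α, P.transition i j y α μ • P.frame i α y := by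
    intro μ
    filter_upwards [(P.isOpen_baseSet i).mem_nhds hi] with y hy
    exact P.frame_eq_sum_transition j hy μ
  have hb : mlieBracket (𝓡 5) (P.frame j ρ) (P.frame j ν) x =
      ∑ β, (mvfderiv (𝓡 5) (fun y ↦ P.transition i j y β ν) x (P.frame j ρ x) • P.frame i β x
        + P.transition i j x β ν • ∑ α,
          (P.transition i j x α ρ • mlieBracket (𝓡 5) (P.frame i α) (P.frame i β) x
          - mvfderiv (𝓡 5) (fun y ↦ P.transition i j y α ρ) x (P.frame i β x) •
            P.frame i α x)) := by
    refine (Filter.EventuallyEq.mlieBracket_vectorField_eq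
        (Filter.EventuallyEq.refl _ (P.frame j ρ)) (he ν)).trans
      ((mlieBracket_sum_smul_right (f := fun β y ↦ P.transition i j y β ν) _
        (fun a _ ↦ hd a ν) (fun a _ ↦ hY a)).trans ?_)
    refine Finset.sum_congr rfl fun β _ ↦ ?_
    congr 2
    exact (Filter.EventuallyEq.mlieBracket_vectorField_eq (he ρ)
        (Filter.EventuallyEq.refl _ (P.frame i β))).trans
      (mlieBracket_sum_smul_left (f := fun β y ↦ P.transition i j y β ρ) _
        (fun a _ ↦ hd a ρ) (fun a _ ↦ hY a))
  have hin : ∀ α, g.inner x (P.frame i α x) (P.frame j μ x) = eta α * P.transition i j x α μ :=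
    fun α ↦ P.inner_eq_eta_mul_comp i x α _
  have hstr : ∀ α β, g.inner x (mlieBracket (𝓡 5) (P.frame i α) (P.frame i β) x)
      (P.frame j μ x) = ∑ γ, P.transition i j x γ μ * P.structFun i x α β γ := by
    intro α β
    rw [P.frame_eq_sum_transition j hi μ]
    simp [structFun]
  have e2 : P.inhomogeneous i j x μ ρ (P.frame j ν x) = ∑ β, ∑ α, P.transition i j x β ν *
      (mvfderiv (𝓡 5) (fun y ↦ P.transition i j y α ρ) x (P.frame i β x) *
        (eta α * P.transition i j x α μ)) := by
    rw [P.frame_eq_sum_transition j hi ν]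
    simp only [inhomogeneous, sum_apply, smul_apply, smul_eq_mul, map_sum, map_smul,
      Finset.mul_sum]
    refine Finset.sum_congr rfl fun α _ ↦ Finset.sum_congr rfl fun β _ ↦ by ring
  have e1 : P.inhomogeneous i j x μ ν (P.frame j ρ x) = ∑ β,
      mvfderiv (𝓡 5) (fun y ↦ P.transition i j y β ν) x (P.frame j ρ x) *
        (eta β * P.transition i j x β μ) := by
    simp only [inhomogeneous, sum_apply, smul_apply, smul_eq_mul]
    refine Finset.sum_congr rfl fun α _ ↦ by ring
  have e0 : ∑ α, ∑ β, ∑ γ, P.transition i j x α ρ * P.transition i j x β ν *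
      P.transition i j x γ μ * P.structFun i x α β γ = ∑ β, ∑ α, P.transition i j x β ν *
        (P.transition i j x α ρ * ∑ γ, P.transition i j x γ μ * P.structFun i x α β γ) := by
    rw [Finset.sum_comm]
    simp only [Finset.mul_sum]
    refine Finset.sum_congr rfl fun β _ ↦ Finset.sum_congr rfl fun α _ ↦
      Finset.sum_congr rfl fun γ _ ↦ by ring
  rw [structFun, hb, e0, e1, e2]
  simp only [map_sum, map_add, map_smul, map_sub, sum_apply, add_apply, sub_apply, smul_apply,
    smul_eq_mul, hin, hstr, Finset.sum_add_distrib, Finset.mul_sum, mul_sub,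
    Finset.sum_sub_distrib]
  ring

/-- The Koszul combination contains six inhomogeneous terms. By antisymmetry four of them cancel and
the other two agree, which absorbs the factor `1 / 2`. -/
theorem leviCivita_frame_eq_sum {i j : ι} {x : M} (hi : x ∈ P.baseSet i) (hj : x ∈ P.baseSet j)
    (ρ ν μ : Fin 5) :
    g.leviCivita (P.frame j ρ) (P.frame j ν) (P.frame j μ) x =
      ∑ α, ∑ β, ∑ γ, P.transition i j x α ρ * P.transition i j x β ν * P.transition i j x γ μ *
        g.leviCivita (P.frame i α) (P.frame i β) (P.frame i γ) x
      + P.inhomogeneous i j x μ ν (P.frame j ρ x) := by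
  have c1 : ∑ α, ∑ β, ∑ γ, P.transition i j x α ν * P.transition i j x β μ *
      P.transition i j x γ ρ * P.structFun i x α β γ =
      ∑ α, ∑ β, ∑ γ, P.transition i j x α ρ * P.transition i j x β ν * P.transition i j x γ μ *
        P.structFun i x β γ α := by
    conv_rhs => rw [Finset.sum_comm]
    refine Finset.sum_congr rfl fun α _ ↦ ?_
    rw [Finset.sum_comm]
    refine Finset.sum_congr rfl fun β _ ↦ Finset.sum_congr rfl fun γ _ ↦ by ring
  have c2 : ∑ α, ∑ β, ∑ γ, P.transition i j x α μ * P.transition i j x β ρ *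
      P.transition i j x γ ν * P.structFun i x α β γ =
      ∑ α, ∑ β, ∑ γ, P.transition i j x α ρ * P.transition i j x β ν * P.transition i j x γ μ *
        P.structFun i x γ α β := by
    rw [Finset.sum_comm]
    refine Finset.sum_congr rfl fun α _ ↦ ?_
    rw [Finset.sum_comm]
    refine Finset.sum_congr rfl fun β _ ↦ Finset.sum_congr rfl fun γ _ ↦ by ring
  rw [P.leviCivita_frame hj, P.structFun_eq_sum hi hj, P.structFun_eq_sum hi hj,
    P.structFun_eq_sum hi hj]
  simp only [P.leviCivita_frame hi, mul_add, mul_sub, Finset.sum_add_distrib,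
    Finset.sum_sub_distrib]
  have h1 := P.inhomogeneous_swap hi hj ρ μ (P.frame j ν x)
  have h2 := P.inhomogeneous_swap hi hj ν μ (P.frame j ρ x)
  have h3 := P.inhomogeneous_swap hi hj ρ ν (P.frame j μ x)
  rw [c1, c2, h1, h2, h3]
  have c3 : ∀ f : Fin 5 → Fin 5 → Fin 5 → ℝ, ∑ α, ∑ β, ∑ γ, P.transition i j x α ρ *
      P.transition i j x β ν * P.transition i j x γ μ * (1 / 2 * f α β γ) =
      1 / 2 * ∑ α, ∑ β, ∑ γ, P.transition i j x α ρ *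
      P.transition i j x β ν * P.transition i j x γ μ * f α β γ := by
    intro f
    simp only [Finset.mul_sum]
    refine Finset.sum_congr rfl fun α _ ↦ Finset.sum_congr rfl fun β _ ↦
      Finset.sum_congr rfl fun γ _ ↦ by ring
  rw [c3, c3 fun α β γ ↦ P.structFun i x β γ α, c3 fun α β γ ↦ P.structFun i x γ α β]
  ring

/-- The connection form as a matrix. -/
def connMatrix (i : ι) (x : M) (v : TangentSpace (𝓡 5) x) : Matrix (Fin 5) (Fin 5) ℝ :=
  Matrix.of fun μ ν ↦ P.connForm i x μ ν v

theorem connMatrix_apply (i : ι) (x : M) (v : TangentSpace (𝓡 5) x) (μ ν : Fin 5) :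
    P.connMatrix i x v μ ν =
      ∑ ρ, g.leviCivita (P.frame i ρ) (P.frame i ν) (P.frame i μ) x * P.comp i x ρ v := by
  simp [connMatrix, connForm]

/-- Metric compatibility; it reduces to the antisymmetry of the bracket in the structure functions.
-/
theorem connMatrix_swap {i : ι} {x : M} (hi : x ∈ P.baseSet i) (v : TangentSpace (𝓡 5) x)
    (μ ν : Fin 5) : P.connMatrix i x v μ ν = -P.connMatrix i x v ν μ := by
  simp only [connMatrix_apply, P.leviCivita_frame hi, ← Finset.sum_neg_distrib]
  refine Finset.sum_congr rfl fun ρ _ ↦ ?_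
  rw [P.structFun_swap i x ρ ν μ, P.structFun_swap i x ν μ ρ, P.structFun_swap i x μ ρ ν]
  ring

/-- The frame law contracted with the components of `v`, in the matrix form `Λᵀ ω Λ + Λᵀ η dΛ` that
`lift_variation_eq` expects. -/
theorem connMatrix_change {i j : ι} {x : M} (hi : x ∈ P.baseSet i) (hj : x ∈ P.baseSet j)
    (v : TangentSpace (𝓡 5) x) :
    P.connMatrix j x v = (Matrix.of (P.transition i j x)).transpose * P.connMatrix i x v *
        Matrix.of (P.transition i j x) +
      (Matrix.of (P.transition i j x)).transpose * Matrix.diagonal eta *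
        Matrix.of fun α ν ↦ mvfderiv (𝓡 5) (fun y ↦ P.transition i j y α ν) x v := by
  ext μ ν
  have e1 : ((Matrix.of (P.transition i j x)).transpose * Matrix.diagonal eta *
        Matrix.of fun α ν ↦ mvfderiv (𝓡 5) (fun y ↦ P.transition i j y α ν) x v) μ ν =
      ∑ ρ, P.inhomogeneous i j x μ ν (P.frame j ρ x) * P.comp j x ρ v := by
    conv_lhs => rw [← P.sum_comp_smul_frame hj v]
    have : ∑ ρ, P.inhomogeneous i j x μ ν (P.frame j ρ x) * P.comp j x ρ v =
        P.inhomogeneous i j x μ ν (∑ ρ, P.comp j x ρ v • P.frame j ρ x) := by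
      simp only [map_sum, map_smul, smul_eq_mul, mul_comm]
    rw [this, Matrix.mul_assoc, Matrix.mul_apply]
    simp only [Matrix.transpose_apply, Matrix.diagonal_mul, Matrix.of_apply, inhomogeneous,
      sum_apply, smul_apply, smul_eq_mul]
    refine Finset.sum_congr rfl fun α _ ↦ by ring
  have e2 : ((Matrix.of (P.transition i j x)).transpose * P.connMatrix i x v *
        Matrix.of (P.transition i j x)) μ ν =
      ∑ ρ, (∑ α, ∑ β, ∑ γ, P.transition i j x α ρ * P.transition i j x β ν *
        P.transition i j x γ μ * g.leviCivita (P.frame i α) (P.frame i β) (P.frame i γ) x) *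
          P.comp j x ρ v := by
    simp only [Matrix.mul_apply, Matrix.transpose_apply, connMatrix_apply, Finset.sum_mul,
      Matrix.of_apply,
      Finset.mul_sum, P.comp_eq_sum_transition (i := i) hj _ v]
    rw [Finset.sum_comm]
    have s : ∀ f : Fin 5 → Fin 5 → Fin 5 → Fin 5 → ℝ,
        ∑ γ, ∑ β, ∑ α, ∑ ρ, f γ β α ρ = ∑ ρ, ∑ α, ∑ β, ∑ γ, f γ β α ρ := by
      intro f
      have t1 : ∀ γ, ∑ β, ∑ α, ∑ ρ, f γ β α ρ = ∑ ρ, ∑ α, ∑ β, f γ β α ρ := by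
        intro γ
        have t0 : ∀ β, ∑ α, ∑ ρ, f γ β α ρ = ∑ ρ, ∑ α, f γ β α ρ := fun β ↦ Finset.sum_comm
        simp only [t0]
        rw [Finset.sum_comm]
        refine Finset.sum_congr rfl fun ρ _ ↦ Finset.sum_comm
      simp only [t1]
      rw [Finset.sum_comm]
      refine Finset.sum_congr rfl fun ρ _ ↦ ?_
      rw [Finset.sum_comm]
      refine Finset.sum_congr rfl fun α _ ↦ Finset.sum_comm
    rw [s]
    refine Finset.sum_congr rfl fun ρ _ ↦ Finset.sum_congr rfl fun α _ ↦
      Finset.sum_congr rfl fun β _ ↦ Finset.sum_congr rfl fun γ _ ↦ by ring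
  rw [Matrix.add_apply, e1, e2, connMatrix_apply, ← Finset.sum_add_distrib]
  refine Finset.sum_congr rfl fun ρ _ ↦ ?_
  rw [P.leviCivita_frame_eq_sum hi hj, add_mul]

end SpinStructure

/-! ### Transition functions of the spinor bundle and their derivatives -/

open VectorField Topology

/-- The action of `𝔰𝔭(1)` on `S` as a linear map. -/
def spActionL : sp1 →ₗ[ℝ] (S →L[ℝ] S) where
  toFun := spAction
  map_add' p q := by
    have key : ∀ s, rightMul (star (sp1.quat (p + q))) s =
        rightMul (star p.quat) s + rightMul (star q.quat) s := by
      intro s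
      have : sp1.quat (p + q) = p.quat + q.quat := rfl
      ext i : 1
      simp [rightMul, this, mul_add]
    exact ContinuousLinearMap.ext key
  map_smul' c q := by
    have key : ∀ s, rightMul (star (sp1.quat (c • q))) s = c • rightMul (star q.quat) s := by
      intro s
      have : sp1.quat (c • q) = c • q.quat := rfl
      ext i : 1
      simp [rightMul, this]
    exact ContinuousLinearMap.ext key

theorem spActionL_apply (q : sp1) : spActionL q = spAction q := rfl

/-- The invariant bilinear form on `S` as a continuous bilinear map. -/
def spinorFormL : S →L[ℝ] S →L[ℝ] ℝ :=
  LinearMap.toContinuousLinearMap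
    ((LinearMap.toContinuousLinearMap : (S →ₗ[ℝ] ℝ) ≃ₗ[ℝ] (S →L[ℝ] ℝ)).toLinearMap ∘ₗ spinorForm)

theorem spinorFormL_apply (s t : S) : spinorFormL s t = spinorForm s t := rfl

variable {M : Type*} [TopologicalSpace M] [ChartedSpace (EuclideanSpace ℝ (Fin 5)) M]

section mvfderiv

variable {F G H : Type*} [NormedAddCommGroup F] [NormedSpace ℝ F] [NormedAddCommGroup G]
  [NormedSpace ℝ G] [NormedAddCommGroup H] [NormedSpace ℝ H]

theorem mvfderiv_clm_apply (L : F →L[ℝ] G) {f : M → F} {x : M}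
    (hf : MDifferentiableAt (𝓡 5) 𝓘(ℝ, F) f x) (v : TangentSpace (𝓡 5) x) :
    mvfderiv (𝓡 5) (fun y ↦ L (f y)) x v = L (mvfderiv (𝓡 5) f x v) := by
  have h3 := (L.hasFDerivAt.hasMFDerivAt.comp x hf.hasMFDerivAt).mfderiv
  have h4 : mvfderiv (𝓡 5) (fun y ↦ L (f y)) x v = mfderiv (𝓡 5) 𝓘(ℝ, G) (L ∘ f) x v := rfl
  rw [h4, h3]
  rfl

theorem mdifferentiableAt_bilinear (B : F →L[ℝ] G →L[ℝ] H) {f : M → F} {k : M → G} {x : M}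
    (hf : MDifferentiableAt (𝓡 5) 𝓘(ℝ, F) f x) (hk : MDifferentiableAt (𝓡 5) 𝓘(ℝ, G) k x) :
    MDifferentiableAt (𝓡 5) 𝓘(ℝ, H) (fun y ↦ B (f y) (k y)) x :=
  (B.isBoundedBilinearMap.differentiableAt (f x, k x)).comp_mdifferentiableAt
    (f := fun y ↦ (f y, k y)) (hf.prodMk_space hk)

theorem mvfderiv_bilinear (B : F →L[ℝ] G →L[ℝ] H) {f : M → F} {k : M → G} {x : M}
    (hf : MDifferentiableAt (𝓡 5) 𝓘(ℝ, F) f x) (hk : MDifferentiableAt (𝓡 5) 𝓘(ℝ, G) k x)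
    (v : TangentSpace (𝓡 5) x) :
    mvfderiv (𝓡 5) (fun y ↦ B (f y) (k y)) x v =
      B (mvfderiv (𝓡 5) f x v) (k x) + B (f x) (mvfderiv (𝓡 5) k x v) := by
  have hp := hf.prodMk_space hk
  have h1 := hp.hasMFDerivAt
  have e1 : (mvfderiv (𝓡 5) (fun y ↦ (f y, k y)) x v).1 = mvfderiv (𝓡 5) f x v :=
    (mvfderiv_clm_apply (ContinuousLinearMap.fst ℝ F G) hp v).symm
  have e2 : (mvfderiv (𝓡 5) (fun y ↦ (f y, k y)) x v).2 = mvfderiv (𝓡 5) k x v :=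
    (mvfderiv_clm_apply (ContinuousLinearMap.snd ℝ F G) hp v).symm
  have h2 := (B.isBoundedBilinearMap.hasFDerivAt (f x, k x)).hasMFDerivAt
  have h3 := (h2.comp x h1).mfderiv
  have h4 : mvfderiv (𝓡 5) (fun y ↦ B (f y) (k y)) x v =
      mfderiv (𝓡 5) 𝓘(ℝ, H) ((fun p : F × G ↦ B p.1 p.2) ∘ fun y ↦ (f y, k y)) x v := rfl
  rw [h4, h3, add_comm, ← e1, ← e2]
  rfl

end mvfderiv

variable [IsManifold (𝓡 5) ∞ M]

namespace SpinStructure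

variable {g : LorentzMetric M} {ι : Type*} (P : SpinStructure g ι)

/-- The transition functions of the spinor bundle. -/
def rep (i j : ι) (x : M) : S →L[ℝ] S := cliffordRep (P.lift i j x : CliffordAlgebra quadForm)

theorem rep_mul_rep {i j k : ι} {x : M} (hi : x ∈ P.baseSet i) (hj : x ∈ P.baseSet j)
    (hk : x ∈ P.baseSet k) : P.rep i j x * P.rep j k x = P.rep i k x := by
  rw [rep, rep, rep, ← map_mul, ← Units.val_mul, P.cocycle i j k x ⟨⟨hi, hj⟩, hk⟩]

theorem rep_self {i : ι} {x : M} (hi : x ∈ P.baseSet i) : P.rep i i x = 1 := by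
  rw [rep, P.lift_self i x hi, Units.val_one, map_one]

theorem rep_mul_rep_symm {i j : ι} {x : M} (hi : x ∈ P.baseSet i) (hj : x ∈ P.baseSet j) :
    P.rep i j x * P.rep j i x = 1 := by
  rw [P.rep_mul_rep hi hj hi, P.rep_self hi]

theorem contMDiffAt_rep {i j : ι} {x : M} (hi : x ∈ P.baseSet i) (hj : x ∈ P.baseSet j) :
    ContMDiffAt (𝓡 5) 𝓘(ℝ, S →L[ℝ] S) ∞ (P.rep i j) x :=
  (P.contMDiffOn_lift i j).contMDiffAt
    (((P.isOpen_baseSet i).inter (P.isOpen_baseSet j)).mem_nhds ⟨hi, hj⟩)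

theorem mdifferentiableAt_rep {i j : ι} {x : M} (hi : x ∈ P.baseSet i) (hj : x ∈ P.baseSet j) :
    MDifferentiableAt (𝓡 5) 𝓘(ℝ, S →L[ℝ] S) (P.rep i j) x :=
  (P.contMDiffAt_rep hi hj).mdifferentiableAt (by simp)

theorem rep_commute_rightMulL (i j : ι) (x : M) (q : ℍ[ℝ]) :
    Commute (P.rep i j x) (rightMulL q) :=
  cliffordRep_commute_rightMulL _ q

/-- Conjugation by the lift sends `u` to some vector `w`, and `frame_change` forces `w = Λ u` by
comparison of components in the frame `i`. -/
theorem rep_mul_gamma {i j : ι} {x : M} (hi : x ∈ P.baseSet i) (hj : x ∈ P.baseSet j) (u : V) :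
    P.rep i j x * gamma u = gamma ((Matrix.of (P.transition i j x)).mulVec u) * P.rep i j x := by
  obtain ⟨w, hw⟩ := exists_conj_of_mem_spin (P.lift_mem i j x ⟨hi, hj⟩) u
  have h1 := P.frame_change i j x ⟨hi, hj⟩ u w hw
  have h2 : w = (Matrix.of (P.transition i j x)).mulVec u := by
    funext α
    have := congrArg (P.comp i x α) h1
    simp only [map_sum, map_smul, P.comp_frame hi, smul_eq_mul, mul_ite, mul_one, mul_zero,
      Finset.sum_ite_eq, Finset.mem_univ, if_true] at this
    rw [← this]
    simp [Matrix.mulVec, dotProduct, transition, mul_comm]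
  rw [← h2]
  have h3 := congrArg (fun a ↦ cliffordRep (a * (P.lift i j x : CliffordAlgebra quadForm))) hw
  simp only [mul_assoc, Units.inv_mul, mul_one, map_mul] at h3
  simpa [cliffordRep, rep] using h3.symm

theorem rep_mul_Γ {i j : ι} {x : M} (hi : x ∈ P.baseSet i) (hj : x ∈ P.baseSet j) (μ : Fin 5) :
    P.rep i j x * Γ μ = (∑ α, P.transition i j x α μ • Γ α) * P.rep i j x := by
  rw [Γ, P.rep_mul_gamma hi hj, gamma_eq_sum]
  simp

/-- The product rule applied to `rep_mul_gamma`, which holds on a whole neighbourhood of `x`. -/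
theorem mvfderiv_rep_mul_gamma {i j : ι} {x : M} (hi : x ∈ P.baseSet i) (hj : x ∈ P.baseSet j)
    (v : TangentSpace (𝓡 5) x) (u : V) :
    mvfderiv (𝓡 5) (P.rep i j) x v * gamma u =
      gamma ((Matrix.of fun α ν ↦ mvfderiv (𝓡 5) (fun y ↦ P.transition i j y α ν) x v).mulVec u)
        * P.rep i j x
      + gamma ((Matrix.of (P.transition i j x)).mulVec u) * mvfderiv (𝓡 5) (P.rep i j) x v := by
  have hr := P.mdifferentiableAt_rep hi hj
  have hd : ∀ α μ, MDifferentiableAt (𝓡 5) 𝓘(ℝ, ℝ) (fun y ↦ P.transition i j y α μ) x :=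
    fun α μ ↦ (P.contMDiffAt_transition hi hj α μ).mdifferentiableAt (by simp)
  have hsum : ∀ (L : Fin 5 → Fin 5 → ℝ) (A : S →L[ℝ] S), gamma ((Matrix.of L).mulVec u) * A =
      ∑ α, ∑ μ, (L α μ) • (u μ • (Γ α * A)) := by
    intro L A
    rw [gamma_eq_sum, Finset.sum_mul]
    refine Finset.sum_congr rfl fun α _ ↦ ?_
    simp only [Matrix.mulVec, dotProduct, Matrix.of_apply, Finset.sum_smul, Finset.sum_mul,
      smul_mul_assoc, smul_smul]
  have e : (fun y ↦ P.rep i j y * gamma u) =ᶠ[𝓝 x]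
      fun y ↦ ∑ α, ∑ μ, P.transition i j y α μ • (u μ • (Γ α * P.rep i j y)) := by
    filter_upwards [(P.isOpen_baseSet i).mem_nhds hi, (P.isOpen_baseSet j).mem_nhds hj] with y h h'
    rw [P.rep_mul_gamma h h', hsum]
  have h1 : mvfderiv (𝓡 5) (fun y ↦ P.rep i j y * gamma u) x v =
      mvfderiv (𝓡 5) (P.rep i j) x v * gamma u :=
    mvfderiv_clm_apply ((ContinuousLinearMap.mul ℝ (S →L[ℝ] S)).flip (gamma u)) hr v
  have hA : ∀ α μ, MDifferentiableAt (𝓡 5) 𝓘(ℝ, S →L[ℝ] S)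
      (fun y ↦ u μ • (Γ α * P.rep i j y)) x := fun α μ ↦
    (u μ • (ContinuousLinearMap.mul ℝ (S →L[ℝ] S) (Γ α))).differentiableAt.comp_mdifferentiableAt hr
  have hA' : ∀ α μ, mvfderiv (𝓡 5) (fun y ↦ u μ • (Γ α * P.rep i j y)) x v =
      u μ • (Γ α * mvfderiv (𝓡 5) (P.rep i j) x v) := fun α μ ↦
    mvfderiv_clm_apply (u μ • (ContinuousLinearMap.mul ℝ (S →L[ℝ] S) (Γ α))) hr v
  have hB : ∀ α μ, MDifferentiableAt (𝓡 5) 𝓘(ℝ, S →L[ℝ] S)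
      (fun y ↦ P.transition i j y α μ • (u μ • (Γ α * P.rep i j y))) x := fun α μ ↦
    (hd α μ).smul (hA α μ)
  have hB' : ∀ α μ, mvfderiv (𝓡 5)
      (fun y ↦ P.transition i j y α μ • (u μ • (Γ α * P.rep i j y))) x v =
      mvfderiv (𝓡 5) (fun y ↦ P.transition i j y α μ) x v • (u μ • (Γ α * P.rep i j x)) +
      P.transition i j x α μ • (u μ • (Γ α * mvfderiv (𝓡 5) (P.rep i j) x v)) := fun α μ ↦ by
    rw [← hA']
    exact mvfderiv_bilinear (ContinuousLinearMap.lsmul ℝ ℝ) (hd α μ) (hA α μ) v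
  have hC : ∀ α, MDifferentiableAt (𝓡 5) 𝓘(ℝ, S →L[ℝ] S)
      (fun y ↦ ∑ μ, P.transition i j y α μ • (u μ • (Γ α * P.rep i j y))) x := fun α ↦
    mdifferentiableAt_finset_sum _ fun μ _ ↦ hB α μ
  rw [← h1, mvfderiv_congr e, mvfderiv_finset_sum _ (fun α _ ↦ hC α), sum_apply, hsum, hsum,
    ← Finset.sum_add_distrib]
  refine Finset.sum_congr rfl fun α _ ↦ ?_
  rw [mvfderiv_finset_sum _ (fun μ _ ↦ hB α μ), sum_apply, ← Finset.sum_add_distrib]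
  exact Finset.sum_congr rfl fun μ _ ↦ hB' α μ

end SpinStructure

/-! ### Gauge transformation law of the spin connection -/

open VectorField Topology

variable {M : Type*} [TopologicalSpace M] [ChartedSpace (EuclideanSpace ℝ (Fin 5)) M]
  [IsManifold (𝓡 5) ∞ M]

namespace SpinStructure

variable {g : LorentzMetric M} {ι : Type*} (P : SpinStructure g ι)

/-- A continuous function with values in `{a, -a}` is locally constant, since two distinct values
lie `2 |a|` apart. This makes the sign `ε` invisible to differentiation. -/
theorem spinorForm_rep_eventually_eq {i j : ι} {x : M} (hi : x ∈ P.baseSet i)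
    (hj : x ∈ P.baseSet j) (s t : S) :
    (fun y ↦ spinorFormL (P.rep i j y s) (P.rep i j y t)) =ᶠ[𝓝 x]
      fun _ ↦ spinorFormL (P.rep i j x s) (P.rep i j x t) := by
  have hc : ContinuousAt (fun y ↦ spinorFormL (P.rep i j y s) (P.rep i j y t)) x := by
    have h := (P.contMDiffAt_rep hi hj).continuousAt
    exact ((spinorFormL.continuous.continuousAt.comp (h.clm_apply continuousAt_const))).clm_apply
      (h.clm_apply continuousAt_const)
  have hval : ∀ y, y ∈ P.baseSet i → y ∈ P.baseSet j →
      spinorFormL (P.rep i j y s) (P.rep i j y t) = spinorFormL s t ∨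
      spinorFormL (P.rep i j y s) (P.rep i j y t) = -spinorFormL s t := by
    intro y hy hy'
    obtain ⟨ε, rfl | rfl, h⟩ := spinorForm_spin (P.lift_mem i j y ⟨hy, hy'⟩)
    · left
      simp only [spinorFormL_apply, rep, h, one_mul]
    · right
      simp only [spinorFormL_apply, rep, h, neg_mul, one_mul]
  by_cases h0 : spinorFormL s t = 0
  · filter_upwards [(P.isOpen_baseSet i).mem_nhds hi, (P.isOpen_baseSet j).mem_nhds hj] with y h h'
    have h1 := hval y h h'
    have h2 := hval x hi hj
    simp only [h0, neg_zero, or_self] at h1 h2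
    rw [h1, h2]
  · have hpos : 0 < 2 * |spinorFormL s t| := by positivity
    filter_upwards [(P.isOpen_baseSet i).mem_nhds hi, (P.isOpen_baseSet j).mem_nhds hj,
      Metric.continuousAt_iff'.1 hc _ hpos] with y h h' hd
    have h1 := hval y h h'
    have h2 := hval x hi hj
    rw [Real.dist_eq] at hd
    rcases h1 with h1 | h1 <;> rcases h2 with h2 | h2 <;> rw [h1, h2] at hd ⊢
    · rw [sub_neg_eq_add, ← two_mul, abs_mul, abs_two] at hd
      exact absurd hd (lt_irrefl _)
    · rw [← neg_add', ← two_mul, abs_neg, abs_mul, abs_two] at hd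
      exact absurd hd (lt_irrefl _)

/-- The spin connection forms in two frames are related by the gauge transformation law. -/
theorem mvfderiv_rep {i j : ι} {x : M} (hi : x ∈ P.baseSet i) (hj : x ∈ P.baseSet j)
    (v : TangentSpace (𝓡 5) x) :
    mvfderiv (𝓡 5) (P.rep i j) x v =
      P.rep i j x * P.spinForm j x v - P.spinForm i x v * P.rep i j x := by
  have hr := P.mdifferentiableAt_rep hi hj
  obtain ⟨ε, hε, hB⟩ := spinorForm_spin (P.lift_mem i j x ⟨hi, hj⟩)
  refine lift_variation_eq (P.rep_mul_rep_symm hj hi) (P.rep_mul_rep_symm hi hj)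
    (P.transition_orthogonal hi hj) (P.connMatrix_swap hi v) (P.connMatrix_swap hj v)
    (P.connMatrix_change hi hj v) (P.rep_mul_gamma hi hj) (P.mvfderiv_rep_mul_gamma hi hj v)
    (P.rep_commute_rightMulL i j x) (fun q ↦ ?_) (ε := ε) ?_ hB fun s t ↦ ?_
  · have h1 : mvfderiv (𝓡 5) (fun y ↦ P.rep i j y * rightMulL q) x v =
        mvfderiv (𝓡 5) (P.rep i j) x v * rightMulL q :=
      mvfderiv_clm_apply ((ContinuousLinearMap.mul ℝ (S →L[ℝ] S)).flip (rightMulL q)) hr v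
    have h2 : mvfderiv (𝓡 5) (fun y ↦ rightMulL q * P.rep i j y) x v =
        rightMulL q * mvfderiv (𝓡 5) (P.rep i j) x v :=
      mvfderiv_clm_apply (ContinuousLinearMap.mul ℝ (S →L[ℝ] S) (rightMulL q)) hr v
    have h3 : (fun y ↦ P.rep i j y * rightMulL q) = fun y ↦ rightMulL q * P.rep i j y :=
      funext fun y ↦ (P.rep_commute_rightMulL i j y q).eq
    rw [Commute, SemiconjBy, ← h1, ← h2, h3]
  · rcases hε with rfl | rfl <;> norm_num
  · have hs : ∀ s, MDifferentiableAt (𝓡 5) 𝓘(ℝ, S) (fun y ↦ P.rep i j y s) x := fun s ↦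
      (ContinuousLinearMap.apply ℝ S s).differentiableAt.comp_mdifferentiableAt hr
    have hs' : ∀ s, mvfderiv (𝓡 5) (fun y ↦ P.rep i j y s) x v =
        mvfderiv (𝓡 5) (P.rep i j) x v s := fun s ↦
      mvfderiv_clm_apply (ContinuousLinearMap.apply ℝ S s) hr v
    have h1 := mvfderiv_bilinear spinorFormL (hs s) (hs t) v
    rw [mvfderiv_congr (P.spinorForm_rep_eventually_eq hi hj s t), mvfderiv_const, hs', hs'] at h1
    exact h1.symm

theorem slash_eq_gamma (i : ι) (x : M) (v : TangentSpace (𝓡 5) x) :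
    P.slash i x v = gamma fun μ ↦ P.comp i x μ v := by
  rw [gamma_eq_sum, slash]

theorem rep_mul_slash {i j : ι} {x : M} (hi : x ∈ P.baseSet i) (hj : x ∈ P.baseSet j)
    (v : TangentSpace (𝓡 5) x) :
    P.rep i j x * P.slash j x v = P.slash i x v * P.rep i j x := by
  rw [slash_eq_gamma, slash_eq_gamma, P.rep_mul_gamma hi hj]
  congr 2
  funext α
  rw [P.comp_eq_sum_transition hj]
  rfl

theorem eta_mul_transition (i j : ι) (x : M) (α μ : Fin 5) :
    eta μ * P.transition i j x α μ = eta α * P.transition j i x μ α := by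
  change eta μ * (eta α * g.inner x _ _) = eta α * (eta μ * g.inner x _ _)
  rw [g.symm]
  ring

/-- Frame vectors with raised index transform so as to compensate the change of the gamma matrices.
This is why the contractions in `slashC` and `slashF` do not depend on the frame. -/
theorem sum_eta_transition_smul_frame {j : ι} (i : ι) {x : M} (hj : x ∈ P.baseSet j) (α : Fin 5) :
    ∑ μ, (eta μ * P.transition i j x α μ) • P.frame j μ x = eta α • P.frame i α x := by
  simp only [eta_mul_transition, mul_smul, ← Finset.smul_sum]
  rw [← P.frame_eq_sum_transition i hj α]

theorem rep_mul_Γ₂ {i j : ι} {x : M} (hi : x ∈ P.baseSet i) (hj : x ∈ P.baseSet j)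
    (μ ν : Fin 5) :
    P.rep i j x * Γ₂ μ ν =
      (∑ α, ∑ β, (P.transition i j x α μ * P.transition i j x β ν) • Γ₂ α β) * P.rep i j x := by
  have h := fun μ ν ↦ show P.rep i j x * (Γ μ * Γ ν) =
      (∑ α, ∑ β, (P.transition i j x α μ * P.transition i j x β ν) • (Γ α * Γ β)) *
        P.rep i j x by
    rw [← mul_assoc, P.rep_mul_Γ hi hj, mul_assoc, P.rep_mul_Γ hi hj, ← mul_assoc]
    simp only [Finset.sum_mul, Finset.mul_sum, smul_mul_assoc, mul_smul_comm, Finset.smul_sum,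
      smul_smul]
    rw [Finset.sum_comm]
    refine Finset.sum_congr rfl fun α _ ↦ Finset.sum_congr rfl fun β _ ↦ ?_
    rw [mul_comm]
  rw [Γ₂, mul_smul_comm, mul_sub, h, h, ← sub_mul, ← smul_mul_assoc]
  congr 1
  have e : ∑ α, ∑ β, (P.transition i j x α ν * P.transition i j x β μ) • (Γ α * Γ β) =
      ∑ α, ∑ β, (P.transition i j x α μ * P.transition i j x β ν) • (Γ β * Γ α) := by
    rw [Finset.sum_comm]
    refine Finset.sum_congr rfl fun α _ ↦ Finset.sum_congr rfl fun β _ ↦ ?_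
    rw [mul_comm]
  rw [e, ← Finset.sum_sub_distrib, Finset.smul_sum]
  refine Finset.sum_congr rfl fun α _ ↦ ?_
  rw [← Finset.sum_sub_distrib, Finset.smul_sum]
  refine Finset.sum_congr rfl fun β _ ↦ ?_
  rw [← smul_sub, Γ₂, smul_comm]

end SpinStructure

/-! ### The superconnection in an arbitrary frame -/

namespace Background

open SpinStructure

variable {ι : Type*} (B : Background M ι)

theorem rep_mul_slashC {i j : ι} {x : M} (hi : x ∈ B.spinStr.baseSet i)
    (hj : x ∈ B.spinStr.baseSet j) :
    B.spinStr.rep i j x * B.slashC j x = B.slashC i x * B.spinStr.rep i j x := by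
  have hc : ∀ α β, eta α * eta β *
      B.C.toFun x (B.spinStr.frame i α x) (B.spinStr.frame i β x) =
      ∑ μ, ∑ ν, eta μ * eta ν * B.C.toFun x (B.spinStr.frame j μ x) (B.spinStr.frame j ν x) *
        (B.spinStr.transition i j x α μ * B.spinStr.transition i j x β ν) := by
    intro α β
    have h : eta α * eta β * B.C.toFun x (B.spinStr.frame i α x) (B.spinStr.frame i β x) =
        B.C.toFun x (eta α • B.spinStr.frame i α x) (eta β • B.spinStr.frame i β x) := by
      simp only [map_smul, smul_apply, smul_eq_mul]
      ring
    rw [h, ← B.spinStr.sum_eta_transition_smul_frame i hj,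
      ← B.spinStr.sum_eta_transition_smul_frame i hj]
    simp only [map_sum, map_smul, sum_apply, smul_apply, smul_eq_mul, Finset.mul_sum]
    rw [Finset.sum_comm]
    refine Finset.sum_congr rfl fun μ _ ↦ Finset.sum_congr rfl fun ν _ ↦ by ring
  rw [slashC, slashC, mul_smul_comm, smul_mul_assoc]
  congr 1
  simp only [hc, Finset.mul_sum, mul_smul_comm, B.spinStr.rep_mul_Γ₂ hi hj, Finset.sum_smul,
    Finset.sum_mul, smul_mul_assoc, Finset.smul_sum, smul_smul]
  have s : ∀ f : Fin 5 → Fin 5 → Fin 5 → Fin 5 → (S →L[ℝ] S),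
      ∑ μ, ∑ ν, ∑ α, ∑ β, f μ ν α β = ∑ α, ∑ β, ∑ μ, ∑ ν, f μ ν α β := by
    intro f
    have t1 : ∀ μ, ∑ ν, ∑ α, ∑ β, f μ ν α β = ∑ α, ∑ β, ∑ ν, f μ ν α β := by
      intro μ
      rw [Finset.sum_comm]
      exact Finset.sum_congr rfl fun α _ ↦ Finset.sum_comm
    simp only [t1]
    rw [Finset.sum_comm]
    exact Finset.sum_congr rfl fun α _ ↦ Finset.sum_comm
  rw [s]

/-- Beyond the contraction of indices, this uses that `𝔰𝔭(1)` acts from the right and so commutes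
with the spin group. -/
theorem rep_mul_slashF {i j : ι} {x : M} (hi : x ∈ B.spinStr.baseSet i)
    (hj : x ∈ B.spinStr.baseSet j) :
    B.spinStr.rep i j x * B.slashF j x = B.slashF i x * B.spinStr.rep i j x := by
  have hc : ∀ α, eta α • spAction (B.F.toFun x (B.spinStr.frame i α x)) =
      ∑ μ, (eta μ * B.spinStr.transition i j x α μ) •
        spAction (B.F.toFun x (B.spinStr.frame j μ x)) := by
    intro α
    rw [← spActionL_apply, ← map_smul, ← map_smul,
      ← B.spinStr.sum_eta_transition_smul_frame i hj]
    simp only [map_sum, map_smul, spActionL_apply]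
  have hcomm : ∀ q : sp1, B.spinStr.rep i j x * spAction q = spAction q * B.spinStr.rep i j x :=
    fun q ↦ (B.spinStr.rep_commute_rightMulL i j x _).eq
  have h1 : B.slashF i x * B.spinStr.rep i j x =
      ∑ α, Γ α * (eta α • spAction (B.F.toFun x (B.spinStr.frame i α x)))
        * B.spinStr.rep i j x := by
    simp only [slashF, Finset.sum_mul, mul_smul_comm]
  rw [h1]
  simp only [hc, slashF, Finset.mul_sum, mul_smul_comm, ← mul_assoc, B.spinStr.rep_mul_Γ hi hj,
    Finset.sum_mul, smul_mul_assoc, Finset.smul_sum, smul_smul]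
  rw [Finset.sum_comm]
  refine Finset.sum_congr rfl fun α _ ↦ Finset.sum_congr rfl fun μ _ ↦ ?_
  rw [mul_assoc (Γ α), hcomm, mul_assoc (Γ α)]

theorem rep_mul_betaOp {i j : ι} {x : M} (hi : x ∈ B.spinStr.baseSet i)
    (hj : x ∈ B.spinStr.baseSet j) (v : TangentSpace (𝓡 5) x) :
    B.spinStr.rep i j x * B.betaOp j x v = B.betaOp i x v * B.spinStr.rep i j x := by
  have h1 := B.spinStr.rep_mul_slash hi hj v
  have h2 := B.rep_mul_slashC hi hj
  have h3 := B.rep_mul_slashF hi hj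
  simp only [betaOp, mul_sub, sub_mul, mul_smul_comm, smul_mul_assoc]
  rw [← mul_assoc _ (B.spinStr.slash j x v) (B.slashC j x),
    ← mul_assoc _ (B.slashC j x), ← mul_assoc _ (B.spinStr.slash j x v) (B.slashF j x),
    ← mul_assoc _ (B.slashF j x), h1, h2, h3]
  simp only [mul_assoc, h1, h2, h3]

/-- The connection form of the superconnection in the frame `i`. -/
def superForm (i : ι) (x : M) (v : TangentSpace (𝓡 5) x) : S →L[ℝ] S :=
  B.spinStr.spinForm i x v - B.betaOp i x v

/-- Since `β` is tensorial, subtracting it does not affect the gauge law of the spin connection. -/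
theorem mvfderiv_rep {i j : ι} {x : M} (hi : x ∈ B.spinStr.baseSet i)
    (hj : x ∈ B.spinStr.baseSet j) (v : TangentSpace (𝓡 5) x) :
    mvfderiv (𝓡 5) (B.spinStr.rep i j) x v =
      B.spinStr.rep i j x * B.superForm j x v - B.superForm i x v * B.spinStr.rep i j x := by
  rw [B.spinStr.mvfderiv_rep hi hj, superForm, superForm, mul_sub, sub_mul,
    B.rep_mul_betaOp hi hj]
  abel

/-- The components of a spinor field in the frame `i`. -/
def localRep (i : ι) (s : ∀ x : M, B.spinStr.Fiber x) (x : M) : S :=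
  B.spinStr.rep i (B.spinStr.indexAt x) x (s x)

/-- The superconnection in the frame `i`. -/
theorem rep_superconnection {i : ι} {x : M} (hi : x ∈ B.spinStr.baseSet i)
    {s : ∀ x : M, B.spinStr.Fiber x}
    (hs : MDifferentiableAt (𝓡 5) 𝓘(ℝ, S) (B.localRep i s) x) (v : TangentSpace (𝓡 5) x) :
    B.spinStr.rep i (B.spinStr.indexAt x) x (B.superconnection s x v) =
      mvfderiv (𝓡 5) (B.localRep i s) x v + B.superForm i x v (B.localRep i s x) := by
  have hj := B.spinStr.mem_baseSet_at x
  -- In the preferred frame at `x` this is the definition. The frame `i` is reached by writing those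
  -- components as `rep` applied to the components in the frame `i`; the derivative of `rep` is then
  -- absorbed by the gauge law.
  have h1 : B.superconnection s x v =
      mvfderiv (𝓡 5) (B.localRep (B.spinStr.indexAt x) s) x v +
        B.superForm (B.spinStr.indexAt x) x v (s x) := by
    have e : B.superconnection s x v =
      mvfderiv (𝓡 5) (B.localRep (B.spinStr.indexAt x) s) x v +
        B.spinStr.spinForm (B.spinStr.indexAt x) x v (s x) +
        -(B.betaOp (B.spinStr.indexAt x) x v (s x)) := rfl
    have h : ∀ (a b : S →L[ℝ] S) (p z : S), p + a z + -(b z) = p + (a - b) z := by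
      intro a b p z
      rw [sub_apply]
      abel
    exact e.trans (h _ _ _ _)
  have h2 : B.localRep (B.spinStr.indexAt x) s =ᶠ[𝓝 x]
      fun y ↦ B.spinStr.rep (B.spinStr.indexAt x) i y (B.localRep i s y) := by
    filter_upwards [(B.spinStr.isOpen_baseSet i).mem_nhds hi,
      (B.spinStr.isOpen_baseSet _).mem_nhds hj] with y h h'
    have := B.spinStr.rep_mul_rep h' h (B.spinStr.mem_baseSet_at y)
    exact (congrArg (fun A : S →L[ℝ] S ↦ A (s y)) this).symm
  have h3 := mvfderiv_bilinear (ContinuousLinearMap.id ℝ (S →L[ℝ] S))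
    (B.spinStr.mdifferentiableAt_rep hj hi) hs v
  have h4 : mvfderiv (𝓡 5) (B.localRep (B.spinStr.indexAt x) s) x v =
      mvfderiv (𝓡 5) (B.spinStr.rep (B.spinStr.indexAt x) i) x v (B.localRep i s x) +
        B.spinStr.rep (B.spinStr.indexAt x) i x (mvfderiv (𝓡 5) (B.localRep i s) x v) := by
    rw [mvfderiv_congr h2]
    exact h3
  have h5 : s x = B.spinStr.rep (B.spinStr.indexAt x) i x (B.localRep i s x) := by
    have := B.spinStr.rep_mul_rep_symm hj hi
    exact (congrArg (fun A : S →L[ℝ] S ↦ A (s x)) this).symm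
  have h6 := B.spinStr.rep_mul_rep_symm hi hj
  rw [B.mvfderiv_rep hj hi] at h4
  rw [h1, h4, h5]
  have key : ∀ (a b c d : S →L[ℝ] S) (p q : S), a * b = 1 →
      a ((b * c - d * b) p + b q + d (b p)) = q + c p := by
    intro a b c d p q hab
    have hab' : ∀ z, a (b z) = z := fun z ↦ congrArg (fun A : S →L[ℝ] S ↦ A z) hab
    have e : (b * c - d * b) p = b (c p) - d (b p) := rfl
    rw [e, map_add, map_add, map_sub, hab', hab']
    abel
  exact key _ _ _ _ _ _ h6

end Background

/-! ### Coordinates -/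

section Coordinates

open VectorField Topology

variable {M : Type*} [TopologicalSpace M] [ChartedSpace (EuclideanSpace ℝ (Fin 5)) M]
  [IsManifold (𝓡 5) ∞ M] {F : Type*} [NormedAddCommGroup F] [NormedSpace ℝ F]

/-- The components of a tangent vector at `y` in the chart around `x₀`. -/
def chartComp (x₀ y : M) : TangentSpace (𝓡 5) y →L[ℝ] EuclideanSpace ℝ (Fin 5) :=
  (trivializationAt (EuclideanSpace ℝ (Fin 5)) (TangentSpace (𝓡 5)) x₀).continuousLinearMapAt ℝ y

/-- The vector field with constant components `w` in the chart around `x₀`. -/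
def chartField (x₀ : M) (w : EuclideanSpace ℝ (Fin 5)) (y : M) : TangentSpace (𝓡 5) y :=
  (trivializationAt (EuclideanSpace ℝ (Fin 5)) (TangentSpace (𝓡 5)) x₀).symmL ℝ y w

theorem mem_baseSet_iff_mem_source {x₀ y : M} :
    y ∈ (trivializationAt (EuclideanSpace ℝ (Fin 5)) (TangentSpace (𝓡 5)) x₀).baseSet ↔
      y ∈ (extChartAt (𝓡 5) x₀).source := by
  rw [extChartAt_source]
  rfl

theorem chartComp_chartField {x₀ y : M} (hy : y ∈ (extChartAt (𝓡 5) x₀).source)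
    (w : EuclideanSpace ℝ (Fin 5)) : chartComp x₀ y (chartField x₀ w y) = w :=
  (trivializationAt (EuclideanSpace ℝ (Fin 5)) (TangentSpace (𝓡 5)) x₀).continuousLinearMapAt_symmL
    (mem_baseSet_iff_mem_source.2 hy) w

theorem chartField_chartComp {x₀ y : M} (hy : y ∈ (extChartAt (𝓡 5) x₀).source)
    (v : TangentSpace (𝓡 5) y) : chartField x₀ (chartComp x₀ y v) y = v :=
  (trivializationAt (EuclideanSpace ℝ (Fin 5)) (TangentSpace (𝓡 5)) x₀).symmL_continuousLinearMapAt
    (mem_baseSet_iff_mem_source.2 hy) v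

theorem contMDiffAt_chartField {x₀ y : M} (hy : y ∈ (extChartAt (𝓡 5) x₀).source)
    (w : EuclideanSpace ℝ (Fin 5)) :
    ContMDiffAt (𝓡 5) (𝓡 5).tangent ∞
      (fun x ↦ (⟨x, chartField x₀ w x⟩ : TangentBundle (𝓡 5) M)) y := by
  refine ((trivializationAt (EuclideanSpace ℝ (Fin 5)) (TangentSpace (𝓡 5))
    x₀).contMDiffAt_section_iff
    (mem_baseSet_iff_mem_source.2 hy)).2 ?_
  refine (contMDiffAt_const (c := w)).congr_of_eventuallyEq ?_
  filter_upwards [(isOpen_extChartAt_source x₀).mem_nhds hy] with z hz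
  have := chartComp_chartField hz w
  rwa [chartComp, Trivialization.continuousLinearMapAt_apply_of_mem ℝ _
    (mem_baseSet_iff_mem_source.2 hz)] at this

theorem differentiableAt_comp_extChartAt_symm {f : M → F} {x₀ y : M}
    (hy : y ∈ (extChartAt (𝓡 5) x₀).source) (hf : MDifferentiableAt (𝓡 5) 𝓘(ℝ, F) f y) :
    DifferentiableAt ℝ (f ∘ (extChartAt (𝓡 5) x₀).symm) (extChartAt (𝓡 5) x₀ y) := by
  have h := mdifferentiableWithinAt_extChartAt_symm (I := 𝓡 5) ((extChartAt (𝓡 5) x₀).map_source hy)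
  rw [ModelWithCorners.range_eq_univ, mdifferentiableWithinAt_univ] at h
  rw [← mdifferentiableAt_iff_differentiableAt]
  refine MDifferentiableAt.comp _ ?_ h
  rwa [(extChartAt (𝓡 5) x₀).left_inv hy]

theorem mvfderiv_eq_fderiv {f : M → F} {x₀ y : M}
    (hy : y ∈ (extChartAt (𝓡 5) x₀).source) (hf : MDifferentiableAt (𝓡 5) 𝓘(ℝ, F) f y)
    (v : TangentSpace (𝓡 5) y) :
    mvfderiv (𝓡 5) f y v =
      fderiv ℝ (f ∘ (extChartAt (𝓡 5) x₀).symm) (extChartAt (𝓡 5) x₀ y) (chartComp x₀ y v) := by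
  have hd := differentiableAt_comp_extChartAt_symm hy hf
  have hφ : MDifferentiableAt (𝓡 5) 𝓘(ℝ, EuclideanSpace ℝ (Fin 5)) (extChartAt (𝓡 5) x₀) y :=
    mdifferentiableAt_extChartAt (by rwa [extChartAt_source] at hy)
  have he : f =ᶠ[𝓝 y] (f ∘ (extChartAt (𝓡 5) x₀).symm) ∘ extChartAt (𝓡 5) x₀ := by
    filter_upwards [(isOpen_extChartAt_source x₀).mem_nhds hy] with z hz
    exact congrArg f ((extChartAt (𝓡 5) x₀).left_inv hz).symm
  rw [mvfderiv_congr he, chartComp, TangentBundle.continuousLinearMapAt_trivializationAt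
    (by rwa [extChartAt_source] at hy)]
  have h1 := mfderiv_comp y hd.mdifferentiableAt hφ
  have h2 : ∀ u, mvfderiv (𝓡 5) ((f ∘ (extChartAt (𝓡 5) x₀).symm) ∘ extChartAt (𝓡 5) x₀) y u =
    mfderiv (𝓡 5) 𝓘(ℝ, F) ((f ∘ (extChartAt (𝓡 5) x₀).symm) ∘ extChartAt (𝓡 5) x₀) y u :=
    fun u ↦ rfl
  rw [h2, h1, mfderiv_eq_fderiv]
  rfl

theorem mvfderiv_chartField {f : M → F} {x₀ y : M}
    (hy : y ∈ (extChartAt (𝓡 5) x₀).source) (hf : MDifferentiableAt (𝓡 5) 𝓘(ℝ, F) f y)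
    (w : EuclideanSpace ℝ (Fin 5)) :
    mvfderiv (𝓡 5) f y (chartField x₀ w y) =
      fderiv ℝ (f ∘ (extChartAt (𝓡 5) x₀).symm) (extChartAt (𝓡 5) x₀ y) w := by
  rw [mvfderiv_eq_fderiv hy hf, chartComp_chartField hy]

theorem contDiffAt_comp_extChartAt_symm {f : M → F} {x₀ y : M} {n : WithTop ℕ∞} (hn : n ≤ ∞)
    (hy : y ∈ (extChartAt (𝓡 5) x₀).source) (hf : ContMDiffAt (𝓡 5) 𝓘(ℝ, F) n f y) :
    ContDiffAt ℝ n (f ∘ (extChartAt (𝓡 5) x₀).symm) (extChartAt (𝓡 5) x₀ y) := by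
  have h := contMDiffWithinAt_extChartAt_symm_range (I := 𝓡 5) (n := ∞) x₀
    ((extChartAt (𝓡 5) x₀).map_source hy)
  rw [ModelWithCorners.range_eq_univ, contMDiffWithinAt_univ] at h
  rw [← contMDiffAt_iff_contDiffAt]
  refine ContMDiffAt.comp _ ?_ (h.of_le hn)
  rwa [(extChartAt (𝓡 5) x₀).left_inv hy]

theorem differentiableAt_chartComp {X : ∀ x : M, TangentSpace (𝓡 5) x} {x₀ y : M}
    (hy : y ∈ (extChartAt (𝓡 5) x₀).source)
    (hX : MDifferentiableAt (𝓡 5) (𝓡 5).tangent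
      (fun x ↦ (⟨x, X x⟩ : TangentBundle (𝓡 5) M)) y) :
    MDifferentiableAt (𝓡 5) 𝓘(ℝ, EuclideanSpace ℝ (Fin 5)) (fun z ↦ chartComp x₀ z (X z)) y := by
  have h := ((trivializationAt (EuclideanSpace ℝ (Fin 5)) (TangentSpace (𝓡 5))
    x₀).mdifferentiableAt_section_iff (𝓡 5) X (mem_baseSet_iff_mem_source.2 hy)).1 hX
  refine h.congr_of_eventuallyEq ?_
  filter_upwards [(isOpen_extChartAt_source x₀).mem_nhds hy] with z hz
  rw [chartComp, Trivialization.continuousLinearMapAt_apply_of_mem ℝ _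
    (mem_baseSet_iff_mem_source.2 hz)]

/-- The bracket on `M` is defined by pulling the fields back along the inverse chart, and near the
image of `x` the pulled-back fields are the chart components. -/
theorem chartComp_mlieBracket (X Y : ∀ x : M, TangentSpace (𝓡 5) x) (x : M) :
    chartComp x x (mlieBracket (𝓡 5) X Y x) =
      lieBracket ℝ ((fun y ↦ chartComp x y (X y)) ∘ (extChartAt (𝓡 5) x).symm)
        ((fun y ↦ chartComp x y (Y y)) ∘ (extChartAt (𝓡 5) x).symm) (extChartAt (𝓡 5) x x) := by
  have hp : ∀ Z : ∀ x : M, TangentSpace (𝓡 5) x,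
      (mpullbackWithin 𝓘(ℝ, EuclideanSpace ℝ (Fin 5)) (𝓡 5) (extChartAt (𝓡 5) x).symm Z
        (Set.range (𝓡 5)) : EuclideanSpace ℝ (Fin 5) → EuclideanSpace ℝ (Fin 5))
      =ᶠ[𝓝 (extChartAt (𝓡 5) x x)]
        ((fun y ↦ chartComp x y (Z y)) ∘ (extChartAt (𝓡 5) x).symm) := by
    intro Z
    filter_upwards [extChartAt_target_mem_nhds (I := 𝓡 5) x] with z hz
    have hs := (extChartAt (𝓡 5) x).map_target hz
    have e2 := mfderiv_extChartAt_comp_mfderivWithin_extChartAt_symm (I := 𝓡 5) hz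
    have e1 := mfderivWithin_extChartAt_symm_comp_mfderiv_extChartAt (I := 𝓡 5) hz
    rw [mpullbackWithin_apply, ContinuousLinearMap.inverse_eq e1 e2, Function.comp_apply,
      chartComp, TangentBundle.continuousLinearMapAt_trivializationAt
      (by rwa [extChartAt_source] at hs)]
    rfl
  have hb := mlieBracketWithin_apply (I := 𝓡 5) (V := X) (W := Y) (s := Set.univ) (x₀ := x)
  have hr : (extChartAt (𝓡 5) x).symm ⁻¹' Set.univ ∩ Set.range (𝓡 5) = Set.univ := by
    rw [ModelWithCorners.range_eq_univ]
    simp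
  rw [mlieBracketWithin_univ, hr] at hb
  have h := (congrFun (lieBracketWithin_univ (𝕜 := ℝ)) (extChartAt (𝓡 5) x x)).trans
    ((hp X).lieBracket_vectorField_eq (hp Y))
  rw [chartComp, TangentBundle.continuousLinearMapAt_trivializationAt (mem_chart_source _ x)]
  refine (congrArg (mfderiv (𝓡 5) 𝓘(ℝ, EuclideanSpace ℝ (Fin 5)) (extChartAt (𝓡 5) x) x)
    (hb.trans (congrArg _ h))).trans ?_
  exact (isInvertible_mfderiv_extChartAt (mem_extChartAt_source x)).self_apply_inverse _

/-- The Lie bracket is the commutator of derivations. -/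
theorem mvfderiv_mlieBracket {f : M → F} {x : M} (hf : ContMDiffAt (𝓡 5) 𝓘(ℝ, F) 2 f x)
    {X Y : ∀ x : M, TangentSpace (𝓡 5) x}
    (hX : MDifferentiableAt (𝓡 5) (𝓡 5).tangent (fun x ↦ (⟨x, X x⟩ : TangentBundle (𝓡 5) M)) x)
    (hY : MDifferentiableAt (𝓡 5) (𝓡 5).tangent (fun x ↦ (⟨x, Y x⟩ : TangentBundle (𝓡 5) M)) x) :
    mvfderiv (𝓡 5) f x (mlieBracket (𝓡 5) X Y x) =
      mvfderiv (𝓡 5) (fun y ↦ mvfderiv (𝓡 5) f y (Y y)) x (X x) -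
        mvfderiv (𝓡 5) (fun y ↦ mvfderiv (𝓡 5) f y (X y)) x (Y x) := by
  have hx := mem_extChartAt_source (I := 𝓡 5) x
  have hs := (isOpen_extChartAt_source (I := 𝓡 5) x).mem_nhds hx
  set φ := extChartAt (𝓡 5) x with hφ
  have hF : ContDiffAt ℝ 2 (f ∘ φ.symm) (φ x) :=
    contDiffAt_comp_extChartAt_symm (WithTop.coe_le_coe.2 (le_top : (2 : ℕ∞) ≤ ⊤)) hx hf
  have hF' : DifferentiableAt ℝ (fderiv ℝ (f ∘ φ.symm)) (φ x) :=
    (hF.fderiv_right (m := 1) (by norm_num)).differentiableAt (by simp)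
  have hfe : ∀ᶠ y in 𝓝 x, MDifferentiableAt (𝓡 5) 𝓘(ℝ, F) f y := by
    filter_upwards [contMDiffAt_iff_contMDiffAt_nhds (by simp) |>.1 hf] with y hy
      using hy.mdifferentiableAt (by simp)
  have hinv : ∀ {G : Type _} (k : M → G), ∀ y ∈ φ.source, (k ∘ φ.symm) (φ y) = k y :=
    fun k y hy ↦ congrArg k (φ.left_inv hy)
  -- In the chart, an iterated derivative of `f` is a Hessian term plus `df` applied to the
  -- derivative of the components of the inner field. In the commutator the Hessian terms cancel by
  -- symmetry, and the rest is `df` of the coordinate Lie bracket.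
  have key : ∀ (Z : ∀ x : M, TangentSpace (𝓡 5) x) (W : TangentSpace (𝓡 5) x),
      MDifferentiableAt (𝓡 5) (𝓡 5).tangent (fun x ↦ (⟨x, Z x⟩ : TangentBundle (𝓡 5) M)) x →
      mvfderiv (𝓡 5) (fun y ↦ mvfderiv (𝓡 5) f y (Z y)) x W =
        fderiv ℝ (fderiv ℝ (f ∘ φ.symm)) (φ x) (chartComp x x W) (chartComp x x (Z x)) +
        fderiv ℝ (f ∘ φ.symm) (φ x) (fderiv ℝ ((fun y ↦ chartComp x y (Z y)) ∘ φ.symm) (φ x)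
          (chartComp x x W)) := by
    intro Z W hZ
    have hk := differentiableAt_chartComp hx hZ
    obtain ⟨k, hkdef⟩ : ∃ k : M → EuclideanSpace ℝ (Fin 5), k = fun y ↦ chartComp x y (Z y) :=
      ⟨_, rfl⟩
    have hkx : chartComp x x (Z x) = k x := by rw [hkdef]
    rw [← hkdef] at hk ⊢
    rw [hkx]
    have e : (fun y ↦ mvfderiv (𝓡 5) f y (Z y)) =ᶠ[𝓝 x]
        (fun z ↦ fderiv ℝ (f ∘ φ.symm) z ((k ∘ φ.symm) z)) ∘ φ := by
      filter_upwards [hfe, hs] with y hy hy'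
      rw [mvfderiv_eq_fderiv hy' hy, Function.comp_apply, hinv k y hy', hkdef]
    have hZ' : DifferentiableAt ℝ (k ∘ φ.symm) (φ x) :=
      differentiableAt_comp_extChartAt_symm hx hk
    have hd := hF'.clm_apply hZ'
    have hm : MDifferentiableAt (𝓡 5) 𝓘(ℝ, F)
        ((fun z ↦ fderiv ℝ (f ∘ φ.symm) z ((k ∘ φ.symm) z)) ∘ φ) x :=
      MDifferentiableAt.comp _ hd.mdifferentiableAt
        (mdifferentiableAt_extChartAt (mem_chart_source _ x))
    rw [mvfderiv_congr e, mvfderiv_eq_fderiv hx hm]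
    have e2 : ((fun z ↦ fderiv ℝ (f ∘ φ.symm) z ((k ∘ φ.symm) z)) ∘ φ) ∘ φ.symm =ᶠ[𝓝 (φ x)]
        (fun z ↦ fderiv ℝ (f ∘ φ.symm) z ((k ∘ φ.symm) z)) := by
      filter_upwards [extChartAt_target_mem_nhds (I := 𝓡 5) x] with z hz
      exact congrArg (fun z ↦ fderiv ℝ (f ∘ φ.symm) z ((k ∘ φ.symm) z)) (φ.right_inv hz)
    have e3 : fderiv ℝ (((fun z ↦ fderiv ℝ (f ∘ φ.symm) z ((k ∘ φ.symm) z)) ∘ φ) ∘ φ.symm) (φ x) =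
      fderiv ℝ (fun z ↦ fderiv ℝ (f ∘ φ.symm) z ((k ∘ φ.symm) z)) (φ x) := e2.fderiv_eq
    refine (congrArg (fun A ↦ A (chartComp x x W)) e3).trans ?_
    rw [fderiv_clm_apply hF' hZ', add_comm, add_apply, ContinuousLinearMap.flip_apply,
      hinv k x hx]
    rfl
  have hl := mvfderiv_eq_fderiv hx (hf.mdifferentiableAt (by simp)) (mlieBracket (𝓡 5) X Y x)
  rw [chartComp_mlieBracket, lieBracket] at hl
  rw [hl, key Y _ hY, key X _ hX, ← hφ, hinv (fun y ↦ chartComp x y (X y)) x hx,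
    hinv (fun y ↦ chartComp x y (Y y)) x hx, map_sub,
    (hF.isSymmSndFDerivAt (by simp)).eq (chartComp x x (X x)) (chartComp x x (Y x))]
  abel

/-- The commutator formula is applied to the chart map itself. Its derivative along a chart field is
constant, so the bracket has zero components. -/
theorem mlieBracket_chartField {x₀ y : M} (hy : y ∈ (extChartAt (𝓡 5) x₀).source)
    (v w : EuclideanSpace ℝ (Fin 5)) :
    mlieBracket (𝓡 5) (chartField x₀ v) (chartField x₀ w) y = 0 := by
  have hφ : ∀ z ∈ (extChartAt (𝓡 5) x₀).source,
      ContMDiffAt (𝓡 5) 𝓘(ℝ, EuclideanSpace ℝ (Fin 5)) ∞ (extChartAt (𝓡 5) x₀) z :=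
    fun z hz ↦ contMDiffAt_extChartAt' (by rwa [extChartAt_source] at hz)
  have h1 : ∀ z ∈ (extChartAt (𝓡 5) x₀).source, ∀ u,
      mvfderiv (𝓡 5) (extChartAt (𝓡 5) x₀) z u = chartComp x₀ z u := by
    intro z hz u
    rw [chartComp, TangentBundle.continuousLinearMapAt_trivializationAt
      (by rwa [extChartAt_source] at hz)]
    rfl
  have h2 : ∀ u, (fun z ↦ mvfderiv (𝓡 5) (extChartAt (𝓡 5) x₀) z (chartField x₀ u z)) =ᶠ[𝓝 y]
      fun _ ↦ u := by
    intro u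
    filter_upwards [(isOpen_extChartAt_source x₀).mem_nhds hy] with z hz
    rw [h1 z hz, chartComp_chartField hz]
  have hd : ∀ u, MDifferentiableAt (𝓡 5) (𝓡 5).tangent
      (fun x ↦ (⟨x, chartField x₀ u x⟩ : TangentBundle (𝓡 5) M)) y :=
    fun u ↦ (contMDiffAt_chartField hy u).mdifferentiableAt (by simp)
  have h3 := mvfderiv_mlieBracket ((hφ y hy).of_le
    (WithTop.coe_le_coe.2 (le_top : (2 : ℕ∞) ≤ ⊤))) (hd v) (hd w)
  rw [mvfderiv_congr (h2 v), mvfderiv_congr (h2 w), mvfderiv_const, mvfderiv_const, h1 y hy] at h3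
  rw [← chartField_chartComp hy (mlieBracket (𝓡 5) (chartField x₀ v) (chartField x₀ w) y), h3]
  simp [chartField]

end Coordinates

/-! ### The superconnection in coordinates -/

open VectorField Topology

variable {M : Type*} [TopologicalSpace M] [ChartedSpace (EuclideanSpace ℝ (Fin 5)) M]
  [IsManifold (𝓡 5) ∞ M]

section ContMDiff

variable {F : Type*} [NormedAddCommGroup F] [NormedSpace ℝ F] {n : WithTop ℕ∞} {x : M}

omit [IsManifold (𝓡 5) ∞ M] in
theorem contMDiffAt_fun_smul {f : M → ℝ} {k : M → F} (hf : ContMDiffAt (𝓡 5) 𝓘(ℝ, ℝ) n f x)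
    (hk : ContMDiffAt (𝓡 5) 𝓘(ℝ, F) n k x) :
    ContMDiffAt (𝓡 5) 𝓘(ℝ, F) n (fun y ↦ f y • k y) x :=
  hf.smul hk

omit [IsManifold (𝓡 5) ∞ M] in
theorem contMDiffAt_const_smul (c : ℝ) {k : M → F} (hk : ContMDiffAt (𝓡 5) 𝓘(ℝ, F) n k x) :
    ContMDiffAt (𝓡 5) 𝓘(ℝ, F) n (fun y ↦ c • k y) x :=
  contMDiffAt_fun_smul contMDiffAt_const hk

omit [IsManifold (𝓡 5) ∞ M] in
theorem contMDiffAt_fun_mul {f k : M → F →L[ℝ] F} (hf : ContMDiffAt (𝓡 5) 𝓘(ℝ, F →L[ℝ] F) n f x)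
    (hk : ContMDiffAt (𝓡 5) 𝓘(ℝ, F →L[ℝ] F) n k x) :
    ContMDiffAt (𝓡 5) 𝓘(ℝ, F →L[ℝ] F) n (fun y ↦ f y * k y) x :=
  hf.clm_comp hk

omit [IsManifold (𝓡 5) ∞ M] in
theorem contMDiffAt_fun_sub {f k : M → F} (hf : ContMDiffAt (𝓡 5) 𝓘(ℝ, F) n f x)
    (hk : ContMDiffAt (𝓡 5) 𝓘(ℝ, F) n k x) :
    ContMDiffAt (𝓡 5) 𝓘(ℝ, F) n (fun y ↦ f y - k y) x :=
  hf.sub hk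

end ContMDiff

namespace SpinStructure

variable {g : LorentzMetric M} {ι : Type*} (P : SpinStructure g ι)

theorem contMDiffAt_structFun {i : ι} {x : M} (hx : x ∈ P.baseSet i) (ρ ν μ : Fin 5) :
    ContMDiffAt (𝓡 5) 𝓘(ℝ, ℝ) ∞ (fun y ↦ P.structFun i y ρ ν μ) x := by
  have : IsManifold (𝓡 5) (((⊤ : ℕ∞) : WithTop ℕ∞) + 1) M := inferInstanceAs (IsManifold (𝓡 5) ∞ M)
  have : IsManifold (𝓡 5) (minSmoothness ℝ 2) M := by
    rw [minSmoothness_of_isRCLikeNormedField]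
    infer_instance
  exact g.contMDiffAt_inner (ContMDiffAt.mlieBracket_vectorField (n := ⊤) (m := ⊤)
    (P.contMDiffAt_frame hx ρ) (P.contMDiffAt_frame hx ν) (by simp)) (P.contMDiffAt_frame hx μ)

/-- Near `x` the Koszul expression reduces to structure functions, which are smooth because brackets
of smooth fields are. -/
theorem contMDiffAt_connForm {i : ι} {x : M} (hx : x ∈ P.baseSet i)
    {X : ∀ x : M, TangentSpace (𝓡 5) x}
    (hX : ContMDiffAt (𝓡 5) (𝓡 5).tangent ∞ (fun x ↦ (⟨x, X x⟩ : TangentBundle (𝓡 5) M)) x)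
    (μ ν : Fin 5) :
    ContMDiffAt (𝓡 5) 𝓘(ℝ, ℝ) ∞ (fun y ↦ P.connForm i y μ ν (X y)) x := by
  have h : (fun y ↦ P.connForm i y μ ν (X y)) =ᶠ[𝓝 x] fun y ↦ ∑ ρ,
      (1 / 2 : ℝ) * (P.structFun i y ρ ν μ - P.structFun i y ν μ ρ + P.structFun i y μ ρ ν) *
        P.comp i y ρ (X y) := by
    filter_upwards [(P.isOpen_baseSet i).mem_nhds hx] with y hy
    refine (P.connMatrix_apply i y (X y) μ ν).trans (Finset.sum_congr rfl fun ρ _ ↦ ?_)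
    rw [P.leviCivita_frame hy]
  refine ContMDiffAt.congr_of_eventuallyEq ?_ h
  refine contMDiffAt_finsetSum fun ρ _ ↦ ContMDiffAt.mul (contMDiffAt_const.mul ?_)
    (P.contMDiffAt_comp hx hX ρ)
  exact ((P.contMDiffAt_structFun hx ρ ν μ).sub (P.contMDiffAt_structFun hx ν μ ρ)).add
    (P.contMDiffAt_structFun hx μ ρ ν)

theorem contMDiffAt_spinForm {i : ι} {x : M} (hx : x ∈ P.baseSet i)
    {X : ∀ x : M, TangentSpace (𝓡 5) x}
    (hX : ContMDiffAt (𝓡 5) (𝓡 5).tangent ∞ (fun x ↦ (⟨x, X x⟩ : TangentBundle (𝓡 5) M)) x) :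
    ContMDiffAt (𝓡 5) 𝓘(ℝ, S →L[ℝ] S) ∞ (fun y ↦ P.spinForm i y (X y)) x :=
  contMDiffAt_const_smul _ (contMDiffAt_finsetSum fun μ _ ↦ contMDiffAt_finsetSum fun ν _ ↦
    contMDiffAt_fun_smul (contMDiffAt_const.mul (P.contMDiffAt_connForm hx hX μ ν))
      contMDiffAt_const)

theorem contMDiffAt_slash {i : ι} {x : M} (hx : x ∈ P.baseSet i)
    {X : ∀ x : M, TangentSpace (𝓡 5) x}
    (hX : ContMDiffAt (𝓡 5) (𝓡 5).tangent ∞ (fun x ↦ (⟨x, X x⟩ : TangentBundle (𝓡 5) M)) x) :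
    ContMDiffAt (𝓡 5) 𝓘(ℝ, S →L[ℝ] S) ∞ (fun y ↦ P.slash i y (X y)) x :=
  contMDiffAt_finsetSum fun μ _ ↦ contMDiffAt_fun_smul (P.contMDiffAt_comp hx hX μ)
    contMDiffAt_const

end SpinStructure

namespace Background

variable {ι : Type*} (B : Background M ι)

theorem contMDiffAt_slashC {i : ι} {x : M} (hx : x ∈ B.spinStr.baseSet i) :
    ContMDiffAt (𝓡 5) 𝓘(ℝ, S →L[ℝ] S) ∞ (B.slashC i) x :=
  contMDiffAt_const_smul _ (contMDiffAt_finsetSum fun μ _ ↦ contMDiffAt_finsetSum fun ν _ ↦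
    contMDiffAt_fun_smul (contMDiffAt_const.mul (B.C.contMDiffAt_apply
      (B.spinStr.contMDiffAt_frame hx μ) (B.spinStr.contMDiffAt_frame hx ν))) contMDiffAt_const)

theorem contMDiffAt_slashF {i : ι} {x : M} (hx : x ∈ B.spinStr.baseSet i) :
    ContMDiffAt (𝓡 5) 𝓘(ℝ, S →L[ℝ] S) ∞ (B.slashF i) x := by
  refine contMDiffAt_finsetSum fun μ _ ↦ contMDiffAt_const_smul _
    (contMDiffAt_fun_mul contMDiffAt_const ?_)
  exact (LinearMap.toContinuousLinearMap spActionL).contMDiff.contMDiffAt.comp x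
    (B.F.contMDiffAt_apply (B.spinStr.contMDiffAt_frame hx μ))

theorem contMDiffAt_superForm {i : ι} {x : M} (hx : x ∈ B.spinStr.baseSet i)
    {X : ∀ x : M, TangentSpace (𝓡 5) x}
    (hX : ContMDiffAt (𝓡 5) (𝓡 5).tangent ∞ (fun x ↦ (⟨x, X x⟩ : TangentBundle (𝓡 5) M)) x) :
    ContMDiffAt (𝓡 5) 𝓘(ℝ, S →L[ℝ] S) ∞ (fun y ↦ B.superForm i y (X y)) x := by
  have h1 := B.spinStr.contMDiffAt_slash hx hX
  have h2 := B.contMDiffAt_slashC hx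
  have h3 := B.contMDiffAt_slashF hx
  exact contMDiffAt_fun_sub (B.spinStr.contMDiffAt_spinForm hx hX)
    (contMDiffAt_fun_sub (contMDiffAt_fun_sub (contMDiffAt_fun_sub
      (contMDiffAt_const_smul _ (contMDiffAt_fun_mul h1 h2))
      (contMDiffAt_const_smul _ (contMDiffAt_fun_mul h2 h1)))
      (contMDiffAt_const_smul _ (contMDiffAt_fun_mul h1 h3)))
      (contMDiffAt_const_smul _ (contMDiffAt_fun_mul h3 h1)))

/-- The connection form of the superconnection in the frame `i` and in the chart around `x₀`. -/
def chartForm (x₀ : M) (i : ι) (z : EuclideanSpace ℝ (Fin 5)) :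
    EuclideanSpace ℝ (Fin 5) →L[ℝ] S →L[ℝ] S :=
  LinearMap.toContinuousLinearMap
    { toFun := fun w ↦ B.superForm i ((extChartAt (𝓡 5) x₀).symm z)
        (chartField x₀ w ((extChartAt (𝓡 5) x₀).symm z))
      map_add' := fun v w ↦ by
        simp only [chartField, map_add, superForm, SpinStructure.spinForm_add, betaOp_add]
        abel
      map_smul' := fun c w ↦ by
        simp only [chartField, map_smul, superForm, SpinStructure.spinForm_smul, betaOp_smul,
          smul_sub, RingHom.id_apply] }

theorem chartForm_apply {x₀ y : M} (hy : y ∈ (extChartAt (𝓡 5) x₀).source) (i : ι)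
    (w : EuclideanSpace ℝ (Fin 5)) :
    B.chartForm x₀ i (extChartAt (𝓡 5) x₀ y) w = B.superForm i y (chartField x₀ w y) := by
  have h : ∀ y', y' = y → B.superForm i y' (chartField x₀ w y') =
      B.superForm i y (chartField x₀ w y) := by
    rintro _ rfl
    rfl
  exact h _ ((extChartAt (𝓡 5) x₀).left_inv hy)

/-- The part of the chart around `x₀` that lies in the domain of the frame `i`. -/
def chartDomain (x₀ : M) (i : ι) : Set (EuclideanSpace ℝ (Fin 5)) :=
  (extChartAt (𝓡 5) x₀).target ∩ (extChartAt (𝓡 5) x₀).symm ⁻¹' B.spinStr.baseSet i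

theorem isOpen_chartDomain (x₀ : M) (i : ι) : IsOpen (B.chartDomain x₀ i) :=
  (continuousOn_extChartAt_symm x₀).isOpen_inter_preimage (isOpen_extChartAt_target x₀)
    (B.spinStr.isOpen_baseSet i)

theorem mem_chartDomain {x₀ y : M} {i : ι} (hy : y ∈ (extChartAt (𝓡 5) x₀).source)
    (hi : y ∈ B.spinStr.baseSet i) : extChartAt (𝓡 5) x₀ y ∈ B.chartDomain x₀ i :=
  ⟨(extChartAt (𝓡 5) x₀).map_source hy, by
    rwa [Set.mem_preimage, (extChartAt (𝓡 5) x₀).left_inv hy]⟩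

theorem contDiffOn_chartForm (x₀ : M) (i : ι) :
    ContDiffOn ℝ ∞ (B.chartForm x₀ i) (B.chartDomain x₀ i) := by
  refine contDiffOn_clm_apply.2 fun w z hz ↦ ContDiffAt.contDiffWithinAt ?_
  have hs := (extChartAt (𝓡 5) x₀).map_target hz.1
  have h := contDiffAt_comp_extChartAt_symm le_rfl hs
    (B.contMDiffAt_superForm hz.2 (contMDiffAt_chartField hs w))
  rwa [(extChartAt (𝓡 5) x₀).right_inv hz.1] at h

attribute [irreducible] chartForm

theorem rep_superconnection_chartField {x₀ y : M} {i : ι}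
    (hy : y ∈ (extChartAt (𝓡 5) x₀).source) (hi : y ∈ B.spinStr.baseSet i)
    {s : ∀ x : M, B.spinStr.Fiber x} (hs : MDifferentiableAt (𝓡 5) 𝓘(ℝ, S) (B.localRep i s) y)
    (w : EuclideanSpace ℝ (Fin 5)) :
    B.spinStr.rep i (B.spinStr.indexAt y) y (B.superconnection s y (chartField x₀ w y)) =
      fderiv ℝ (B.localRep i s ∘ (extChartAt (𝓡 5) x₀).symm) (extChartAt (𝓡 5) x₀ y) w +
        B.chartForm x₀ i (extChartAt (𝓡 5) x₀ y) w (B.localRep i s y) := by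
  rw [B.rep_superconnection hi hs, mvfderiv_chartField hy hs, B.chartForm_apply hy]

/-- The section with components `σ` in the frame `i`. -/
def ofLocalRep (i : ι) (σ : M → S) (x : M) : B.spinStr.Fiber x :=
  show S from B.spinStr.rep (B.spinStr.indexAt x) i x (σ x)

theorem localRep_ofLocalRep {i : ι} {x : M} (hi : x ∈ B.spinStr.baseSet i) (σ : M → S) :
    B.localRep i (B.ofLocalRep i σ) x = σ x :=
  congrArg (fun A : S →L[ℝ] S ↦ A (σ x))
    (B.spinStr.rep_mul_rep_symm hi (B.spinStr.mem_baseSet_at x))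

theorem ofLocalRep_localRep {i : ι} {x : M} (hi : x ∈ B.spinStr.baseSet i)
    (s : ∀ x : M, B.spinStr.Fiber x) : B.ofLocalRep i (B.localRep i s) x = s x :=
  congrArg (fun A : S →L[ℝ] S ↦ A (s x))
    (B.spinStr.rep_mul_rep_symm (B.spinStr.mem_baseSet_at x) hi)

theorem eq_of_localRep_eq {i : ι} {x : M} (hi : x ∈ B.spinStr.baseSet i)
    {s t : ∀ x : M, B.spinStr.Fiber x} (h : B.localRep i s x = B.localRep i t x) : s x = t x := by
  rw [← B.ofLocalRep_localRep hi s, ← B.ofLocalRep_localRep hi t, ofLocalRep, ofLocalRep, h]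

/-- `localRep i s` is the fibre coordinate of `s` in the local trivialization of index `i`. -/
theorem contMDiffAt_localRep_iff {i : ι} {x : M} (hi : x ∈ B.spinStr.baseSet i)
    {s : ∀ x : M, B.spinStr.Fiber x} {n : WithTop ℕ∞} (hn : n ≤ ∞) :
    ContMDiffAt (𝓡 5) ((𝓡 5).prod 𝓘(ℝ, S)) n (fun x ↦ TotalSpace.mk' S x (s x)) x ↔
      ContMDiffAt (𝓡 5) 𝓘(ℝ, S) n (B.localRep i s) x := by
  have : ContMDiffVectorBundle n S B.spinStr.Fiber (𝓡 5) := ContMDiffVectorBundle.of_le hn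
  have : MemTrivializationAtlas (B.spinStr.bundleCore.localTriv i) := ⟨⟨i, rfl⟩⟩
  exact (B.spinStr.bundleCore.localTriv i).contMDiffAt_section_iff (IB := 𝓡 5) (n := n) hi

end Background

/-! ### Parallel spinor fields -/

open VectorField Topology Metric

section Regularity

set_option maxSynthPendingDepth 3

variable {E F : Type*} [NormedAddCommGroup E] [NormedSpace ℝ E] [NormedAddCommGroup F]
  [NormedSpace ℝ F] {A : E → E →L[ℝ] F →L[ℝ] F}

/-- Bootstrapping: the equation expresses the derivative of `σ` through `A` and `σ`, so each order
of smoothness of `σ` yields the next. -/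
theorem contDiffOn_of_parallel {U : Set E} (hU : IsOpen U) (hA : ContDiffOn ℝ ∞ A U) {σ : E → F}
    (hσ : ∀ z ∈ U, HasFDerivAt σ (-(A z).flip (σ z)) z) : ContDiffOn ℝ ∞ σ U := by
  rw [contDiffOn_infty]
  intro n
  induction n with
  | zero =>
    exact contDiffOn_zero.2 fun z hz ↦ (hσ z hz).continuousAt.continuousWithinAt
  | succ n ih =>
    rw [Nat.cast_add, Nat.cast_one, contDiffOn_succ_iff_fderiv_of_isOpen hU]
    refine ⟨fun z hz ↦ (hσ z hz).differentiableAt.differentiableWithinAt, by simp, ?_⟩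
    have h1 : ContDiffOn ℝ n (fun z ↦ (A z).flip) U :=
      (ContinuousLinearMap.flipₗᵢ ℝ E F F).toContinuousLinearEquiv.contDiff.comp_contDiffOn
        (hA.of_le (by exact_mod_cast le_top))
    exact (h1.clm_apply ih).neg.congr fun z hz ↦ (hσ z hz).fderiv

end Regularity

variable {M : Type*} [TopologicalSpace M] [ChartedSpace (EuclideanSpace ℝ (Fin 5)) M]
  [IsManifold (𝓡 5) ∞ M]

/-- The preimage in `M` of a ball in the chart around `x₀`. -/
def chartBall (x₀ : M) (r : ℝ) : Set M :=
  (extChartAt (𝓡 5) x₀).source ∩ extChartAt (𝓡 5) x₀ ⁻¹' ball (extChartAt (𝓡 5) x₀ x₀) r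

omit [IsManifold (𝓡 5) ∞ M] in
theorem isOpen_chartBall (x₀ : M) (r : ℝ) : IsOpen (chartBall x₀ r) :=
  (continuousOn_extChartAt x₀).isOpen_inter_preimage (isOpen_extChartAt_source x₀) isOpen_ball

omit [IsManifold (𝓡 5) ∞ M] in
theorem mem_chartBall_self (x₀ : M) {r : ℝ} (hr : 0 < r) : x₀ ∈ chartBall x₀ r :=
  ⟨mem_extChartAt_source x₀, mem_ball_self hr⟩

namespace Background

variable {ι : Type*} (B : Background M ι)

/-- Smooth spinor fields on `U` with `𝒟 s = 0`. -/
def ParallelOn (s : ∀ x : M, B.spinStr.Fiber x) (U : Set M) : Prop :=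
  ∀ y ∈ U, ContMDiffAt (𝓡 5) ((𝓡 5).prod 𝓘(ℝ, S)) ∞ (fun x ↦ TotalSpace.mk' S x (s x)) y ∧
    B.superconnection s y = 0

variable {B} in
theorem ParallelOn.mono {s : ∀ x : M, B.spinStr.Fiber x} {U U' : Set M} (h : B.ParallelOn s U)
    (hU : U' ⊆ U) : B.ParallelOn s U' := fun y hy ↦ h y (hU hy)

variable {B} in
theorem ParallelOn.add {s t : ∀ x : M, B.spinStr.Fiber x} {U : Set M} (hs : B.ParallelOn s U)
    (ht : B.ParallelOn t U) : B.ParallelOn (s + t) U := fun y hy ↦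
  ⟨(hs y hy).1.add_section (ht y hy).1, by
    rw [B.superconnection.isCovariantDerivativeOnUniv.add
      ((hs y hy).1.mdifferentiableAt (by simp)) ((ht y hy).1.mdifferentiableAt (by simp)),
      (hs y hy).2, (ht y hy).2, add_zero]⟩

variable {B} in
theorem ParallelOn.const_smul {s : ∀ x : M, B.spinStr.Fiber x} {U : Set M} (c : ℝ)
    (hs : B.ParallelOn s U) : B.ParallelOn (c • s) U := fun y hy ↦
  ⟨(hs y hy).1.const_smul_section, by
    rw [B.superconnection.isCovariantDerivativeOnUniv.smul_const c
      ((hs y hy).1.mdifferentiableAt (by simp)), (hs y hy).2, smul_zero]⟩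

-- Translates parallel spinor fields into solutions of the equation on a trivial bundle over a piece
-- of the chart.
variable {B} in
theorem ParallelOn.hasFDerivAt {s : ∀ x : M, B.spinStr.Fiber x} {U : Set M}
    (hs : B.ParallelOn s U) {x₀ y : M} {i : ι} (hy : y ∈ U)
    (hy' : y ∈ (extChartAt (𝓡 5) x₀).source) (hi : y ∈ B.spinStr.baseSet i) :
    HasFDerivAt (B.localRep i s ∘ (extChartAt (𝓡 5) x₀).symm)
      (-(B.chartForm x₀ i (extChartAt (𝓡 5) x₀ y)).flip
        ((B.localRep i s ∘ (extChartAt (𝓡 5) x₀).symm) (extChartAt (𝓡 5) x₀ y)))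
      (extChartAt (𝓡 5) x₀ y) := by
  have hm : MDifferentiableAt (𝓡 5) 𝓘(ℝ, S) (B.localRep i s) y :=
    ((B.contMDiffAt_localRep_iff hi le_rfl).1 (hs y hy).1).mdifferentiableAt (by simp)
  have hd := (differentiableAt_comp_extChartAt_symm hy' hm).hasFDerivAt
  refine hd.congr_fderiv (ContinuousLinearMap.ext fun w ↦ ?_)
  have h := B.rep_superconnection_chartField hy' hi hm w
  have h0 : B.superconnection s y (chartField x₀ w y) = 0 := by
    rw [(hs y hy).2]
    rfl
  rw [h0] at h
  have h1 : (B.localRep i s ∘ (extChartAt (𝓡 5) x₀).symm) (extChartAt (𝓡 5) x₀ y) =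
      B.localRep i s y := congrArg (B.localRep i s) ((extChartAt (𝓡 5) x₀).left_inv hy')
  rw [neg_apply, ContinuousLinearMap.flip_apply, h1]
  exact eq_neg_of_add_eq_zero_left (h.symm.trans (map_zero _))

theorem superconnection_eq_zero_of_hasFDerivAt {s : ∀ x : M, B.spinStr.Fiber x} {x₀ y : M} {i : ι}
    (hy' : y ∈ (extChartAt (𝓡 5) x₀).source) (hi : y ∈ B.spinStr.baseSet i)
    (hm : MDifferentiableAt (𝓡 5) 𝓘(ℝ, S) (B.localRep i s) y)
    (hd : HasFDerivAt (B.localRep i s ∘ (extChartAt (𝓡 5) x₀).symm)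
      (-(B.chartForm x₀ i (extChartAt (𝓡 5) x₀ y)).flip (B.localRep i s y))
      (extChartAt (𝓡 5) x₀ y)) : B.superconnection s y = 0 := by
  refine ContinuousLinearMap.ext fun v ↦ ?_
  have h := B.rep_superconnection_chartField hy' hi hm (chartComp x₀ y v)
  rw [chartField_chartComp hy', hd.fderiv, neg_apply, ContinuousLinearMap.flip_apply,
    neg_add_cancel] at h
  have h1 := congrArg (B.spinStr.rep (B.spinStr.indexAt y) i y) h
  rw [map_zero] at h1
  have h2 := B.spinStr.rep_mul_rep_symm (B.spinStr.mem_baseSet_at y) hi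
  exact (congrArg (fun A : S →L[ℝ] S ↦ A (B.superconnection s y v)) h2).symm.trans h1

/-- Parallel spinor fields are determined by their value at a point. -/
theorem eq_of_parallelOn {x₀ : M} {r : ℝ} {i : ι}
    (hr : ball (extChartAt (𝓡 5) x₀ x₀) r ⊆ B.chartDomain x₀ i)
    {s t : ∀ x : M, B.spinStr.Fiber x} (hs : B.ParallelOn s (chartBall x₀ r))
    (ht : B.ParallelOn t (chartBall x₀ r)) {y z : M} (hy : y ∈ chartBall x₀ r)
    (hz : z ∈ chartBall x₀ r) (h : s y = t y) : s z = t z := by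
  have hbase : ∀ z ∈ chartBall x₀ r, z ∈ B.spinStr.baseSet i := fun z hz ↦ by
    have := (hr hz.2).2
    rwa [Set.mem_preimage, (extChartAt (𝓡 5) x₀).left_inv hz.1] at this
  -- The equation is linear, so the difference of the components is parallel on the ball, which is
  -- convex, and it vanishes at the image of `y`.
  obtain ⟨σ, hσ⟩ : ∃ σ : EuclideanSpace ℝ (Fin 5) → S,
      σ = B.localRep i s ∘ (extChartAt (𝓡 5) x₀).symm -
        B.localRep i t ∘ (extChartAt (𝓡 5) x₀).symm := ⟨_, rfl⟩
  have hev : ∀ z ∈ chartBall x₀ r, σ (extChartAt (𝓡 5) x₀ z) =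
      B.localRep i s z - B.localRep i t z := fun z hz ↦ by
    rw [hσ]
    exact congrArg (fun z ↦ B.localRep i s z - B.localRep i t z)
      ((extChartAt (𝓡 5) x₀).left_inv hz.1)
  have hpar : ∀ z ∈ ball (extChartAt (𝓡 5) x₀ x₀) r,
      HasFDerivAt σ (-(B.chartForm x₀ i z).flip (σ z)) z := by
    intro z hz
    have hz1 := (hr hz).1
    obtain ⟨y, hy, rfl⟩ : ∃ y ∈ (extChartAt (𝓡 5) x₀).source, extChartAt (𝓡 5) x₀ y = z :=
      ⟨_, (extChartAt (𝓡 5) x₀).map_target hz1, (extChartAt (𝓡 5) x₀).right_inv hz1⟩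
    have hyb : y ∈ chartBall x₀ r := ⟨hy, hz⟩
    rw [hσ]
    refine ((hs.hasFDerivAt hyb hy (hbase y hyb)).sub
      (ht.hasFDerivAt hyb hy (hbase y hyb))).congr_fderiv ?_
    rw [Pi.sub_apply, map_sub]
    abel
  have h0 := eq_zero_of_parallel (convex_ball _ r)
    ((B.contDiffOn_chartForm x₀ i).continuousOn.mono hr) hpar hy.2
    (by rw [hev y hy, localRep, localRep, h, sub_self]) hz.2
  rw [hev z hz] at h0
  exact B.eq_of_localRep_eq (hbase z hz) (sub_eq_zero.1 h0)

theorem exists_ball_subset_chartDomain (x₀ : M) :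
    ∃ r > 0, ball (extChartAt (𝓡 5) x₀ x₀) r ⊆ B.chartDomain x₀ (B.spinStr.indexAt x₀) :=
  Metric.isOpen_iff.1 (B.isOpen_chartDomain x₀ _) _
    (B.mem_chartDomain (mem_extChartAt_source x₀) (B.spinStr.mem_baseSet_at x₀))

/-- Two parallel spinor fields that agree at a point agree near that point. -/
theorem eventually_eq_of_parallelOn {s t : ∀ x : M, B.spinStr.Fiber x} {U : Set M} (hU : IsOpen U)
    (hs : B.ParallelOn s U) (ht : B.ParallelOn t U) {x : M} (hx : x ∈ U) (h : s x = t x) :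
    ∀ᶠ y in 𝓝 x, s y = t y := by
  obtain ⟨r, hr, hr'⟩ := B.exists_ball_subset_chartDomain x
  have hU' : IsOpen ((extChartAt (𝓡 5) x).target ∩ (extChartAt (𝓡 5) x).symm ⁻¹' U) :=
    (continuousOn_extChartAt_symm x).isOpen_inter_preimage (isOpen_extChartAt_target x) hU
  obtain ⟨ρ, hρ, hρ'⟩ := Metric.isOpen_iff.1 hU' (extChartAt (𝓡 5) x x)
    ⟨mem_extChartAt_target x, by rwa [Set.mem_preimage, extChartAt_to_inv]⟩
  have hsub : chartBall x (min r ρ) ⊆ U := fun y hy ↦ by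
    have := (hρ' (ball_subset_ball (min_le_right _ _) hy.2)).2
    rwa [Set.mem_preimage, (extChartAt (𝓡 5) x).left_inv hy.1] at this
  have hm : 0 < min r ρ := lt_min hr hρ
  filter_upwards [(isOpen_chartBall x (min r ρ)).mem_nhds (mem_chartBall_self x hm)] with y hy
  exact B.eq_of_parallelOn ((ball_subset_ball (min_le_left _ _)).trans hr') (hs.mono hsub)
    (ht.mono hsub) (mem_chartBall_self x hm) hy h

/-- The spinor field with given parallel components. -/
theorem parallelOn_ofLocalRep {x₀ : M} {r : ℝ} {i : ι}
    (hsub : ball (extChartAt (𝓡 5) x₀ x₀) r ⊆ B.chartDomain x₀ i) {σ : EuclideanSpace ℝ (Fin 5) → S}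
    (hσ : ∀ z ∈ ball (extChartAt (𝓡 5) x₀ x₀) r,
      HasFDerivAt σ (-(B.chartForm x₀ i z).flip (σ z)) z) :
    B.ParallelOn (B.ofLocalRep i (σ ∘ extChartAt (𝓡 5) x₀)) (chartBall x₀ r) := by
  intro y hy
  have hsm := contDiffOn_of_parallel isOpen_ball ((B.contDiffOn_chartForm x₀ i).mono hsub) hσ
  have hbase : ∀ z ∈ chartBall x₀ r, z ∈ B.spinStr.baseSet i := fun z hz ↦ by
    have := (hsub hz.2).2
    rwa [Set.mem_preimage, (extChartAt (𝓡 5) x₀).left_inv hz.1] at this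
  have hloc : B.localRep i (B.ofLocalRep i (σ ∘ extChartAt (𝓡 5) x₀)) =ᶠ[𝓝 y]
      σ ∘ extChartAt (𝓡 5) x₀ := by
    filter_upwards [(isOpen_chartBall x₀ _).mem_nhds hy] with z hz
    exact B.localRep_ofLocalRep (hbase z hz) _
  have hsm' : ContMDiffAt (𝓡 5) 𝓘(ℝ, S) ∞
      (B.localRep i (B.ofLocalRep i (σ ∘ extChartAt (𝓡 5) x₀))) y := by
    refine ContMDiffAt.congr_of_eventuallyEq ?_ hloc
    exact ((hsm.contDiffAt (isOpen_ball.mem_nhds hy.2)).contMDiffAt).comp y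
      (contMDiffAt_extChartAt' (by simpa using hy.1))
  refine ⟨(B.contMDiffAt_localRep_iff (hbase y hy) le_rfl).2 hsm', ?_⟩
  refine B.superconnection_eq_zero_of_hasFDerivAt hy.1 (hbase y hy)
    (hsm'.mdifferentiableAt (by simp)) ?_
  rw [hloc.eq_of_nhds]
  refine (hσ _ hy.2).congr_of_eventuallyEq ?_
  filter_upwards [isOpen_ball.mem_nhds hy.2] with z hz
  have hz1 := (hsub hz).1
  have hz2 : (extChartAt (𝓡 5) x₀).symm z ∈ chartBall x₀ r :=
    ⟨(extChartAt (𝓡 5) x₀).map_target hz1, by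
      rwa [Set.mem_preimage, (extChartAt (𝓡 5) x₀).right_inv hz1]⟩
  exact (B.localRep_ofLocalRep (hbase _ hz2) _).trans
    (congrArg σ ((extChartAt (𝓡 5) x₀).right_inv hz1))

/-- The curvature of the connection form in the frame `i` and in the chart around `x₀`. -/
def chartCurvature (x₀ : M) (i : ι) (z v w : EuclideanSpace ℝ (Fin 5)) (p : S) : S :=
  fderiv ℝ (B.chartForm x₀ i) z v w p - fderiv ℝ (B.chartForm x₀ i) z w v p +
    (B.chartForm x₀ i z v (B.chartForm x₀ i z w p) -
      B.chartForm x₀ i z w (B.chartForm x₀ i z v p))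

/-- If the connection form is flat then there are local parallel spinor fields. -/
theorem exists_parallelOn_of_flat {x₀ : M} {i : ι} (hx₀ : x₀ ∈ B.spinStr.baseSet i)
    (hflat : ∀ z ∈ B.chartDomain x₀ i, ∀ v w p, B.chartCurvature x₀ i z v w p = 0) :
    ∃ r > 0, ball (extChartAt (𝓡 5) x₀ x₀) r ⊆ B.chartDomain x₀ i ∧
      ∀ c : B.spinStr.Fiber x₀, ∃ s : ∀ x : M, B.spinStr.Fiber x, s x₀ = c ∧
        B.ParallelOn s (chartBall x₀ r) := by
  have hmem := (B.isOpen_chartDomain x₀ i).mem_nhds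
    (B.mem_chartDomain (mem_extChartAt_source x₀) hx₀)
  obtain ⟨r₁, hr₁, hr₁'⟩ := Metric.mem_nhds_iff.1 hmem
  have hA := ((B.contDiffOn_chartForm x₀ i).contDiffAt hmem).of_le
    (WithTop.coe_le_coe.2 (le_top : (2 : ℕ∞) ≤ ⊤))
  have : CompleteSpace S := FiniteDimensional.complete ℝ S
  obtain ⟨r₂, hr₂, hex⟩ := exists_parallel_of_flat hA (Filter.mem_of_superset hmem hflat)
  have hsub := (ball_subset_ball (x := extChartAt (𝓡 5) x₀ x₀) (min_le_left r₁ r₂)).trans hr₁'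
  refine ⟨min r₁ r₂, lt_min hr₁ hr₂, hsub, fun c ↦ ?_⟩
  obtain ⟨σ, hσ0, hσ⟩ := hex (B.spinStr.rep i (B.spinStr.indexAt x₀) x₀ c)
  refine ⟨B.ofLocalRep i (σ ∘ extChartAt (𝓡 5) x₀), ?_, B.parallelOn_ofLocalRep hsub
    fun z hz ↦ hσ z (ball_subset_ball (min_le_right r₁ r₂) hz)⟩
  have h2 : B.ofLocalRep i (σ ∘ extChartAt (𝓡 5) x₀) x₀ =
    B.spinStr.rep (B.spinStr.indexAt x₀) i x₀ (σ (extChartAt (𝓡 5) x₀ x₀)) := rfl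
  rw [h2, hσ0]
  exact congrArg (fun A : S →L[ℝ] S ↦ A c)
    (B.spinStr.rep_mul_rep_symm (B.spinStr.mem_baseSet_at x₀) hx₀)

end Background

/-! ### Flatness in coordinates -/

open VectorField Topology Metric

section ClmApply

set_option maxSynthPendingDepth 3

variable {E F G : Type*} [NormedAddCommGroup E] [NormedSpace ℝ E] [NormedAddCommGroup F]
  [NormedSpace ℝ F] [NormedAddCommGroup G] [NormedSpace ℝ G] {A : E → E →L[ℝ] F →L[ℝ] G} {z : E}

theorem hasFDerivAt_clm_apply_apply (hA : DifferentiableAt ℝ A z) (w : E) (p : F) :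
    HasFDerivAt (fun z ↦ A z w p) ((ContinuousLinearMap.apply ℝ G p).comp
      ((ContinuousLinearMap.apply ℝ (F →L[ℝ] G) w).comp (fderiv ℝ A z))) z :=
  (ContinuousLinearMap.apply ℝ G p).hasFDerivAt.comp z
    ((ContinuousLinearMap.apply ℝ (F →L[ℝ] G) w).hasFDerivAt.comp z hA.hasFDerivAt)

theorem fderiv_clm_apply_apply (hA : DifferentiableAt ℝ A z) (v w : E) (p : F) :
    fderiv ℝ (fun z ↦ A z w p) z v = fderiv ℝ A z v w p := by
  rw [(hasFDerivAt_clm_apply_apply hA w p).fderiv]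
  rfl

end ClmApply

variable {M : Type*} [TopologicalSpace M] [ChartedSpace (EuclideanSpace ℝ (Fin 5)) M]

theorem exists_smoothBumpFunction_tsupport_subset {U : Set M} {y : M} (hU : U ∈ 𝓝 y) [T2Space M] :
    ∃ ψ : SmoothBumpFunction (𝓡 5) y, tsupport ψ ⊆ U := by
  obtain ⟨ψ, -, hψ⟩ := (SmoothBumpFunction.nhds_basis_tsupport (I := 𝓡 5) y).mem_iff.1 hU
  exact ⟨ψ, hψ⟩

variable [IsManifold (𝓡 5) ∞ M]

namespace Background

variable {ι : Type*} (B : Background M ι)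

/-- On a spinor field with constant components the superconnection is just multiplication by the
connection form. The statement is needed on a neighbourhood because it is differentiated next. -/
theorem localRep_D_of_eventuallyEq_const {x₀ y : M} {i : ι}
    (hy : y ∈ (extChartAt (𝓡 5) x₀).source) (hi : y ∈ B.spinStr.baseSet i)
    {X : ∀ x : M, TangentSpace (𝓡 5) x} {s : ∀ x : M, B.spinStr.Fiber x}
    {w : EuclideanSpace ℝ (Fin 5)} {p : S} (hX : ∀ᶠ q in 𝓝 y, X q = chartField x₀ w q)
    (hs : ∀ᶠ q in 𝓝 y, B.localRep i s q = p) :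
    ∀ᶠ q in 𝓝 y, B.localRep i (B.D X s) q = B.chartForm x₀ i (extChartAt (𝓡 5) x₀ q) w p := by
  filter_upwards [hX, hs.eventually_nhds, (isOpen_extChartAt_source x₀).mem_nhds hy,
    (B.spinStr.isOpen_baseSet i).mem_nhds hi] with q hq hsq hq1 hq2
  have hsq' : B.localRep i s =ᶠ[𝓝 q] fun _ ↦ p := hsq
  have hm : MDifferentiableAt (𝓡 5) 𝓘(ℝ, S) (B.localRep i s) q :=
    mdifferentiableAt_const.congr_of_eventuallyEq hsq'
  refine (B.rep_superconnection hq2 hm (X q)).trans ?_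
  rw [mvfderiv_congr hsq', hsq'.eq_of_nhds, hq, B.chartForm_apply hq1]
  rw [show mvfderiv (𝓡 5) (fun _ : M ↦ p) q = 0 from mvfderiv_const p]
  exact zero_add _

/-- The outer field enters only through its value at `y`, whereas the inner one is differentiated
and has to be a chart field near `y`. The part antisymmetric in `v` and `w` is `chartCurvature`. -/
theorem localRep_D_D {x₀ y : M} {i : ι}
    (hy : y ∈ (extChartAt (𝓡 5) x₀).source) (hi : y ∈ B.spinStr.baseSet i)
    {X Y : ∀ x : M, TangentSpace (𝓡 5) x} {s : ∀ x : M, B.spinStr.Fiber x}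
    {v w : EuclideanSpace ℝ (Fin 5)} {p : S} (hX : X y = chartField x₀ v y)
    (hY : ∀ᶠ q in 𝓝 y, Y q = chartField x₀ w q) (hs : ∀ᶠ q in 𝓝 y, B.localRep i s q = p) :
    B.localRep i (B.D X (B.D Y s)) y =
      fderiv ℝ (B.chartForm x₀ i) (extChartAt (𝓡 5) x₀ y) v w p +
        B.chartForm x₀ i (extChartAt (𝓡 5) x₀ y) v
          (B.chartForm x₀ i (extChartAt (𝓡 5) x₀ y) w p) := by
  have h := B.localRep_D_of_eventuallyEq_const hy hi hY hs
  have hc : ContDiffAt ℝ ∞ (B.chartForm x₀ i) (extChartAt (𝓡 5) x₀ y) :=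
    (B.contDiffOn_chartForm x₀ i).contDiffAt
      ((B.isOpen_chartDomain x₀ i).mem_nhds (B.mem_chartDomain hy hi))
  have hd := hc.differentiableAt (by simp)
  have hm : MDifferentiableAt (𝓡 5) 𝓘(ℝ, S) (B.localRep i (B.D Y s)) y := by
    refine MDifferentiableAt.congr_of_eventuallyEq ?_ h
    exact (hasFDerivAt_clm_apply_apply hd w p).differentiableAt.mdifferentiableAt.comp y
      ((contMDiffAt_extChartAt' (n := ∞) (by simpa using hy)).mdifferentiableAt (by simp))
  have h1 : B.localRep i (B.D Y s) ∘ (extChartAt (𝓡 5) x₀).symm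
      =ᶠ[𝓝 (extChartAt (𝓡 5) x₀ y)] fun z ↦ B.chartForm x₀ i z w p := by
    have ht := (continuousAt_extChartAt_symm' hy).tendsto
    rw [(extChartAt (𝓡 5) x₀).left_inv hy] at ht
    filter_upwards [ht.eventually h, (isOpen_extChartAt_target x₀).mem_nhds
      ((extChartAt (𝓡 5) x₀).map_source hy)] with z hz hz'
    rw [(extChartAt (𝓡 5) x₀).right_inv hz'] at hz
    exact hz
  have h2 := B.rep_superconnection_chartField hy hi hm v
  rw [h1.fderiv_eq, fderiv_clm_apply_apply hd, h.self_of_nhds] at h2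
  have h3 : B.localRep i (B.D X (B.D Y s)) y =
      B.spinStr.rep i (B.spinStr.indexAt y) y (B.superconnection (B.D Y s) y (X y)) := rfl
  rw [h3, hX]
  exact h2

/-- The connection form of a flat superconnection is flat. -/
theorem chartCurvature_eq_zero_of_isFlat [T2Space M] (hflat : B.IsFlat) (x₀ : M) (i : ι)
    {z : EuclideanSpace ℝ (Fin 5)} (hz : z ∈ B.chartDomain x₀ i) (v w : EuclideanSpace ℝ (Fin 5))
    (p : S) : B.chartCurvature x₀ i z v w p = 0 := by
  obtain ⟨y, hy, hi, rfl⟩ : ∃ y ∈ (extChartAt (𝓡 5) x₀).source, y ∈ B.spinStr.baseSet i ∧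
      extChartAt (𝓡 5) x₀ y = z :=
    ⟨_, (extChartAt (𝓡 5) x₀).map_target hz.1, hz.2, (extChartAt (𝓡 5) x₀).right_inv hz.1⟩
  have hU : IsOpen ((extChartAt (𝓡 5) x₀).source ∩ B.spinStr.baseSet i) :=
    (isOpen_extChartAt_source x₀).inter (B.spinStr.isOpen_baseSet i)
  -- Flatness is stated for global smooth fields. Chart fields and the spinor field with constant
  -- components are therefore cut off by a function equal to one near `y`, which changes nothing at
  -- `y`.
  obtain ⟨ψ, hψ⟩ := exists_smoothBumpFunction_tsupport_subset (hU.mem_nhds ⟨hy, hi⟩)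
  let X : EuclideanSpace ℝ (Fin 5) →
      Cₛ^∞⟮𝓡 5; EuclideanSpace ℝ (Fin 5), (TangentSpace (𝓡 5) : M → Type)⟯ := fun v ↦
    ⟨(ψ : M → ℝ) • chartField x₀ v, ContMDiffOn.smul_section_of_tsupport
      ψ.contMDiff.contMDiffOn hU hψ
      fun q hq ↦ (contMDiffAt_chartField hq.1 v).contMDiffWithinAt⟩
  have hX : ∀ v, (X v : ∀ x : M, TangentSpace (𝓡 5) x) =ᶠ[𝓝 y] chartField x₀ v := fun v ↦ by
    filter_upwards [ψ.eventuallyEq_one] with q hq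
    change ψ q • chartField x₀ v q = _
    rw [hq]
    exact one_smul _ _
  have hs : ∀ q ∈ B.spinStr.baseSet i, ContMDiffAt (𝓡 5) ((𝓡 5).prod 𝓘(ℝ, S)) ∞
      (fun x ↦ TotalSpace.mk' S x (B.ofLocalRep i (fun _ ↦ p) x)) q := fun q hq ↦ by
    refine (B.contMDiffAt_localRep_iff hq le_rfl).2
      ((contMDiffAt_const (c := p)).congr_of_eventuallyEq ?_)
    filter_upwards [(B.spinStr.isOpen_baseSet i).mem_nhds hq] with q' hq'
    exact B.localRep_ofLocalRep hq' _
  let s : B.spinStr.SpinorField :=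
    ⟨(ψ : M → ℝ) • B.ofLocalRep i (fun _ ↦ p), ContMDiffOn.smul_section_of_tsupport
      ψ.contMDiff.contMDiffOn hU hψ fun q hq ↦ (hs q hq.2).contMDiffWithinAt⟩
  have hsp : ∀ᶠ q in 𝓝 y, B.localRep i s q = p := by
    filter_upwards [ψ.eventuallyEq_one, (B.spinStr.isOpen_baseSet i).mem_nhds hi] with q hq hq'
    have h1 : s q = B.ofLocalRep i (fun _ ↦ p) q := by
      change ψ q • B.ofLocalRep i (fun _ ↦ p) q = _
      rw [hq]
      exact one_smul _ _
    exact (congrArg (B.spinStr.rep i (B.spinStr.indexAt q) q) h1).trans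
      (B.localRep_ofLocalRep hq' _)
  -- The bracket term drops out, so flatness says that the two iterated derivatives agree.
  have hb : mlieBracket (𝓡 5) (X v) (X w) y = 0 := by
    rw [(hX v).mlieBracket_vectorField_eq (hX w), mlieBracket_chartField hy]
  have h0 : B.D (mlieBracket (𝓡 5) (X v) (X w)) s y = 0 := by
    refine (congrArg (B.superconnection s y) hb).trans ?_
    exact map_zero _
  have h1 : B.D (X v) (B.D (X w) s) y = B.D (X w) (B.D (X v) s) y := by
    have h := congrFun (hflat (X v) (X w) s) y
    have h' : B.D (mlieBracket (𝓡 5) (X v) (X w)) s y -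
      (B.D (X v) (B.D (X w) s) y - B.D (X w) (B.D (X v) s) y) = 0 := h
    rw [h0, zero_sub, neg_eq_zero] at h'
    exact sub_eq_zero.1 h'
  have h2 : B.localRep i (B.D (X v) (B.D (X w) s)) y = B.localRep i (B.D (X w) (B.D (X v) s)) y :=
    congrArg (B.spinStr.rep i (B.spinStr.indexAt y) y) h1
  rw [B.localRep_D_D hy hi (hX v).self_of_nhds (hX w) hsp,
    B.localRep_D_D hy hi (hX w).self_of_nhds (hX v) hsp] at h2
  have key : ∀ a b c d : S, a + c = b + d → a - b + (c - d) = 0 := fun a b c d h ↦ by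
    rw [sub_add_sub_comm, h, sub_self]
  exact key _ _ _ _ h2

end Background

/-! ### Maximal supersymmetry implies flatness -/

open VectorField Topology Metric

variable {M : Type*} [TopologicalSpace M] [ChartedSpace (EuclideanSpace ℝ (Fin 5)) M]

theorem contMDiffAt_clm_of_apply {F G : Type*} [NormedAddCommGroup F] [NormedSpace ℝ F]
    [FiniteDimensional ℝ F] [NormedAddCommGroup G] [NormedSpace ℝ G] {n : WithTop ℕ∞} {x : M}
    {K : M → F →L[ℝ] G} (h : ∀ p, ContMDiffAt (𝓡 5) 𝓘(ℝ, G) n (fun y ↦ K y p) x) :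
    ContMDiffAt (𝓡 5) 𝓘(ℝ, F →L[ℝ] G) n K x := by
  have e : K = fun y ↦ ∑ a, ContinuousLinearMap.smulRightL ℝ F G
      (LinearMap.toContinuousLinearMap ((Module.finBasis ℝ F).coord a))
        (K y (Module.finBasis ℝ F a)) := by
    funext y
    refine ContinuousLinearMap.ext fun p ↦ ?_
    conv_lhs => rw [← (Module.finBasis ℝ F).sum_repr p]
    rw [map_sum]
    simp [sum_apply]
  rw [e]
  exact contMDiffAt_finsetSum fun a _ ↦
    (ContinuousLinearMap.contDiff _).contMDiff.contMDiffAt.comp x (h (Module.finBasis ℝ F a))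

variable [IsManifold (𝓡 5) ∞ M]

theorem mdifferentiableAt_mvfderiv_apply {F : Type*} [NormedAddCommGroup F] [NormedSpace ℝ F]
    {f : M → F} {x : M} (hf : ContMDiffAt (𝓡 5) 𝓘(ℝ, F) 2 f x)
    {X : ∀ x : M, TangentSpace (𝓡 5) x}
    (hX : MDifferentiableAt (𝓡 5) (𝓡 5).tangent
      (fun x ↦ (⟨x, X x⟩ : TangentBundle (𝓡 5) M)) x) :
    MDifferentiableAt (𝓡 5) 𝓘(ℝ, F) (fun y ↦ mvfderiv (𝓡 5) f y (X y)) x := by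
  have hx := mem_extChartAt_source (I := 𝓡 5) x
  have hF : ContDiffAt ℝ 2 (f ∘ (extChartAt (𝓡 5) x).symm) (extChartAt (𝓡 5) x x) :=
    contDiffAt_comp_extChartAt_symm (WithTop.coe_le_coe.2 (le_top : (2 : ℕ∞) ≤ ⊤)) hx hf
  have hF' := (hF.fderiv_right (m := 1) (by norm_num)).differentiableAt (by simp)
  have hfe : ∀ᶠ y in 𝓝 x, MDifferentiableAt (𝓡 5) 𝓘(ℝ, F) f y := by
    filter_upwards [contMDiffAt_iff_contMDiffAt_nhds (by simp) |>.1 hf] with y hy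
      using hy.mdifferentiableAt (by simp)
  have hd := hF'.mdifferentiableAt.comp x (mdifferentiableAt_extChartAt (mem_chart_source _ x))
  refine (hd.clm_apply (differentiableAt_chartComp hx hX)).congr_of_eventuallyEq ?_
  filter_upwards [hfe, (isOpen_extChartAt_source (I := 𝓡 5) x).mem_nhds hx] with y hy hy'
  exact mvfderiv_eq_fderiv hy' hy (X y)

namespace Background

variable {ι : Type*} (B : Background M ι)

/-- The columns of `K` are parallel, so only the derivative of the coefficients `f` survives in the
Leibniz rule. -/
theorem localRep_D_of_parallel_frame {i : ι} {x : M} (hi : x ∈ B.spinStr.baseSet i)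
    {K : M → S →L[ℝ] S} {f : M → S} {X : ∀ x : M, TangentSpace (𝓡 5) x}
    {s : ∀ x : M, B.spinStr.Fiber x} (hK : MDifferentiableAt (𝓡 5) 𝓘(ℝ, S →L[ℝ] S) K x)
    (hpar : ∀ p v, mvfderiv (𝓡 5) (fun y ↦ K y p) x v + B.superForm i x v (K x p) = 0)
    (hf : MDifferentiableAt (𝓡 5) 𝓘(ℝ, S) f x)
    (hs : ∀ᶠ y in 𝓝 x, B.localRep i s y = K y (f y)) :
    B.localRep i (B.D X s) x = K x (mvfderiv (𝓡 5) f x (X x)) := by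
  have hs' : B.localRep i s =ᶠ[𝓝 x]
      fun y ↦ ContinuousLinearMap.id ℝ (S →L[ℝ] S) (K y) (f y) := hs
  have hm : MDifferentiableAt (𝓡 5) 𝓘(ℝ, S) (B.localRep i s) x :=
    (mdifferentiableAt_bilinear (ContinuousLinearMap.id ℝ (S →L[ℝ] S)) hK
      hf).congr_of_eventuallyEq hs'
  refine (B.rep_superconnection hi hm (X x)).trans ?_
  have h1 : mvfderiv (𝓡 5) (fun y ↦ K y (f x)) x (X x) = mvfderiv (𝓡 5) K x (X x) (f x) :=
    mvfderiv_clm_apply (ContinuousLinearMap.apply ℝ S (f x)) hK (X x)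
  have h2 := hpar (f x) (X x)
  rw [h1] at h2
  rw [mvfderiv_congr hs', mvfderiv_bilinear _ hK hf, hs'.eq_of_nhds]
  have key : ∀ a b c : S, a + c = 0 → a + b + c = b := fun a b c h ↦ by
    rw [add_right_comm, h, zero_add]
  exact key _ _ _ h2

/-- With `s = K f`, the curvature becomes `K` applied to `[X, Y] f - (X (Y f) - Y (X f))`, which is
zero. Invertibility at `x` alone suffices because the units are open. -/
theorem curvature_eq_zero_of_parallel_frame {i : ι} {x : M} (hi : x ∈ B.spinStr.baseSet i)
    {K : M → S →L[ℝ] S} {X Y : ∀ x : M, TangentSpace (𝓡 5) x}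
    {s : ∀ x : M, B.spinStr.Fiber x} (hKx : IsUnit (K x))
    (hK : ContMDiffAt (𝓡 5) 𝓘(ℝ, S →L[ℝ] S) 2 K x)
    (hpar : ∀ᶠ y in 𝓝 x, ∀ p v,
      mvfderiv (𝓡 5) (fun y' ↦ K y' p) y v + B.superForm i y v (K y p) = 0)
    (hs : ContMDiffAt (𝓡 5) 𝓘(ℝ, S) 2 (B.localRep i s) x)
    (hX : MDifferentiableAt (𝓡 5) (𝓡 5).tangent (fun x ↦ (⟨x, X x⟩ : TangentBundle (𝓡 5) M)) x)
    (hY : MDifferentiableAt (𝓡 5) (𝓡 5).tangent (fun x ↦ (⟨x, Y x⟩ : TangentBundle (𝓡 5) M)) x) :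
    B.curvature X Y s x = 0 := by
  have : CompleteSpace S := FiniteDimensional.complete ℝ S
  -- `Ring.inverse` is zero off the units; only its values near `x`, where `K` is invertible,
  -- matter.
  obtain ⟨f, hf⟩ : ∃ f : M → S, f = fun y ↦ Ring.inverse (K y) (B.localRep i s y) := ⟨_, rfl⟩
  have hfs : ContMDiffAt (𝓡 5) 𝓘(ℝ, S) 2 f x := by
    obtain ⟨u, hu⟩ := hKx
    have h1 : ContDiffAt ℝ 2 Ring.inverse (K x) := hu ▸ contDiffAt_ringInverse ℝ u
    rw [hf]
    exact (h1.contMDiffAt.comp x hK).clm_apply hs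
  have hKd : ∀ᶠ y in 𝓝 x, MDifferentiableAt (𝓡 5) 𝓘(ℝ, S →L[ℝ] S) K y := by
    filter_upwards [contMDiffAt_iff_contMDiffAt_nhds (by simp) |>.1 hK] with y hy
      using hy.mdifferentiableAt (by simp)
  have hfd : ∀ᶠ y in 𝓝 x, MDifferentiableAt (𝓡 5) 𝓘(ℝ, S) f y := by
    filter_upwards [contMDiffAt_iff_contMDiffAt_nhds (by simp) |>.1 hfs] with y hy
      using hy.mdifferentiableAt (by simp)
  have hKf : ∀ᶠ y in 𝓝 x, B.localRep i s y = K y (f y) := by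
    filter_upwards [hK.continuousAt.eventually (Units.isOpen.mem_nhds hKx)] with y hy
    have h1 : K y * Ring.inverse (K y) = 1 := Ring.mul_inverse_cancel _ hy
    rw [hf]
    exact (congrArg (fun A : S →L[ℝ] S ↦ A (B.localRep i s y)) h1).symm
  have hD : ∀ Z : ∀ x : M, TangentSpace (𝓡 5) x, ∀ᶠ y in 𝓝 x,
      B.localRep i (B.D Z s) y = K y (mvfderiv (𝓡 5) f y (Z y)) := fun Z ↦ by
    filter_upwards [(B.spinStr.isOpen_baseSet i).mem_nhds hi, hKd, hpar, hfd, hKf.eventually_nhds]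
      with y hiy hKy hpy hfy hKfy
    exact B.localRep_D_of_parallel_frame hiy hKy hpy hfy hKfy
  have hdd : ∀ {Z}, MDifferentiableAt (𝓡 5) (𝓡 5).tangent
      (fun x ↦ (⟨x, Z x⟩ : TangentBundle (𝓡 5) M)) x → ∀ W,
      B.localRep i (B.D W (B.D Z s)) x =
        K x (mvfderiv (𝓡 5) (fun y ↦ mvfderiv (𝓡 5) f y (Z y)) x (W x)) := fun hZ W ↦
    B.localRep_D_of_parallel_frame hi hKd.self_of_nhds hpar.self_of_nhds
      (mdifferentiableAt_mvfderiv_apply hfs hZ) (hD _)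
  refine B.eq_of_localRep_eq (t := 0) hi ?_
  have h1 : B.localRep i (B.curvature X Y s) x = B.localRep i (B.D (mlieBracket (𝓡 5) X Y) s) x -
      (B.localRep i (B.D X (B.D Y s)) x - B.localRep i (B.D Y (B.D X s)) x) :=
    (map_sub (B.spinStr.rep i (B.spinStr.indexAt x) x) _ _).trans
      (congrArg _ (map_sub (B.spinStr.rep i (B.spinStr.indexAt x) x) _ _))
  have h2 : B.localRep i (0 : ∀ x : M, B.spinStr.Fiber x) x = 0 :=
    map_zero (B.spinStr.rep i (B.spinStr.indexAt x) x)
  rw [h1, h2, hdd hY, hdd hX, (hD (mlieBracket (𝓡 5) X Y)).self_of_nhds,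
    mvfderiv_mlieBracket hfs hX hY, map_sub, sub_self]

variable {B} in
theorem parallelOn_of_mem_killingSpinors {s : B.spinStr.SpinorField} (hs : s ∈ B.killingSpinors)
    (U : Set M) : B.ParallelOn s U := fun y _ ↦ ⟨s.contMDiff y, hs y⟩

/-- On a connected manifold, parallel spinor fields that agree at a point are equal. -/
theorem eq_of_parallelOn_univ [ConnectedSpace M] {s t : ∀ x : M, B.spinStr.Fiber x}
    (hs : B.ParallelOn s Set.univ) (ht : B.ParallelOn t Set.univ) {x : M} (h : s x = t x) :
    s = t := by
  have ho : IsOpen {y | s y = t y} := isOpen_iff_mem_nhds.2 fun y hy ↦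
    B.eventually_eq_of_parallelOn isOpen_univ hs ht (Set.mem_univ y) hy
  -- If the fields differ at `y`, they differ on a whole chart ball around `y`, since agreement at
  -- one point of the ball would propagate back to `y`.
  have hc : IsClosed {y | s y = t y} := by
    rw [← isOpen_compl_iff, isOpen_iff_mem_nhds]
    intro y hy
    obtain ⟨r, hr, hr'⟩ := B.exists_ball_subset_chartDomain y
    filter_upwards [(isOpen_chartBall y r).mem_nhds (mem_chartBall_self y hr)] with z hz hz'
    exact hy (B.eq_of_parallelOn hr' (hs.mono (Set.subset_univ _)) (ht.mono (Set.subset_univ _))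
      hz (mem_chartBall_self y hr) hz')
  have hu := IsClopen.eq_univ ⟨hc, ho⟩ ⟨x, h⟩
  exact funext fun y ↦ (Set.eq_univ_iff_forall.1 hu) y

/-- Evaluation of Killing spinors at a point. -/
def evalKilling (x : M) : B.killingSpinors →ₗ[ℝ] S where
  toFun s := s.1 x
  map_add' _ _ := rfl
  map_smul' _ _ := rfl

theorem evalKilling_injective [ConnectedSpace M] (x : M) :
    Function.Injective (B.evalKilling x) := fun s t h ↦ by
  refine Subtype.ext (ContMDiffSection.coe_injective ?_)
  exact B.eq_of_parallelOn_univ (parallelOn_of_mem_killingSpinors s.2 _)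
    (parallelOn_of_mem_killingSpinors t.2 _) (x := x) h

/-- A maximally supersymmetric background has a flat superconnection. -/
theorem IsMaximallySupersymmetric.isFlat [ConnectedSpace M] (h : B.IsMaximallySupersymmetric) :
    B.IsFlat := by
  intro X Y s
  funext x
  have hi := B.spinStr.mem_baseSet_at x
  have hfin : FiniteDimensional ℝ B.killingSpinors :=
    FiniteDimensional.of_injective _ (B.evalKilling_injective x)
  -- Equality of dimensions turns injectivity of evaluation into bijectivity.
  have hbij : ∀ y, Function.Bijective (B.evalKilling y) := fun y ↦
    ⟨B.evalKilling_injective y, (LinearMap.injective_iff_surjective_of_finrank_eq_finrank h).1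
      (B.evalKilling_injective y)⟩
  obtain ⟨e, he⟩ : ∃ e : S ≃ₗ[ℝ] B.killingSpinors, e = (LinearEquiv.ofBijective _ (hbij x)).symm :=
    ⟨_, rfl⟩
  -- `K y p` is the value at `y` of the Killing spinor that equals `p` at `x`, in the preferred
  -- frame at `x`. Hence `K x = 1`.
  obtain ⟨K, hK⟩ : ∃ K : M → S →L[ℝ] S, ∀ y p, K y p = B.localRep (B.spinStr.indexAt x) (e p).1 y :=
    ⟨fun y ↦ (B.spinStr.rep (B.spinStr.indexAt x) (B.spinStr.indexAt y) y).comp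
      (LinearMap.toContinuousLinearMap (B.evalKilling y ∘ₗ e.toLinearMap)), fun _ _ ↦ rfl⟩
  have hKf : ∀ p, (fun y ↦ K y p) = B.localRep (B.spinStr.indexAt x) (e p).1 := fun p ↦
    funext fun y ↦ hK y p
  have hsm : ∀ y ∈ B.spinStr.baseSet (B.spinStr.indexAt x), ∀ p, ContMDiffAt (𝓡 5) 𝓘(ℝ, S) ∞
      (B.localRep (B.spinStr.indexAt x) (e p).1) y := fun y hy p ↦
    (B.contMDiffAt_localRep_iff hy le_rfl).1 ((e p).1.contMDiff y)
  refine B.curvature_eq_zero_of_parallel_frame hi (K := K) ?_ ?_ ?_ ?_ ?_ ?_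
  · suffices h1 : K x = 1 from h1 ▸ isUnit_one
    refine ContinuousLinearMap.ext fun p ↦ (hK x p).trans ?_
    have h1 : B.evalKilling x (e p) = p := by
      rw [he]
      exact (LinearEquiv.ofBijective _ (hbij x)).apply_symm_apply p
    exact (congrArg (fun A : S →L[ℝ] S ↦ A ((e p).1 x)) (B.spinStr.rep_self hi)).trans h1
  · refine ContMDiffAt.of_le (n := ∞) (contMDiffAt_clm_of_apply fun p ↦ ?_)
      (WithTop.coe_le_coe.2 (le_top : (2 : ℕ∞) ≤ ⊤))
    rw [hKf]
    exact hsm x hi p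
  · filter_upwards [(B.spinStr.isOpen_baseSet _).mem_nhds hi] with y hy p v
    have h1 := B.rep_superconnection hy ((hsm y hy p).mdifferentiableAt (by simp)) v
    rw [hKf, hK, ← h1, (e p).2 y]
    exact map_zero _
  · exact ((B.contMDiffAt_localRep_iff hi le_rfl).1 (s.contMDiff x)).of_le
      (WithTop.coe_le_coe.2 (le_top : (2 : ℕ∞) ≤ ⊤))
  · exact (X.contMDiff x).mdifferentiableAt (by simp)
  · exact (Y.contMDiff x).mdifferentiableAt (by simp)

end Background

/-! ### Flatness implies maximal supersymmetry -/

open VectorField Topology Metric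

/-- A locally constant cocycle on a simply connected space admits global sections through any
point. -/
theorem exists_section_of_locally_constant_cocycle {X F : Type*} [TopologicalSpace X]
    [SimplyConnectedSpace X] [LocallyPathConnectedSpace X] (U : X → Set X)
    (hU : ∀ x, IsOpen (U x)) (hmem : ∀ x, x ∈ U x) (e : X → X → F ≃ F)
    (hloc : ∀ x y c, ∀ z ∈ U x ∩ U y,
      ∀ᶠ w in 𝓝 z, (e y w).symm (e x w c) = (e y z).symm (e x z c)) (x₀ : X) (c : F) :
    ∃ σ : X → F, σ x₀ = c ∧ ∀ x, ∃ a, ∀ᶠ z in 𝓝 x, σ z = e x z a := by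
  -- Here `e x z c` plays the role of the value at `z` of the local section labelled `c` in the
  -- family around `x`. With `F` discrete, local constancy is continuity of the coordinate changes,
  -- and the resulting bundle of labels is a covering.
  let _ : TopologicalSpace F := ⊥
  have : DiscreteTopology F := ⟨rfl⟩
  let core : FiberBundleCore X X F :=
    { baseSet := U
      isOpen_baseSet := hU
      indexAt := id
      mem_baseSet_at := hmem
      coordChange := fun x y z c ↦ (e y z).symm (e x z c)
      coordChange_self := fun x z _ c ↦ (e x z).symm_apply_apply c
      continuousOn_coordChange := fun x y ↦ by
        rintro ⟨z, c⟩ ⟨hz, -⟩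
        refine ContinuousAt.continuousWithinAt ?_
        rw [ContinuousAt, nhds_discrete F, Filter.tendsto_pure]
        have h1 : ∀ᶠ q : X × F in 𝓝 (z, c), q.2 = c := by
          have := (continuous_snd (X := X) (Y := F)).tendsto (z, c)
          rwa [nhds_discrete F, Filter.tendsto_pure] at this
        have h2 := ((continuous_fst (X := X) (Y := F)).tendsto (z, c)).eventually
          (hloc x y c z hz)
        filter_upwards [h1, h2] with q hq hq'
        rw [hq]
        exact hq'
      coordChange_comp := fun x y z w _ c ↦ by simp }
  have hcov : IsCoveringMap (π F core.Fiber) := FiberBundle.isCoveringMap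
  -- Over a simply connected, locally path connected base the identity lifts to the covering, and
  -- the lift is a global section with prescribed label at `x₀`.
  obtain ⟨Φ, ⟨hΦ, hΦ'⟩, -⟩ := hcov.existsUnique_continuousMap_lifts (ContinuousMap.id X) x₀
    ⟨x₀, (e x₀ x₀).symm c⟩ rfl
  have hproj : ∀ z, (Φ z).1 = z := fun z ↦ congrFun hΦ' z
  refine ⟨fun z ↦ e (Φ z).1 (Φ z).1 (Φ z).2, ?_, fun x ↦ ?_⟩
  · change e (Φ x₀).1 (Φ x₀).1 (Φ x₀).2 = c
    rw [hΦ]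
    exact (e x₀ x₀).apply_symm_apply c
  · have hx : Φ x ∈ (core.localTriv x).source := by
      rw [(core.localTriv x).mem_source]
      have h1 : (Φ x).1 ∈ U x := by
        rw [hproj]
        exact hmem x
      exact h1
    -- A continuous map to a discrete space is locally constant: near `x` the label in the family
    -- around `x` is fixed.
    have hc : ContinuousAt (fun z ↦ (core.localTriv x (Φ z)).2) x :=
      (((core.localTriv x).continuousOn.continuousAt
        ((core.localTriv x).open_source.mem_nhds hx)).comp Φ.continuous.continuousAt).snd
    rw [ContinuousAt, nhds_discrete F, Filter.tendsto_pure] at hc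
    refine ⟨(core.localTriv x (Φ x)).2, ?_⟩
    filter_upwards [hc] with z hz
    rw [← hz]
    have h1 : (core.localTriv x (Φ z)).2 =
      (e x (Φ z).1).symm (e (Φ z).1 (Φ z).1 (Φ z).2) := rfl
    have h2 : e x z = e x (Φ z).1 := by rw [hproj z]
    rw [h1, h2]
    exact ((e x (Φ z).1).apply_symm_apply _).symm

variable {M : Type*} [TopologicalSpace M] [ChartedSpace (EuclideanSpace ℝ (Fin 5)) M]
  [IsManifold (𝓡 5) ∞ M]

namespace Background

variable {ι : Type*} (B : Background M ι)

theorem superconnection_congr {s t : ∀ x : M, B.spinStr.Fiber x} {x : M}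
    (h : ∀ᶠ y in 𝓝 x, s y = t y) : B.superconnection s x = B.superconnection t x := by
  have h1 : B.localRep (B.spinStr.indexAt x) s =ᶠ[𝓝 x] B.localRep (B.spinStr.indexAt x) t := by
    filter_upwards [h] with y hy
    rw [localRep, localRep, hy]
  refine ContinuousLinearMap.ext fun v ↦ ?_
  have e : ∀ s, B.superconnection s x v = mvfderiv (𝓡 5) (B.localRep (B.spinStr.indexAt x) s) x v +
    B.spinStr.spinForm (B.spinStr.indexAt x) x v (s x) +
      -(B.betaOp (B.spinStr.indexAt x) x v (s x)) := fun _ ↦ rfl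
  rw [e, e, mvfderiv_congr h1, h.self_of_nhds]

-- Being parallel is a local condition, so a field that is locally one of the given parallel fields
-- is parallel.
variable {B} in
theorem ParallelOn.of_eventually_eq {s : ∀ x : M, B.spinStr.Fiber x}
    (h : ∀ x, ∃ t : ∀ x : M, B.spinStr.Fiber x, ∃ U, x ∈ U ∧ B.ParallelOn t U ∧
      ∀ᶠ y in 𝓝 x, s y = t y) : B.ParallelOn s Set.univ := fun y _ ↦ by
  obtain ⟨t, U, hy, ht, hst⟩ := h y
  refine ⟨(ht y hy).1.congr_of_eventuallyEq ?_, (B.superconnection_congr hst).trans (ht y hy).2⟩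
  filter_upwards [hst] with z hz
  rw [hz]

/-- A flat superconnection admits local parallel spinor fields with given initial values, which
evaluate bijectively at all points of their domain. -/
theorem exists_local_parallel_family [T2Space M] (hflat : B.IsFlat) (x : M) :
    ∃ U : Set M, IsOpen U ∧ x ∈ U ∧ ∃ s : S → ∀ y : M, B.spinStr.Fiber y,
      (∀ c, B.ParallelOn (s c) U) ∧
      ∀ y ∈ U, Function.Bijective (fun c ↦ (show S from s c y)) := by
  obtain ⟨r, hr, hsub, hex⟩ := B.exists_parallelOn_of_flat (B.spinStr.mem_baseSet_at x)
    fun z hz v w p ↦ B.chartCurvature_eq_zero_of_isFlat hflat x _ hz v w p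
  choose s hs0 hs using hex
  have hx := mem_chartBall_self x hr
  refine ⟨chartBall x r, isOpen_chartBall x r, hx, s, hs, fun y hy ↦ ?_⟩
  -- Uniqueness of parallel fields makes the value at `y` linear in the value at `x`, and also
  -- injective. Bijectivity follows because `S` is finite-dimensional.
  let T : S →ₗ[ℝ] S :=
    { toFun := fun c ↦ s c y
      map_add' := fun c d ↦ B.eq_of_parallelOn hsub (hs (c + d)) ((hs c).add (hs d)) hx hy
        ((hs0 (c + d)).trans (congrArg₂ (fun a b : S ↦ a + b) (hs0 c) (hs0 d)).symm)
      map_smul' := fun a c ↦ B.eq_of_parallelOn hsub (hs (a • c)) ((hs c).const_smul a) hx hy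
        ((hs0 (a • c)).trans (congrArg (fun b : S ↦ a • b) (hs0 c)).symm) }
  have hT : Function.Injective T := fun c d h ↦ by
    have h1 := B.eq_of_parallelOn hsub (hs c) (hs d) hy hx h
    exact (hs0 c).symm.trans (h1.trans (hs0 d))
  exact ⟨hT, LinearMap.injective_iff_surjective.1 hT⟩

/-- On a simply connected manifold, a flat superconnection admits global parallel spinor fields. -/
theorem exists_parallelOn_univ_of_isFlat [T2Space M] [SimplyConnectedSpace M] (hflat : B.IsFlat)
    (x₀ : M) (c : S) : ∃ s : ∀ x : M, B.spinStr.Fiber x, s x₀ = c ∧ B.ParallelOn s Set.univ := by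
  have := ChartedSpace.locallyPathConnectedSpace (EuclideanSpace ℝ (Fin 5)) M
  choose U hU hmem s hs hbij using B.exists_local_parallel_family hflat
  -- Outside `U x` the equivalence is an arbitrary filler; the cocycle is only tested on overlaps.
  have hex : ∀ x y, ∃ f : S ≃ S, y ∈ U x → ∀ c, f c = s x c y := fun x y ↦ by
    by_cases h : y ∈ U x
    · exact ⟨Equiv.ofBijective _ (hbij x y h), fun _ _ ↦ rfl⟩
    · exact ⟨Equiv.refl S, fun h' ↦ absurd h' h⟩
  choose e he using hex
  obtain ⟨σ, hσ, hσ'⟩ := exists_section_of_locally_constant_cocycle U hU hmem e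
    (fun x y c z hz ↦ by
      -- The members labelled `c` around `x` and `d` around `y` agree at `z`, hence near `z`, so the
      -- relabelling is locally constant.
      obtain ⟨d, hd⟩ : ∃ d, d = (e y z).symm (e x z c) := ⟨_, rfl⟩
      have h1 : s x c z = s y d z := by
        refine (he x z hz.1 c).symm.trans (Eq.trans ?_ (he y z hz.2 d))
        rw [hd, Equiv.apply_symm_apply]
      have hUU := (hU x).inter (hU y)
      filter_upwards [B.eventually_eq_of_parallelOn hUU ((hs x c).mono Set.inter_subset_left)
        ((hs y d).mono Set.inter_subset_right) hz h1, hUU.mem_nhds hz] with w hw hwU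
      rw [← hd, Equiv.symm_apply_eq]
      exact (he x w hwU.1 c).trans (hw.trans (he y w hwU.2 d).symm)) x₀ c
  refine ⟨σ, hσ, ParallelOn.of_eventually_eq fun x ↦ ?_⟩
  obtain ⟨a, ha⟩ := hσ' x
  refine ⟨s x a, U x, hmem x, hs x a, ?_⟩
  filter_upwards [ha, (hU x).mem_nhds (hmem x)] with z hz hzU
  exact hz.trans (he x z hzU a)

theorem mem_killingSpinors {k : B.spinStr.SpinorField} :
    k ∈ B.killingSpinors ↔ ∀ x, B.superconnection k x = 0 := Iff.rfl

variable {B} in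
theorem ParallelOn.contMDiff {s : ∀ x : M, B.spinStr.Fiber x} (hs : B.ParallelOn s Set.univ) :
    ContMDiff (𝓡 5) ((𝓡 5).prod 𝓘(ℝ, S)) ∞ (fun x ↦ TotalSpace.mk' S x (s x)) :=
  fun y ↦ (hs y (Set.mem_univ y)).1

variable {B} in
theorem ParallelOn.exists_spinorField {s : ∀ x : M, B.spinStr.Fiber x}
    (hs : B.ParallelOn s Set.univ) :
    ∃ k : B.spinStr.SpinorField, (k : ∀ x : M, B.spinStr.Fiber x) = s :=
  ⟨⟨s, hs.contMDiff⟩, rfl⟩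

variable {B} in
theorem ParallelOn.exists_mem_killingSpinors {s : ∀ x : M, B.spinStr.Fiber x}
    (hs : B.ParallelOn s Set.univ) :
    ∃ k ∈ B.killingSpinors, (k : ∀ x : M, B.spinStr.Fiber x) = s := by
  obtain ⟨k, rfl⟩ := hs.exists_spinorField
  exact ⟨k, B.mem_killingSpinors.2 fun y ↦ (hs y (Set.mem_univ y)).2, rfl⟩

theorem evalKilling_surjective_of_isFlat [T2Space M] [SimplyConnectedSpace M] (hflat : B.IsFlat)
    (x : M) : Function.Surjective (B.evalKilling x) := fun c ↦ by
  obtain ⟨s, hs, hs'⟩ := B.exists_parallelOn_univ_of_isFlat hflat x c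
  obtain ⟨k, hk, hks⟩ := hs'.exists_mem_killingSpinors
  exact ⟨⟨k, hk⟩, (congrFun hks x).trans hs⟩

/-- On a simply connected manifold, a background with flat superconnection is maximally
supersymmetric. -/
theorem isMaximallySupersymmetric_of_isFlat [T2Space M] [ConnectedSpace M]
    [SimplyConnectedSpace M] (hflat : B.IsFlat) : B.IsMaximallySupersymmetric := by
  have hne : Nonempty M := ConnectedSpace.toNonempty
  have hb : Function.Bijective (B.evalKilling hne.some) :=
    ⟨B.evalKilling_injective _, B.evalKilling_surjective_of_isFlat hflat _⟩
  have h := LinearEquiv.finrank_eq (LinearEquiv.ofBijective _ hb)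
  exact h

end Background

end Susy5

end

/-- Let `(M, g, C, F)` be a connected five-dimensional bosonic background. If it is maximally
supersymmetric, then the superconnection is flat. Conversely, if `M` is simply connected and the
superconnection is flat, then the background is maximally supersymmetric. -/
theorem mainTheorem7 {M : Type*} [TopologicalSpace M] [T2Space M] [SecondCountableTopology M]
    [ConnectedSpace M] [ChartedSpace (EuclideanSpace ℝ (Fin 5)) M] [IsManifold (𝓡 5) ∞ M]
    {ι : Type*} (B : Susy5.Background M ι) :
    (B.IsMaximallySupersymmetric → B.IsFlat) ∧
      (SimplyConnectedSpace M → B.IsFlat → B.IsMaximallySupersymmetric) := by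
  exact ⟨fun h ↦ h.isFlat, fun _ hflat ↦ B.isMaximallySupersymmetric_of_isFlat hflat⟩
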